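/- Setting. Let $\mathfrak g$ be a finite-dimensional complex reductive Lie algebra (its radical is its center), and let $B$ be an invariant bilinear form on $\mathfrak g$ that coincides with the Killing form of $[\mathfrak g,\mathfrak g]$ on $[\mathfrak g,\mathfrak g]$. Let $\xi_0\in\mathfrak g$ be such that $\operatorname{ad}\xi_0$ is diagonalizable with real eigenvalues. Let $\mathfrak h$ be the centralizer of $\xi_0$, and let $\mathfrak u$ (resp. $\bar{\mathfrak u}$) be the sum of the eigenspaces of $\operatorname{ad}\xi_0$ for the positive (resp. negative) eigenvalues. Each basis $X_1,\dots,X_n$ of $\mathfrak u$ has a unique dual basis $\xi_1,\dots,\xi_n$ of $\bar{\mathfrak u}$, with $B(X_i,\xi_j)=\delta_{ij}$. On $\wedge\bar{\mathfrak u}$ let $e(\xi)$ be the exterior product with $\xi\in\bar{\mathfrak u}$, let $\iota(Z)$, for $Z\in\mathfrak g$, be the antiderivation extending $\xi\mapsto B(Z,\xi)$, and let $\tau(Y)$, for $Y\in\mathfrak h$, be the derivation extending $\operatorname{ad}(Y)|_{\bar{\mathfrak u}}$. For a Lie algebra $\mathfrak l$ write $\mathcal Z(\mathfrak l)$ for the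 center of the enveloping algebra $\mathcal U(\mathfrak l)$. Let $\delta_{\mathfrak h}:\mathcal U(\mathfrak h)\to\mathcal U(\mathfrak g)\otimes\operatorname{End}(\wedge\bar{\mathfrak u})$ be the algebra homomorphism with $\delta_{\mathfrak h}(Y)=Y\otimes1+1\otimes\tau(Y)$ for $Y\in\mathfrak h$. Let $\mathcal A$ be the algebra of $\mathfrak h$-invariant elements of $\mathcal U(\mathfrak g)\otimes\operatorname{End}(\wedge\bar{\mathfrak u})$, that is, of the elements that commute with all $\delta_{\mathfrak h}(Y)$, $Y\in\mathfrak h$. (If $\mathfrak h$ is the complexified Lie algebra of a connected group $H$ whose action integrates that of $\mathfrak h$, these are the $H$-invariants.) Let $\gamma$ be the grading operator of $\mathcal A$ that comes from the parity of $\operatorname{End}(\wedge\bar{\mathfrak u})$. The abstract Dolbeault operator is the odd element $$\bar\partial=\sum_i X_i\otimes e(\xi_i)-\sum_{i<j}1\otimes e(\xi_i)e(\xi_j)\iota([X_i,X_j]),$$ and $d_{\bar\partial}(b)=\bar\partial b-\gamma(b)\bar\partial$ for $b\in\mathcal A$ is the graded commutator with it. Theorem. One has $\bar\partial\in\mathcal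 A$ and $\bar\partial^2=0$, so that $d_{\bar\partial}$ is a differential on $\mathcal A$, and $$\ker d_{\bar\partial}=\delta_{\mathfrak h}(\mathcal Z(\mathfrak h))\oplus\operatorname{im}d_{\bar\partial}.$$ Moreover $w\mapsto[\delta_{\mathfrak h}(w)]$ is an isomorphism of algebras from $\mathcal Z(\mathfrak h)$ onto $H_{d_{\bar\partial}}=\ker d_{\bar\partial}/\operatorname{im}d_{\bar\partial}$. Composing $\mathcal Z(\mathfrak g)\to H_{d_{\bar\partial}}$, $z\mapsto[z\otimes1]$, with its inverse defines an algebra homomorphism $\zeta_{\bar\partial}:\mathcal Z(\mathfrak g)\to\mathcal Z(\mathfrak h)$. Finally, the natural map $\mathcal U(\mathfrak h)\to\mathcal U(\mathfrak g)$ is injective, $\mathcal U(\mathfrak g)=\mathcal U(\mathfrak h)\oplus\big(\bar{\mathfrak u}\,\mathcal U(\mathfrak g)+\mathcal U(\mathfrak g)\,\mathfrak u\big)$, and if $p$ denotes the projection on the first summand, then $\zeta_{\bar\partial}(z)=p(z)$ for all $z\in\mathcal Z(\mathfrak g)$. -/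

import Mathlib

open scoped TensorProduct

noncomputable section

namespace Dolbeault

attribute [local instance 100] LieRing.ofAssociativeRing

/-! ### Graded commutators and their cohomology -/

section Graded

variable {A : Type*} [Ring A] [Algebra ℂ A]

/-- The graded commutator `d_a(b) = a b - γ(b) a` with an odd element `a` of a `ℤ/2`-graded
algebra with grading operator `γ`. -/
def gradedComm (γ : A →ₐ[ℂ] A) (a : A) : A →ₗ[ℂ] A :=
  LinearMap.mulLeft ℂ a - (LinearMap.mulRight ℂ a).comp γ.toLinearMap

@[simp] theorem gradedComm_apply (γ : A →ₐ[ℂ] A) (a b : A) :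
    gradedComm γ a b = a * b - γ b * a := rfl

theorem gradedComm_mul (γ : A →ₐ[ℂ] A) (a b c : A) :
    gradedComm γ a (b * c) = gradedComm γ a b * c + γ b * gradedComm γ a c := by
  simp only [gradedComm_apply, map_mul]; noncomm_ring

/-- The kernel of `d_a` acting on the subalgebra `S`; it is again a subalgebra. -/
def kerComm (S : Subalgebra ℂ A) (γ : A →ₐ[ℂ] A) (a : A) : Subalgebra ℂ A where
  carrier := {b | b ∈ S ∧ gradedComm γ a b = 0}
  mul_mem' := fun {b c} hb hc => ⟨S.mul_mem hb.1 hc.1, by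
    rw [gradedComm_mul, hb.2, hc.2]; simp⟩
  add_mem' := fun {b c} hb hc => ⟨S.add_mem hb.1 hc.1, by
    rw [map_add, hb.2, hc.2, add_zero]⟩
  algebraMap_mem' := fun r => ⟨S.algebraMap_mem r, by
    rw [gradedComm_apply, AlgHom.commutes, Algebra.commutes, sub_self]⟩

/-- The image of `d_a` acting on the subalgebra `S`. -/
def imComm (S : Subalgebra ℂ A) (γ : A →ₐ[ℂ] A) (a : A) : Submodule ℂ A :=
  (Subalgebra.toSubmodule S).map (gradedComm γ a)

/-- Congruence modulo the two-sided ideal `im d_a ∩ ker d_a` of `ker d_a`, for an odd element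
`a` and a graded subalgebra `S`. -/
def cohCon (S : Subalgebra ℂ A) (γ : A →ₐ[ℂ] A) (a : A) (hγ : ∀ b, γ (γ b) = b)
    (hS : ∀ b ∈ S, γ b ∈ S) (ha : γ a = -a) : RingCon (kerComm S γ a) where
  r b c := (b : A) - (c : A) ∈ imComm S γ a
  iseqv :=
    { refl := fun b => by simp
      symm := fun {b c} h => by simpa using (imComm S γ a).neg_mem h
      trans := fun {b c e} h h' => by simpa using (imComm S γ a).add_mem h h' }
  add' := fun {b c e f} h h' => by
    have := (imComm S γ a).add_mem h h'
    simpa [add_sub_add_comm] using this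
  mul' := fun {b c e f} h h' => by
    obtain ⟨x, hx, hx'⟩ := h
    obtain ⟨y, hy, hy'⟩ := h'
    refine ⟨x * (e : A) + γ (c : A) * y,
      S.add_mem (S.mul_mem hx e.2.1) (S.mul_mem (hS _ c.2.1) hy), ?_⟩
    have hc : gradedComm γ a (γ (c : A)) = 0 := by
      have h0 : gradedComm γ a (c : A) = 0 := c.2.2
      have h1 : γ (gradedComm γ a (c : A)) = 0 := by rw [h0, map_zero]
      rw [gradedComm_apply, map_sub, map_mul, map_mul, ha, hγ] at h1
      rw [gradedComm_apply, hγ]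
      have h2 : a * γ (c : A) - (c : A) * a = -(-a * γ (c : A) - (c : A) * -a) := by
        noncomm_ring
      rw [h2, h1, neg_zero]
    have he : gradedComm γ a (e : A) = 0 := e.2.2
    rw [map_add, gradedComm_mul, gradedComm_mul, he, hc, hγ, hx', hy']
    simp only [Subalgebra.coe_mul]
    noncomm_ring

end Graded

/-! ### The derivation of an exterior algebra induced by an endomorphism -/

section Exterior

variable {M : Type*} [AddCommGroup M] [Module ℂ M]

/-- The homomorphism `∧M → (∧M)[ε]` with `m ↦ m + ε f(m)`. -/
def extDerAux (f : Module.End ℂ M) :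
    ExteriorAlgebra ℂ M →ₐ[ℂ] TrivSqZeroExt (ExteriorAlgebra ℂ M) (ExteriorAlgebra ℂ M) :=
  ExteriorAlgebra.lift ℂ
    ⟨(TrivSqZeroExt.inlAlgHom ℂ (ExteriorAlgebra ℂ M) (ExteriorAlgebra ℂ M)).toLinearMap ∘ₗ
        ExteriorAlgebra.ι ℂ +
      ((TrivSqZeroExt.inrHom (ExteriorAlgebra ℂ M) (ExteriorAlgebra ℂ M)).restrictScalars ℂ) ∘ₗ
        ExteriorAlgebra.ι ℂ ∘ₗ f, fun m => by
      ext
      · simp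
      · simp [ExteriorAlgebra.ι_add_mul_swap]⟩

/-- The unique derivation of the algebra `∧M` extending the endomorphism `f` of `M`. -/
def extDer (f : Module.End ℂ M) : Module.End ℂ (ExteriorAlgebra ℂ M) :=
  (TrivSqZeroExt.sndHom (ExteriorAlgebra ℂ M) (ExteriorAlgebra ℂ M)).restrictScalars ℂ ∘ₗ
    (extDerAux f).toLinearMap

theorem extDerAux_fst (f : Module.End ℂ M) (x : ExteriorAlgebra ℂ M) :
    (extDerAux f x).fst = x := by
  have : (TrivSqZeroExt.fstHom ℂ (ExteriorAlgebra ℂ M) (ExteriorAlgebra ℂ M)).comp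
      (extDerAux f) = AlgHom.id ℂ _ := by
    ext m; simp [extDerAux]
  exact DFunLike.congr_fun this x

theorem extDer_ι (f : Module.End ℂ M) (m : M) :
    extDer f (ExteriorAlgebra.ι ℂ m) = ExteriorAlgebra.ι ℂ (f m) := by
  simp [extDer, extDerAux]

theorem extDer_mul (f : Module.End ℂ M) (x y : ExteriorAlgebra ℂ M) :
    extDer f (x * y) = extDer f x * y + x * extDer f y := by
  simp [extDer, extDerAux_fst, add_comm]

theorem extDer_algebraMap (f : Module.End ℂ M) (r : ℂ) :
    extDer f (algebraMap ℂ _ r) = 0 := by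
  simp [extDer, TrivSqZeroExt.algebraMap_eq_inl']

/-- Two derivations of `∧M` which agree on `M` are equal. -/
theorem ext_of_derivation {D E : Module.End ℂ (ExteriorAlgebra ℂ M)}
    (hD : ∀ x y, D (x * y) = D x * y + x * D y) (hE : ∀ x y, E (x * y) = E x * y + x * E y)
    (h : ∀ m, D (ExteriorAlgebra.ι ℂ m) = E (ExteriorAlgebra.ι ℂ m)) : D = E := by
  have h1 : ∀ F : Module.End ℂ (ExteriorAlgebra ℂ M),
      (∀ x y, F (x * y) = F x * y + x * F y) → F 1 = 0 := fun F hF => by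
    have := hF 1 1
    simpa using this
  refine LinearMap.ext fun x => ?_
  induction x using ExteriorAlgebra.induction with
  | algebraMap r => rw [Algebra.algebraMap_eq_smul_one, map_smul, map_smul, h1 D hD, h1 E hE]
  | ι m => exact h m
  | mul a b ha hb => rw [hD, hE, ha, hb]
  | add a b ha hb => rw [map_add, map_add, ha, hb]

/-- `f ↦ extDer f` as a homomorphism of Lie algebras. -/
def extDerHom : Module.End ℂ M →ₗ⁅ℂ⁆ Module.End ℂ (ExteriorAlgebra ℂ M) where
  toFun := extDer
  map_add' f g := ext_of_derivation (extDer_mul _)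
    (fun x y => by simp only [LinearMap.add_apply, extDer_mul]; noncomm_ring)
    (fun m => by simp [extDer_ι])
  map_smul' r f := ext_of_derivation (extDer_mul _)
    (fun x y => by simp [extDer_mul])
    (fun m => by simp [extDer_ι])
  map_lie' {f g} := ext_of_derivation (extDer_mul _)
    (fun x y => by simp only [Ring.lie_def, LinearMap.sub_apply, Module.End.mul_apply,
      extDer_mul, map_add]; noncomm_ring)
    (fun m => by simp [extDer_ι, Ring.lie_def])

/-- The exterior product `e(m)` on `∧M`. -/
def extMul (m : M) : Module.End ℂ (ExteriorAlgebra ℂ M) :=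
  LinearMap.mulLeft ℂ (ExteriorAlgebra.ι ℂ m)

/-- The interior product on `∧M` with a linear form: the antiderivation extending `φ`. -/
def intProd (φ : Module.Dual ℂ M) : Module.End ℂ (ExteriorAlgebra ℂ M) :=
  CliffordAlgebra.contractLeft φ

/-- The grading operator of `End(∧M)`: conjugation by the parity involution of `∧M`. -/
def endParity (M : Type*) [AddCommGroup M] [Module ℂ M] :
    Module.End ℂ (ExteriorAlgebra ℂ M) →ₐ[ℂ] Module.End ℂ (ExteriorAlgebra ℂ M) :=
  ((CliffordAlgebra.involuteEquiv
    (Q := (0 : QuadraticForm ℂ M))).toLinearEquiv.conjAlgEquiv ℂ).toAlgHom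

theorem endParity_apply (T : Module.End ℂ (ExteriorAlgebra ℂ M)) (x : ExteriorAlgebra ℂ M) :
    endParity M T x = CliffordAlgebra.involute (T (CliffordAlgebra.involute x)) := rfl

theorem endParity_endParity (T : Module.End ℂ (ExteriorAlgebra ℂ M)) :
    endParity M (endParity M T) = T := by
  refine LinearMap.ext fun x => ?_
  simp [endParity_apply]

theorem endParity_extMul (m : M) : endParity M (extMul m) = -extMul m := by
  refine LinearMap.ext fun x => ?_
  simp only [endParity_apply, extMul, LinearMap.mulLeft_apply, map_mul, LinearMap.neg_apply,
    CliffordAlgebra.involute_involute, ExteriorAlgebra.ι, CliffordAlgebra.involute_ι, neg_mul]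

theorem involute_intProd (φ : Module.Dual ℂ M) (x : ExteriorAlgebra ℂ M) :
    CliffordAlgebra.involute (intProd φ x) = -intProd φ (CliffordAlgebra.involute x) := by
  induction x using CliffordAlgebra.left_induction with
  | algebraMap r => simp [intProd, CliffordAlgebra.contractLeft_algebraMap]
  | add x y hx hy => rw [map_add, map_add, hx, hy, map_add, map_add, neg_add]
  | ι_mul x m hx =>
    simp only [intProd] at hx ⊢
    rw [CliffordAlgebra.contractLeft_ι_mul, map_sub, map_smul, map_mul, map_mul,
      CliffordAlgebra.involute_ι, hx]
    simp only [neg_mul, map_neg, CliffordAlgebra.contractLeft_ι_mul, mul_neg, neg_neg]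

theorem endParity_intProd (φ : Module.Dual ℂ M) :
    endParity M (intProd φ) = -intProd φ := by
  refine LinearMap.ext fun x => ?_
  rw [endParity_apply, involute_intProd, CliffordAlgebra.involute_involute, LinearMap.neg_apply]

theorem endParity_extDer (f : Module.End ℂ M) : endParity M (extDer f) = extDer f := by
  refine ext_of_derivation (fun x y => ?_) (extDer_mul f) (fun m => ?_)
  · simp only [endParity_apply, map_mul, extDer_mul, map_add, CliffordAlgebra.involute_involute]
  · have h : CliffordAlgebra.involute (ExteriorAlgebra.ι ℂ m) = -ExteriorAlgebra.ι ℂ m :=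
      CliffordAlgebra.involute_ι m
    have h' : CliffordAlgebra.involute (ExteriorAlgebra.ι ℂ (f m)) =
      -ExteriorAlgebra.ι ℂ (f m) := CliffordAlgebra.involute_ι (f m)
    rw [endParity_apply, h, map_neg, map_neg, extDer_ι, h', neg_neg]

end Exterior

/-! ### The subalgebras `𝔥`, `𝔲`, `𝔲bar` and the Dolbeault operator -/

section Lie

variable {𝔤 : Type*} [LieRing 𝔤] [LieAlgebra ℂ 𝔤]

/-- The centralizer `𝔥` of `ξ₀`. -/
def levi (ξ₀ : 𝔤) : LieSubalgebra ℂ 𝔤 where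
  carrier := {Y | ⁅ξ₀, Y⁆ = 0}
  add_mem' := fun {a b} ha hb => by
    simp only [Set.mem_ofPred_eq] at ha hb ⊢; rw [lie_add, ha, hb, add_zero]
  zero_mem' := lie_zero _
  smul_mem' := fun c x hx => by
    simp only [Set.mem_ofPred_eq] at hx ⊢; rw [lie_smul, hx, smul_zero]
  lie_mem' := fun {a b} ha hb => by
    change ⁅ξ₀, a⁆ = 0 at ha
    change ⁅ξ₀, b⁆ = 0 at hb
    change ⁅ξ₀, ⁅a, b⁆⁆ = 0
    rw [leibniz_lie, ha, hb, zero_lie, lie_zero, add_zero]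

/-- `𝔲`: the sum of the eigenspaces of `ad ξ₀` for positive real eigenvalues. -/
def nilPos (ξ₀ : 𝔤) : Submodule ℂ 𝔤 :=
  ⨆ (t : ℝ) (_ : 0 < t), (LieAlgebra.ad ℂ 𝔤 ξ₀).eigenspace (t : ℂ)

/-- `𝔲bar`: the sum of the eigenspaces of `ad ξ₀` for negative real eigenvalues, with the adjoint
action of `𝔥`. -/
def nilNeg (ξ₀ : 𝔤) : LieSubmodule ℂ (levi ξ₀) 𝔤 where
  toSubmodule := ⨆ (t : ℝ) (_ : t < 0), (LieAlgebra.ad ℂ 𝔤 ξ₀).eigenspace (t : ℂ)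
  lie_mem := by
    intro Y m hm
    have key : (⨆ (t : ℝ) (_ : t < 0), (LieAlgebra.ad ℂ 𝔤 ξ₀).eigenspace (t : ℂ)) ≤
        (⨆ (t : ℝ) (_ : t < 0), (LieAlgebra.ad ℂ 𝔤 ξ₀).eigenspace (t : ℂ)).comap
          (LieAlgebra.ad ℂ 𝔤 (Y : 𝔤)) := by
      refine iSup₂_le fun t ht x hx => ?_
      refine Submodule.mem_iSup_of_mem t (Submodule.mem_iSup_of_mem ht ?_)
      rw [Module.End.mem_eigenspace_iff, LieAlgebra.ad_apply] at hx ⊢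
      have hY : ⁅ξ₀, (Y : 𝔤)⁆ = 0 := Y.2
      rw [LieAlgebra.ad_apply, leibniz_lie, hY, zero_lie, zero_add, hx, lie_smul]
    exact key hm

/-- The exterior algebra of `𝔲bar`. -/
abbrev ExtNeg (ξ₀ : 𝔤) : Type _ := ExteriorAlgebra ℂ (nilNeg ξ₀)

/-- The algebra `U(𝔤) ⊗ End(∧𝔲bar)`. -/
abbrev BigAlg (ξ₀ : 𝔤) : Type _ :=
  UniversalEnvelopingAlgebra ℂ 𝔤 ⊗[ℂ] Module.End ℂ (ExtNeg ξ₀)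

/-- The grading operator of `U(𝔤) ⊗ End(∧𝔲bar)`, coming from the parity of `End(∧𝔲bar)`. -/
def parity (ξ₀ : 𝔤) : BigAlg ξ₀ →ₐ[ℂ] BigAlg ξ₀ :=
  Algebra.TensorProduct.map (AlgHom.id ℂ (UniversalEnvelopingAlgebra ℂ 𝔤))
    (endParity (nilNeg ξ₀))

theorem parity_parity (ξ₀ : 𝔤) (b : BigAlg ξ₀) : parity ξ₀ (parity ξ₀ b) = b := by
  induction b using TensorProduct.induction_on with
  | zero => simp
  | tmul x T => simp [parity, endParity_endParity]
  | add x y hx hy => rw [map_add, map_add, hx, hy]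

/-- The action `τ` of `𝔥` on `∧𝔲bar`, extending the adjoint action on `𝔲bar`. -/
def leviAct (ξ₀ : 𝔤) : levi ξ₀ →ₗ⁅ℂ⁆ Module.End ℂ (ExtNeg ξ₀) :=
  extDerHom.comp (LieModule.toEnd ℂ (levi ξ₀) (nilNeg ξ₀))

/-- `Y ↦ Y ⊗ 1 + 1 ⊗ τ(Y)` on `𝔥`. -/
def deltaLie (ξ₀ : 𝔤) : levi ξ₀ →ₗ⁅ℂ⁆ BigAlg ξ₀ where
  toFun Y := UniversalEnvelopingAlgebra.ι ℂ (Y : 𝔤) ⊗ₜ[ℂ] 1 + 1 ⊗ₜ[ℂ] leviAct ξ₀ Y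
  map_add' Y Z := by
    have h : ((Y + Z : levi ξ₀) : 𝔤) = (Y : 𝔤) + (Z : 𝔤) := rfl
    simp only [h, map_add, TensorProduct.add_tmul, TensorProduct.tmul_add]
    abel
  map_smul' r Y := by
    have h : ((r • Y : levi ξ₀) : 𝔤) = r • (Y : 𝔤) := rfl
    rw [h, map_smul, map_smul, RingHom.id_apply, smul_add, TensorProduct.smul_tmul',
      TensorProduct.tmul_smul]
  map_lie' {Y Z} := by
    simp only [LieSubalgebra.coe_bracket, LieHom.map_lie, Ring.lie_def, mul_add, add_mul,
      Algebra.TensorProduct.tmul_mul_tmul, one_mul, mul_one, TensorProduct.sub_tmul,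
      TensorProduct.tmul_sub]
    abel

/-- `δ_𝔥 : U(𝔥) → U(𝔤) ⊗ End(∧𝔲bar)`. -/
def delta (ξ₀ : 𝔤) : UniversalEnvelopingAlgebra ℂ (levi ξ₀) →ₐ[ℂ] BigAlg ξ₀ :=
  UniversalEnvelopingAlgebra.lift ℂ (deltaLie ξ₀)

/-- The algebra of abstract differential operators: the elements of `U(𝔤) ⊗ End(∧𝔲bar)`
that are invariant under the adjoint action of `𝔥`, i.e. that commute with `Y ⊗ 1 + 1 ⊗ τ(Y)` for
`Y ∈ 𝔥`. -/
def invAlg (ξ₀ : 𝔤) : Subalgebra ℂ (BigAlg ξ₀) :=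
  Subalgebra.centralizer ℂ (Set.range (deltaLie ξ₀))

theorem parity_deltaLie (ξ₀ : 𝔤) (Y : levi ξ₀) :
    parity ξ₀ (deltaLie ξ₀ Y) = deltaLie ξ₀ Y := by
  have h : endParity (nilNeg ξ₀) (leviAct ξ₀ Y) = leviAct ξ₀ Y := endParity_extDer _
  change parity ξ₀ (UniversalEnvelopingAlgebra.ι ℂ (Y : 𝔤) ⊗ₜ[ℂ] 1 +
    1 ⊗ₜ[ℂ] leviAct ξ₀ Y) = UniversalEnvelopingAlgebra.ι ℂ (Y : 𝔤) ⊗ₜ[ℂ] 1 +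
    1 ⊗ₜ[ℂ] leviAct ξ₀ Y
  rw [parity, map_add, Algebra.TensorProduct.map_tmul, Algebra.TensorProduct.map_tmul, h,
    map_one, map_one, AlgHom.id_apply]

theorem parity_mem_invAlg (ξ₀ : 𝔤) (b : BigAlg ξ₀) (hb : b ∈ invAlg ξ₀) :
    parity ξ₀ b ∈ invAlg ξ₀ := by
  rw [invAlg, Subalgebra.mem_centralizer_iff] at hb ⊢
  rintro _ ⟨Y, rfl⟩
  have := congrArg (parity ξ₀) (hb _ ⟨Y, rfl⟩)
  simpa only [map_mul, parity_deltaLie] using this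

/-- The interior product `ι(Z)` on `∧𝔲bar` with `Z`, through the linear form `B(Z, ·)` on
`𝔲bar`. -/
def intProdLie (B : LinearMap.BilinForm ℂ 𝔤) (ξ₀ : 𝔤) (Z : 𝔤) : Module.End ℂ (ExtNeg ξ₀) :=
  intProd ((B Z).comp (nilNeg ξ₀).toSubmodule.subtype)

/-- The abstract Dolbeault operator
`∑ i, X i ⊗ e(ξ i) - ∑ i < j, 1 ⊗ e(ξ i) e(ξ j) ι([X i, X j])`. -/
def dolbeault (B : LinearMap.BilinForm ℂ 𝔤) (ξ₀ : 𝔤) {n : ℕ} (X : Fin n → nilPos ξ₀)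
    (ξ : Fin n → nilNeg ξ₀) : BigAlg ξ₀ :=
  ∑ i, UniversalEnvelopingAlgebra.ι ℂ (X i : 𝔤) ⊗ₜ[ℂ] extMul (ξ i) -
    ∑ i, ∑ j ∈ Finset.Ioi i, 1 ⊗ₜ[ℂ]
      (extMul (ξ i) * extMul (ξ j) * intProdLie B ξ₀ ⁅(X i : 𝔤), (X j : 𝔤)⁆)

/-- The Dolbeault operator is odd. -/
theorem parity_dolbeault (B : LinearMap.BilinForm ℂ 𝔤) (ξ₀ : 𝔤) {n : ℕ}
    (X : Fin n → nilPos ξ₀) (ξ : Fin n → nilNeg ξ₀) :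
    parity ξ₀ (dolbeault B ξ₀ X ξ) = -dolbeault B ξ₀ X ξ := by
  have h1 : ∀ m : nilNeg ξ₀, endParity (nilNeg ξ₀) (extMul m) = -extMul m := endParity_extMul
  have h2 : ∀ Z : 𝔤, endParity (nilNeg ξ₀) (intProdLie B ξ₀ Z) = -intProdLie B ξ₀ Z :=
    fun Z => endParity_intProd _
  have h3 : ∀ i j, endParity (nilNeg ξ₀) (extMul (ξ i) * extMul (ξ j) *
      intProdLie B ξ₀ ⁅(X i : 𝔤), (X j : 𝔤)⁆) =
      -(extMul (ξ i) * extMul (ξ j) * intProdLie B ξ₀ ⁅(X i : 𝔤), (X j : 𝔤)⁆) := fun i j => by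
    rw [map_mul, map_mul, h1, h1, h2]; noncomm_ring
  simp only [dolbeault, parity, map_sub, map_sum, Algebra.TensorProduct.map_tmul, h1, h3,
    AlgHom.id_apply, map_one, TensorProduct.tmul_neg, Finset.sum_neg_distrib]
  abel

/-- The kernel of `d_D` on the algebra of abstract differential operators. -/
abbrev kerD {ξ₀ : 𝔤} (D : BigAlg ξ₀) : Subalgebra ℂ (BigAlg ξ₀) :=
  kerComm (invAlg ξ₀) (parity ξ₀) D

/-- The image of `d_D` on the algebra of abstract differential operators. -/
abbrev imD {ξ₀ : 𝔤} (D : BigAlg ξ₀) : Submodule ℂ (BigAlg ξ₀) :=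
  imComm (invAlg ξ₀) (parity ξ₀) D

/-- The cohomology algebra `ker d_D / im d_D`. -/
abbrev Coh {ξ₀ : 𝔤} (D : BigAlg ξ₀) (hD : parity ξ₀ D = -D) : Type _ :=
  (cohCon (invAlg ξ₀) (parity ξ₀) D (parity_parity ξ₀) (parity_mem_invAlg ξ₀) hD).Quotient

/-- The class in `Coh D` of an element of `ker d_D`. -/
def cohClass {ξ₀ : 𝔤} (D : BigAlg ξ₀) (hD : parity ξ₀ D = -D) : kerD D →ₐ[ℂ] Coh D hD :=
  RingCon.mkₐ ℂ _

theorem cohClass_eq_iff {ξ₀ : 𝔤} (D : BigAlg ξ₀) (hD : parity ξ₀ D = -D) (b c : kerD D) :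
    cohClass D hD b = cohClass D hD c ↔ (b : BigAlg ξ₀) - c ∈ imD D :=
  RingCon.eq _

/-- The center `Z(L)` of the enveloping algebra of `L`. -/
abbrev ZU (L : Type*) [LieRing L] [LieAlgebra ℂ L] :
    Subalgebra ℂ (UniversalEnvelopingAlgebra ℂ L) :=
  Subalgebra.center ℂ (UniversalEnvelopingAlgebra ℂ L)

theorem tmul_one_comm (ξ₀ : 𝔤) (z : ZU 𝔤) (b : BigAlg ξ₀) :
    b * ((z : UniversalEnvelopingAlgebra ℂ 𝔤) ⊗ₜ[ℂ] 1) =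
      ((z : UniversalEnvelopingAlgebra ℂ 𝔤) ⊗ₜ[ℂ] 1) * b := by
  induction b using TensorProduct.induction_on with
  | zero => simp
  | tmul x T =>
    rw [Algebra.TensorProduct.tmul_mul_tmul, Algebra.TensorProduct.tmul_mul_tmul, mul_one, one_mul,
      Subalgebra.mem_center_iff.1 z.2 x]
  | add x y hx hy => rw [add_mul, mul_add, hx, hy]

theorem tmul_one_mem_kerD {ξ₀ : 𝔤} (D : BigAlg ξ₀) (z : ZU 𝔤) :
    ((z : UniversalEnvelopingAlgebra ℂ 𝔤) ⊗ₜ[ℂ] 1 : BigAlg ξ₀) ∈ kerD D := by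
  refine ⟨?_, ?_⟩
  · rw [invAlg, Subalgebra.mem_centralizer_iff]
    rintro b -
    exact tmul_one_comm ξ₀ z b
  · have h : parity ξ₀ ((z : UniversalEnvelopingAlgebra ℂ 𝔤) ⊗ₜ[ℂ] 1) =
        (z : UniversalEnvelopingAlgebra ℂ 𝔤) ⊗ₜ[ℂ] 1 := by
      rw [parity, Algebra.TensorProduct.map_tmul, map_one, AlgHom.id_apply]
    rw [gradedComm_apply, h, tmul_one_comm, sub_self]

/-- The homomorphism `Z(𝔤) → ker d_D`, `z ↦ z ⊗ 1`. -/
def centerToKer {ξ₀ : 𝔤} (D : BigAlg ξ₀) : ZU 𝔤 →ₐ[ℂ] kerD D :=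
  ((Algebra.TensorProduct.includeLeft (R := ℂ) (S := ℂ) (A := UniversalEnvelopingAlgebra ℂ 𝔤)
    (B := Module.End ℂ (ExtNeg ξ₀))).comp (ZU 𝔤).val).codRestrict (kerD D)
    (fun z => tmul_one_mem_kerD D z)

/-- The map `ζ : Z(𝔤) → Z(𝔥)` which sends `z` to the class of `z ⊗ 1`, read in `Z(𝔥)` through an
identification of `Z(𝔥)` with the cohomology. -/
def zeta {ξ₀ : 𝔤} (D : BigAlg ξ₀) (hD : parity ξ₀ D = -D)
    (e : ZU (levi ξ₀) ≃ₐ[ℂ] Coh D hD) : ZU 𝔤 →ₐ[ℂ] ZU (levi ξ₀) :=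
  (e.symm : Coh D hD →ₐ[ℂ] ZU (levi ξ₀)).comp ((cohClass D hD).comp (centerToKer D))

/-- The map `U(𝔥) → U(𝔤)` induced by the inclusion of `𝔥` in `𝔤`. -/
def leviIncl (ξ₀ : 𝔤) :
    UniversalEnvelopingAlgebra ℂ (levi ξ₀) →ₐ[ℂ] UniversalEnvelopingAlgebra ℂ 𝔤 :=
  UniversalEnvelopingAlgebra.lift ℂ ((UniversalEnvelopingAlgebra.ι ℂ).comp (levi ξ₀).incl)

/-- The subspace `𝔲bar U(𝔤) + U(𝔤) 𝔲` of `U(𝔤)`. -/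
def pbwCompl (ξ₀ : 𝔤) : Submodule ℂ (UniversalEnvelopingAlgebra ℂ 𝔤) :=
  (nilNeg ξ₀).toSubmodule.map (UniversalEnvelopingAlgebra.ι ℂ : 𝔤 →ₗ⁅ℂ⁆ _).toLinearMap * ⊤ ⊔
    ⊤ * (nilPos ξ₀).map (UniversalEnvelopingAlgebra.ι ℂ : 𝔤 →ₗ⁅ℂ⁆ _).toLinearMap

/-- `p` is the projection of `U(𝔤) = U(𝔥) ⊕ (𝔲bar U(𝔤) + U(𝔤) 𝔲)` on the first component. -/
def IsPBWProj (ξ₀ : 𝔤)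
    (p : UniversalEnvelopingAlgebra ℂ 𝔤 →ₗ[ℂ] UniversalEnvelopingAlgebra ℂ (levi ξ₀)) : Prop :=
  (∀ w, p (leviIncl ξ₀ w) = w) ∧ ∀ x ∈ pbwCompl ξ₀, p x = 0

end Lie

end Dolbeault

end

noncomputable section

namespace Dolbeault

attribute [local instance 100] LieRing.ofAssociativeRing

/-! ### The standard filtration of an enveloping algebra -/

section Filtration

open UniversalEnvelopingAlgebra (ι)

variable (L : Type*) [LieRing L] [LieAlgebra ℂ L]

/-! The proof is a Hodge decomposition carried out in filtered algebra. Let `d` be the graded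
commutator with the Dolbeault operator. Its partner is the contraction `P = ∑ ∂_i ⊗ Q_i` (`contr`),
where `Q_i T = γ(T) ι(X_i)` and `∂_i` imitates on `U(𝔤)` the derivation of `S(𝔤)` dual to `X_i`. To
define `∂_i` without a basis of monomials, one extends `x ↦ x ⊗ 1 + 1 ⊗ ad x` to `U(𝔤)` and pairs
the second factor with `T ↦ tr(T ad ξ_i)` (`coder`, `mainFrame`). Since this pairing gives the
Killing form on `ad 𝔤` and vanishes on endomorphisms of nonpositive `ξ₀`-weight, `∂_i` is dual to
`X_i` and annihilates the algebra generated by `𝔥 + 𝔲bar`.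

Up to lower terms of the standard filtration, `d P + P d` sends `u ⊗ T` to `E(u) ⊗ T + u ⊗ N(T)`:
the Euler operator `E(u) = ∑ ∂_i(u) X_i` counts the factors of `u` in `𝔲`, and `N` is a fermionic
number operator annihilated by `t(t - 1)⋯(t - n)` (`laplace_sub_mem`, `Frame.euler_sub_mem`,
`aeval_numOp_shiftPoly`). A polynomial in the Laplacian with only positive integers as roots
therefore leaves, modulo lower terms, only products of elements of `ℂ + 𝔥 + 𝔲bar` tensored with left
multiplications of `∧𝔲bar` (`aeval_shiftPoly_mem`). These have nonpositive `ξ₀`-weight, and their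
weight zero part comes from `U(𝔥) ⊗ 1`, which agrees with `δ(U(𝔥))` modulo lower terms. As invariant
elements have weight zero, induction on the filtration gives a polynomial `G` with `G(0) ≠ 0` such
that `G` of the Laplacian maps an invariant `b` to some `δ(w)` (`exists_aeval_eq_dHom`). If `d b =
0`, the nonconstant part of `G` contributes a coboundary, so `b` is cohomologous to `δ(w) / G(0)`;
injectivity of `δ` makes `w` central (`exists_eq_dHom_sub`).

For uniqueness and for the formula for `ζ`, the vacuum expectation `T ↦ (T 1)_0` on `End(∧𝔲bar)`
maps `δ(w)` to `w`, `z ⊗ 1` to `z` and coboundaries into `U(𝔤) 𝔲` (`slice_dHom`,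
`slice_gradedComm_mem`). Thus `ζ(z) - z` lies in the complement of `U(𝔥)`, and a coboundary `δ(w)`
has `w = 0`.

The decomposition of `U(𝔤)` also rests on Euler operators: a polynomial in `E` with nonzero constant
term annihilates any given element of `U(𝔤) 𝔲`, whereas `E` itself annihilates the algebra of `𝔥 +
𝔲bar` (`Frame.adjoin_disjoint`); weights separate the rest. Injectivity of `U(𝔥) → U(𝔤)` follows
from derivatives built from a faithful representation of `𝔤` (`leviIncl_injective`). -/

/-- The image of a subspace of `L` in the enveloping algebra. -/
def iotaMap {L : Type*} [LieRing L] [LieAlgebra ℂ L] (V : Submodule ℂ L) :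
    Submodule ℂ (UniversalEnvelopingAlgebra ℂ L) :=
  V.map (ι ℂ : L →ₗ⁅ℂ⁆ _).toLinearMap

/-- The standard filtration of `U(L)`, shifted by one: `ufil L (p + 1)` is spanned by the products
of at most `p` elements of `L`. -/
def ufil : ℕ → Submodule ℂ (UniversalEnvelopingAlgebra ℂ L)
  | 0 => ⊥
  | p + 1 => (1 ⊔ iotaMap ⊤) ^ p

variable {L}

theorem iota_mem_iotaMap {V : Submodule ℂ L} {x : L} (hx : x ∈ V) : ι ℂ x ∈ iotaMap V :=
  Submodule.mem_map_of_mem hx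

theorem iotaMap_mono {V W : Submodule ℂ L} (h : V ≤ W) : iotaMap V ≤ iotaMap W :=
  Submodule.map_mono h

theorem iotaMap_sup (V W : Submodule ℂ L) : iotaMap (V ⊔ W) = iotaMap V ⊔ iotaMap W :=
  Submodule.map_sup _ _ _

theorem ufil_mono : Monotone (ufil L) := by
  refine monotone_nat_of_le_succ fun p => ?_
  cases p with
  | zero => exact bot_le
  | succ p => exact pow_le_pow_right₀ le_sup_left (Nat.le_succ p)

theorem ufil_succ_succ (p : ℕ) : ufil L (p + 2) = ufil L (p + 1) * (1 ⊔ iotaMap ⊤) :=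
  pow_succ _ p

theorem ufil_succ_succ' (p : ℕ) : ufil L (p + 2) = (1 ⊔ iotaMap ⊤) * ufil L (p + 1) :=
  pow_succ' _ p

theorem ufil_one : ufil L 1 = 1 := pow_zero _

theorem mul_iota_mem_ufil {p : ℕ} {u : UniversalEnvelopingAlgebra ℂ L} (hu : u ∈ ufil L p) (x : L) :
    u * ι ℂ x ∈ ufil L (p + 1) := by
  cases p with
  | zero =>
    rw [(Submodule.mem_bot ℂ).1 hu, zero_mul]; exact zero_mem _
  | succ p =>
    rw [ufil_succ_succ]
    exact Submodule.mul_mem_mul hu (Submodule.mem_sup_right (iota_mem_iotaMap trivial))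

theorem iota_mul_mem_ufil {p : ℕ} {u : UniversalEnvelopingAlgebra ℂ L} (hu : u ∈ ufil L p) (x : L) :
    ι ℂ x * u ∈ ufil L (p + 1) := by
  cases p with
  | zero =>
    rw [(Submodule.mem_bot ℂ).1 hu, mul_zero]; exact zero_mem _
  | succ p =>
    rw [ufil_succ_succ']
    exact Submodule.mul_mem_mul (Submodule.mem_sup_right (iota_mem_iotaMap trivial)) hu

theorem mem_one_sup_iotaMap {V : Submodule ℂ L} {y : UniversalEnvelopingAlgebra ℂ L}
    (hy : y ∈ 1 ⊔ iotaMap V) :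
    ∃ (c : ℂ) (x : L), x ∈ V ∧ y = algebraMap ℂ _ c + ι ℂ x := by
  obtain ⟨a, ha, b, hb, rfl⟩ := Submodule.mem_sup.1 hy
  obtain ⟨c, rfl⟩ := Submodule.mem_one.1 ha
  obtain ⟨x, hx, rfl⟩ := hb
  exact ⟨c, x, hx, rfl⟩

theorem iota_mul_iota (x y : L) : ι ℂ x * ι ℂ y = ι ℂ y * ι ℂ x + ι ℂ ⁅x, y⁆ := by
  rw [LieHom.map_lie, Ring.lie_def]; abel

/-- Commutation with `x` is a derivation that replaces one factor `y` by `[x, y]`, so the number of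
factors does not grow. -/
theorem commutator_mem_ufil (x : L) {p : ℕ} {u : UniversalEnvelopingAlgebra ℂ L}
    (hu : u ∈ ufil L p) : ι ℂ x * u - u * ι ℂ x ∈ ufil L p := by
  cases p with
  | zero => rw [(Submodule.mem_bot ℂ).1 hu]; simp
  | succ p =>
    induction p generalizing u with
    | zero =>
      rw [ufil_one] at hu
      obtain ⟨c, rfl⟩ := Submodule.mem_one.1 hu
      rw [Algebra.commutes, sub_self]; exact zero_mem _
    | succ p ih =>
      rw [ufil_succ_succ] at hu
      induction hu using Submodule.mul_induction_on' with
      | mem_mul_mem a ha b hb =>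
        obtain ⟨c, y, -, rfl⟩ := mem_one_sup_iotaMap hb
        have h1 : ι ℂ x * (a * (algebraMap ℂ _ c + ι ℂ y)) - a * (algebraMap ℂ _ c + ι ℂ y) * ι ℂ x
            = c • (ι ℂ x * a - a * ι ℂ x) + (ι ℂ x * a - a * ι ℂ x) * ι ℂ y + a * ι ℂ ⁅x, y⁆ := by
          rw [LieHom.map_lie, Ring.lie_def, Algebra.algebraMap_eq_smul_one]
          simp only [mul_add, mul_smul_comm, mul_one, add_mul, smul_mul_assoc, smul_sub, mul_sub,
            sub_mul, mul_assoc]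
          abel
        rw [h1]
        exact add_mem (add_mem (Submodule.smul_mem _ _ (ufil_mono (Nat.le_succ _) (ih ha)))
          (mul_iota_mem_ufil (ih ha) y)) (mul_iota_mem_ufil ha _)
      | add a _ b _ ha hb =>
        have : ι ℂ x * (a + b) - (a + b) * ι ℂ x =
          (ι ℂ x * a - a * ι ℂ x) + (ι ℂ x * b - b * ι ℂ x) := by noncomm_ring
        rw [this]; exact add_mem ha hb

/-- To prove a statement about all elements of `U(L)` it suffices to treat scalars and to pass from
`u` to `ι x * u`. -/
theorem env_induction {C : UniversalEnvelopingAlgebra ℂ L → Prop}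
    (one : C 1) (smul : ∀ (c : ℂ) u, C u → C (c • u)) (add : ∀ u v, C u → C v → C (u + v))
    (mul : ∀ x u, C u → C (ι ℂ x * u)) (u : UniversalEnvelopingAlgebra ℂ L) : C u := by
  -- The universal property yields a map to the subalgebra generated by `L` whose composite with the
  -- inclusion is the identity on generators, hence everywhere.
  have key : ∀ v : UniversalEnvelopingAlgebra ℂ L, v ∈ Algebra.adjoin ℂ (Set.range (ι ℂ (L := L))) := by
    intro v
    let S := Algebra.adjoin ℂ (Set.range (ι ℂ (L := L)))
    let f : L →ₗ⁅ℂ⁆ S :=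
      { toFun := fun x => ⟨ι ℂ x, Algebra.subset_adjoin ⟨x, rfl⟩⟩
        map_add' := fun x y => Subtype.ext (map_add _ x y)
        map_smul' := fun c x => Subtype.ext (map_smul _ c x)
        map_lie' := fun {x y} =>
          Subtype.ext ((LieHom.map_lie (ι ℂ) x y).trans (Ring.lie_def _ _)) }
    have h : S.val.comp (UniversalEnvelopingAlgebra.lift ℂ f) = AlgHom.id ℂ _ := by
      ext x
      change S.val (UniversalEnvelopingAlgebra.lift ℂ f (ι ℂ x)) = ι ℂ x
      rw [UniversalEnvelopingAlgebra.lift_ι_apply]; rfl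
    have := DFunLike.congr_fun h v
    rw [← (show S.val (UniversalEnvelopingAlgebra.lift ℂ f v) = v from this)]
    exact (UniversalEnvelopingAlgebra.lift ℂ f v).2
  have zero : C 0 := by simpa using smul 0 1 one
  have key2 : ∀ v ∈ Algebra.adjoin ℂ (Set.range (ι ℂ (L := L))), ∀ w, C w → C (v * w) := by
    intro v hv
    induction hv using Algebra.adjoin_induction with
    | mem x hx => obtain ⟨x, rfl⟩ := hx; exact fun w hw => mul x w hw
    | algebraMap r => intro w hw; rw [← Algebra.smul_def]; exact smul r w hw
    | add x y _ _ hx hy => intro w hw; rw [add_mul]; exact add _ _ (hx w hw) (hy w hw)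
    | mul x y _ _ hx hy => intro w hw; rw [mul_assoc]; exact hx _ (hy w hw)
  simpa using key2 u (key u) 1 one

theorem exists_mem_ufil (u : UniversalEnvelopingAlgebra ℂ L) : ∃ p, u ∈ ufil L p := by
  induction u using env_induction with
  | one => exact ⟨1, by rw [ufil_one]; exact Submodule.one_le.1 le_rfl⟩
  | smul c u h => obtain ⟨p, hp⟩ := h; exact ⟨p, Submodule.smul_mem _ _ hp⟩
  | add u v hu hv =>
    obtain ⟨p, hp⟩ := hu
    obtain ⟨q, hq⟩ := hv
    exact ⟨max p q, add_mem (ufil_mono (le_max_left _ _) hp) (ufil_mono (le_max_right _ _) hq)⟩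
  | mul x u h => obtain ⟨p, hp⟩ := h; exact ⟨p + 1, iota_mul_mem_ufil hp x⟩

end Filtration

/-! ### Subspaces of a tensor product -/

section Tensor

variable {A E : Type*} [Ring A] [Algebra ℂ A] [Ring E] [Algebra ℂ E]

/-- The subspace `V ⊗ E` of `A ⊗ E`. -/
def tens (E : Type*) [Ring E] [Algebra ℂ E] (V : Submodule ℂ A) : Submodule ℂ (A ⊗[ℂ] E) :=
  Submodule.map₂ (TensorProduct.mk ℂ A E) V ⊤

theorem tmul_mem_tens {V : Submodule ℂ A} {a : A} (ha : a ∈ V) (T : E) : a ⊗ₜ[ℂ] T ∈ tens E V :=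
  Submodule.apply_mem_map₂ _ ha trivial

theorem tens_le {V : Submodule ℂ A} {W : Submodule ℂ (A ⊗[ℂ] E)} :
    tens E V ≤ W ↔ ∀ a ∈ V, ∀ T, a ⊗ₜ[ℂ] T ∈ W := by
  rw [tens, Submodule.map₂_le]
  simp

theorem tens_mono {V W : Submodule ℂ A} (h : V ≤ W) : tens E V ≤ tens E W :=
  Submodule.map₂_le_map₂_left h

theorem tens_bot : tens E (⊥ : Submodule ℂ A) = ⊥ := Submodule.map₂_bot_left _ _

theorem mul_tmul_mem_tens {V W : Submodule ℂ A} {a : A} (h : ∀ v ∈ V, v * a ∈ W) (T : E)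
    {z : A ⊗[ℂ] E} (hz : z ∈ tens E V) : z * (a ⊗ₜ[ℂ] T) ∈ tens E W := by
  have : tens E V ≤ (tens E W).comap (LinearMap.mulRight ℂ (a ⊗ₜ[ℂ] T)) :=
    tens_le.2 fun v hv S => by
      rw [Submodule.mem_comap, LinearMap.mulRight_apply, Algebra.TensorProduct.tmul_mul_tmul]
      exact tmul_mem_tens (h v hv) _
  exact this hz

/-- The map `id ⊗ f : A ⊗ E → A` for a linear form `f` on `E`. -/
def slice (f : Module.Dual ℂ E) : A ⊗[ℂ] E →ₗ[ℂ] A :=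
  (TensorProduct.rid ℂ A).toLinearMap ∘ₗ f.lTensor A

@[simp] theorem slice_tmul (f : Module.Dual ℂ E) (a : A) (T : E) :
    slice f (a ⊗ₜ[ℂ] T) = f T • a := by
  simp [slice]

theorem slice_mem {V : Submodule ℂ A} (f : Module.Dual ℂ E) {z : A ⊗[ℂ] E} (hz : z ∈ tens E V) :
    slice f z ∈ V := by
  have : tens E V ≤ V.comap (slice f) := tens_le.2 fun v hv S => by
    rw [Submodule.mem_comap, slice_tmul]; exact V.smul_mem _ hv
  exact this hz

end Tensor

/-! ### Derivatives on an enveloping algebra -/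

section Coder

open UniversalEnvelopingAlgebra (ι)

variable {L : Type*} [LieRing L] [LieAlgebra ℂ L] {E : Type*} [Ring E] [Algebra ℂ E]

/-- `x ↦ x ⊗ 1 + 1 ⊗ ρ(x)`. -/
def coactLie (ρ : L →ₗ⁅ℂ⁆ E) : L →ₗ⁅ℂ⁆ UniversalEnvelopingAlgebra ℂ L ⊗[ℂ] E where
  toFun x := ι ℂ x ⊗ₜ[ℂ] 1 + 1 ⊗ₜ[ℂ] ρ x
  map_add' x y := by
    simp only [map_add, TensorProduct.add_tmul, TensorProduct.tmul_add]
    abel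
  map_smul' r x := by
    rw [map_smul, map_smul, RingHom.id_apply, smul_add, TensorProduct.smul_tmul',
      TensorProduct.tmul_smul]
  map_lie' {x y} := by
    simp only [LieHom.map_lie, Ring.lie_def, mul_add, add_mul,
      Algebra.TensorProduct.tmul_mul_tmul, one_mul, mul_one, TensorProduct.sub_tmul,
      TensorProduct.tmul_sub]
    abel

/-- The homomorphism `U(L) → U(L) ⊗ E` with `x ↦ x ⊗ 1 + 1 ⊗ ρ(x)`. -/
def coact (ρ : L →ₗ⁅ℂ⁆ E) :
    UniversalEnvelopingAlgebra ℂ L →ₐ[ℂ] UniversalEnvelopingAlgebra ℂ L ⊗[ℂ] E :=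
  UniversalEnvelopingAlgebra.lift ℂ (coactLie ρ)

theorem coact_iota (ρ : L →ₗ⁅ℂ⁆ E) (x : L) :
    coact ρ (ι ℂ x) = ι ℂ x ⊗ₜ[ℂ] 1 + 1 ⊗ₜ[ℂ] ρ x :=
  UniversalEnvelopingAlgebra.lift_ι_apply ℂ (coactLie ρ) x

/-- The operator on `U(L)` that contracts the coaction with a linear form on `E`. If the form
vanishes on `1`, its symbol is the derivation of `S(L)` in the direction of the form. -/
def coder (ρ : L →ₗ⁅ℂ⁆ E) (f : Module.Dual ℂ E) :
    UniversalEnvelopingAlgebra ℂ L →ₗ[ℂ] UniversalEnvelopingAlgebra ℂ L :=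
  slice f ∘ₗ (coact ρ).toLinearMap

theorem coder_apply (ρ : L →ₗ⁅ℂ⁆ E) (f : Module.Dual ℂ E) (u : UniversalEnvelopingAlgebra ℂ L) :
    coder ρ f u = slice f (coact ρ u) := rfl

/-- Expanding a product, each factor either stays in `U(L)` or moves to `E`. Only the term in which
nothing moves has full degree. A form that vanishes on `1` discards that term, so its derivative
lowers the degree. -/
theorem coact_sub_mem (ρ : L →ₗ⁅ℂ⁆ E) {p : ℕ} {u : UniversalEnvelopingAlgebra ℂ L}
    (hu : u ∈ ufil L (p + 1)) : coact ρ u - u ⊗ₜ[ℂ] 1 ∈ tens E (ufil L p) := by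
  induction p generalizing u with
  | zero =>
    rw [ufil_one] at hu
    obtain ⟨c, rfl⟩ := Submodule.mem_one.1 hu
    rw [AlgHom.commutes, Algebra.TensorProduct.algebraMap_apply, sub_self]; exact zero_mem _
  | succ p ih =>
    rw [ufil_succ_succ] at hu
    induction hu using Submodule.mul_induction_on' with
    | mem_mul_mem a ha b hb =>
      obtain ⟨c, y, -, rfl⟩ := mem_one_sup_iotaMap hb
      have h1 : coact ρ (a * (algebraMap ℂ _ c + ι ℂ y)) - (a * (algebraMap ℂ _ c + ι ℂ y)) ⊗ₜ[ℂ] 1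
          = c • (coact ρ a - a ⊗ₜ[ℂ] 1) + (coact ρ a - a ⊗ₜ[ℂ] 1) * (ι ℂ y ⊗ₜ[ℂ] 1)
            + (coact ρ a - a ⊗ₜ[ℂ] 1) * (1 ⊗ₜ[ℂ] ρ y) + a ⊗ₜ[ℂ] ρ y := by
        rw [map_mul, map_add, AlgHom.commutes, coact_iota, Algebra.algebraMap_eq_smul_one,
          Algebra.algebraMap_eq_smul_one]
        simp only [mul_add, mul_smul_comm, mul_one, smul_sub, sub_mul, TensorProduct.add_tmul,
          Algebra.TensorProduct.tmul_mul_tmul, one_mul, TensorProduct.smul_tmul']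
        abel
      rw [h1]
      refine add_mem (add_mem (add_mem (Submodule.smul_mem _ _
        (tens_mono (ufil_mono (Nat.le_succ _)) (ih ha))) ?_) ?_) ?_
      · exact mul_tmul_mem_tens (fun v hv => mul_iota_mem_ufil hv y) _ (ih ha)
      · exact mul_tmul_mem_tens (fun v hv => by
          rw [mul_one]; exact ufil_mono (Nat.le_succ _) hv) _ (ih ha)
      · exact tmul_mem_tens ha _
    | add a _ b _ ha hb =>
      rw [map_add, TensorProduct.add_tmul, add_sub_add_comm]; exact add_mem ha hb

theorem coder_mem_ufil (ρ : L →ₗ⁅ℂ⁆ E) {f : Module.Dual ℂ E} (hf : f 1 = 0) {p : ℕ}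
    {u : UniversalEnvelopingAlgebra ℂ L} (hu : u ∈ ufil L (p + 1)) :
    coder ρ f u ∈ ufil L p := by
  have := slice_mem f (coact_sub_mem ρ hu)
  rwa [map_sub, slice_tmul, hf, zero_smul, sub_zero] at this

/-- The Leibniz rule modulo lower terms. The defect is the contribution in which `x` and at least
one factor of `u` both move to `E`. -/
theorem coder_mul_iota_sub_mem (ρ : L →ₗ⁅ℂ⁆ E) (f : Module.Dual ℂ E) {p : ℕ}
    {u : UniversalEnvelopingAlgebra ℂ L} (hu : u ∈ ufil L (p + 1)) (x : L) :
    coder ρ f (u * ι ℂ x) - coder ρ f u * ι ℂ x - f (ρ x) • u ∈ ufil L p := by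
  have h1 : ∀ z : UniversalEnvelopingAlgebra ℂ L ⊗[ℂ] E,
      slice f (z * (ι ℂ x ⊗ₜ[ℂ] 1)) = slice f z * ι ℂ x := fun z => by
    induction z using TensorProduct.induction_on with
    | zero => simp
    | tmul a T => simp [Algebra.TensorProduct.tmul_mul_tmul]
    | add a b ha hb => rw [add_mul, map_add, ha, hb, map_add, add_mul]
  have h2 : coder ρ f (u * ι ℂ x) - coder ρ f u * ι ℂ x - f (ρ x) • u =
      slice f ((coact ρ u - u ⊗ₜ[ℂ] 1) * (1 ⊗ₜ[ℂ] ρ x)) := by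
    rw [coder_apply, coder_apply, map_mul, coact_iota, mul_add, map_add, h1, sub_mul,
      Algebra.TensorProduct.tmul_mul_tmul, mul_one, one_mul, map_sub, slice_tmul]
    abel
  rw [h2]
  exact slice_mem f (mul_tmul_mem_tens (fun v hv => by rwa [mul_one]) _ (coact_sub_mem ρ hu))

/-- The coaction maps the algebra generated by `V` into `U(L) ⊗ S`, where the form vanishes
identically. No filtration is involved, so the result is exact. -/
theorem coder_eq_zero (ρ : L →ₗ⁅ℂ⁆ E) (f : Module.Dual ℂ E) (S : Subalgebra ℂ E)
    (hf : ∀ T ∈ S, f T = 0) {V : Submodule ℂ L} (hV : ∀ x ∈ V, ρ x ∈ S)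
    {u : UniversalEnvelopingAlgebra ℂ L} (hu : u ∈ Algebra.adjoin ℂ (iotaMap V : Set _)) :
    coder ρ f u = 0 := by
  have key : coact ρ u ∈
      (Algebra.TensorProduct.map (AlgHom.id ℂ (UniversalEnvelopingAlgebra ℂ L)) S.val).range := by
    induction hu using Algebra.adjoin_induction with
    | mem y hy =>
      obtain ⟨x, hx, rfl⟩ := hy
      refine ⟨ι ℂ x ⊗ₜ[ℂ] 1 + 1 ⊗ₜ[ℂ] ⟨ρ x, hV x hx⟩, ?_⟩
      exact (by simp : _ = ι ℂ x ⊗ₜ[ℂ] (1 : E) + 1 ⊗ₜ[ℂ] ρ x).trans (coact_iota ρ x).symm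
    | algebraMap r => rw [AlgHom.commutes]; exact Subalgebra.algebraMap_mem _ r
    | add x y _ _ hx hy => rw [map_add]; exact add_mem hx hy
    | mul x y _ _ hx hy => rw [map_mul]; exact mul_mem hx hy
  obtain ⟨z, hz⟩ := key
  rw [coder_apply, ← hz]
  clear hz
  change slice f (Algebra.TensorProduct.map _ S.val z) = 0
  induction z using TensorProduct.induction_on with
  | zero => simp
  | tmul a T => simp [hf T T.2]
  | add a b ha hb => rw [map_add, map_add, ha, hb, add_zero]

/-- Derivatives are compatible with homomorphisms of Lie algebras. -/
theorem coder_natural {L' : Type*} [LieRing L'] [LieAlgebra ℂ L'] (φ : L' →ₗ⁅ℂ⁆ L) (ρ : L →ₗ⁅ℂ⁆ E)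
    (f : Module.Dual ℂ E) (w : UniversalEnvelopingAlgebra ℂ L') :
    UniversalEnvelopingAlgebra.lift ℂ ((ι ℂ).comp φ) (coder (ρ.comp φ) f w) =
      coder ρ f (UniversalEnvelopingAlgebra.lift ℂ ((ι ℂ).comp φ) w) := by
  set F := UniversalEnvelopingAlgebra.lift ℂ ((ι ℂ).comp φ) with hF
  have hι : ∀ x, F (ι ℂ x) = ι ℂ (φ x) := fun x =>
    UniversalEnvelopingAlgebra.lift_ι_apply ℂ _ x
  have h1 : (Algebra.TensorProduct.map F (AlgHom.id ℂ E)).comp (coact (ρ.comp φ)) =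
      (coact ρ).comp F := by
    ext x
    change Algebra.TensorProduct.map F (AlgHom.id ℂ E) (coact (ρ.comp φ) (ι ℂ x)) =
      coact ρ (F (ι ℂ x))
    rw [hι, coact_iota, coact_iota, map_add, Algebra.TensorProduct.map_tmul,
      Algebra.TensorProduct.map_tmul, hι, map_one, map_one]
    rfl
  have h2 : ∀ z, slice f (Algebra.TensorProduct.map F (AlgHom.id ℂ E) z) = F (slice f z) :=
    fun z => by
      induction z using TensorProduct.induction_on with
      | zero => simp
      | tmul a T => simp
      | add a b ha hb => rw [map_add, map_add, ha, hb, map_add, map_add]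
  rw [coder_apply, coder_apply, ← h2]
  exact congrArg _ (DFunLike.congr_fun h1 w)

end Coder

/-! ### Polynomials in an endomorphism -/

section Poly

variable {V W : Type*} [AddCommGroup V] [Module ℂ V] [AddCommGroup W] [Module ℂ W]

open Polynomial

/-- `∏_{k < m} (t - (a + k))`. -/
def shiftPoly (a m : ℕ) : ℂ[X] := ∏ k ∈ Finset.range m, (X - C ((a : ℂ) + k))

theorem shiftPoly_succ_comp (a m : ℕ) :
    shiftPoly a (m + 1) = (X - C (a : ℂ)) * shiftPoly (a + 1) m := by
  rw [shiftPoly, Finset.prod_range_succ', mul_comm, shiftPoly]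
  congr 1
  · simp
  · refine Finset.prod_congr rfl fun k _ => ?_
    congr 2; push_cast; ring

theorem shiftPoly_add (a m l : ℕ) :
    shiftPoly a (m + l) = shiftPoly a m * shiftPoly (a + m) l := by
  rw [shiftPoly, Finset.prod_range_add]
  congr 1
  refine Finset.prod_congr rfl fun k _ => ?_
  congr 2; push_cast; ring

theorem shiftPoly_comp (a m : ℕ) : (shiftPoly (a + 1) m).comp (X + 1) = shiftPoly a m := by
  rw [shiftPoly, shiftPoly, prod_comp]
  refine Finset.prod_congr rfl fun k _ => ?_
  simp only [Nat.cast_add, Nat.cast_one, map_add, map_one, sub_comp, X_comp, add_comp,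
    one_comp, map_natCast, natCast_comp]
  ring

theorem shiftPoly_comp_add (a m b : ℕ) :
    (shiftPoly (a + b) m).comp (X + C (b : ℂ)) = shiftPoly a m := by
  rw [shiftPoly, shiftPoly, prod_comp]
  refine Finset.prod_congr rfl fun k _ => ?_
  simp only [Nat.cast_add, map_add, sub_comp, X_comp, add_comp, map_natCast, natCast_comp]
  ring

/-- Zero must not be a root: the constant term of such a polynomial in an Euler operator or in the
Laplacian is divided out later. -/
theorem shiftPoly_eval_zero_ne (a m : ℕ) : (shiftPoly (a + 1) m).eval 0 ≠ 0 := by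
  rw [shiftPoly, eval_prod, Finset.prod_ne_zero_iff]
  intro k _
  simp only [eval_sub, eval_X, eval_C, zero_sub, neg_ne_zero]
  exact_mod_cast (by omega : a + 1 + k ≠ 0)

theorem X_sub_dvd_shiftPoly {a m b : ℕ} (h1 : a ≤ b) (h2 : b < a + m) :
    X - C (b : ℂ) ∣ shiftPoly a m := by
  have := Finset.dvd_prod_of_mem (fun k : ℕ => (X - C ((a : ℂ) + k))) (a := b - a)
    (s := Finset.range m) (Finset.mem_range.2 (by omega))
  rwa [Nat.cast_sub h1, add_sub_cancel] at this

theorem aeval_mem {N : Module.End ℂ V} {S : Submodule ℂ V} (hN : ∀ v ∈ S, N v ∈ S) (G : ℂ[X])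
    {v : V} (hv : v ∈ S) : aeval N G v ∈ S := by
  induction G using Polynomial.induction_on' generalizing v with
  | add p q hp hq => rw [map_add]; exact add_mem (hp hv) (hq hv)
  | monomial n a =>
    rw [aeval_monomial, Module.End.mul_apply, Module.algebraMap_end_apply]
    refine S.smul_mem _ ?_
    induction n generalizing v with
    | zero => exact hv
    | succ n ih => rw [pow_succ]; exact ih (hN v hv)

/-- If `f` intertwines `M` and `N` modulo an `N`-stable subspace, it does so for polynomials. -/
theorem aeval_intertwine {N : Module.End ℂ V} {M : Module.End ℂ W} {S : Submodule ℂ V}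
    (hN : ∀ v ∈ S, N v ∈ S) (f : W →ₗ[ℂ] V) (hf : ∀ w, N (f w) - f (M w) ∈ S) (G : ℂ[X]) (w : W) :
    aeval N G (f w) - f (aeval M G w) ∈ S := by
  induction G using Polynomial.induction_on' generalizing w with
  | add p q hp hq =>
    rw [map_add, map_add, LinearMap.add_apply, LinearMap.add_apply, map_add, add_sub_add_comm]
    exact add_mem (hp w) (hq w)
  | monomial n a =>
    rw [aeval_monomial, aeval_monomial, Module.End.mul_apply, Module.algebraMap_end_apply,
      Module.End.mul_apply, Module.algebraMap_end_apply, map_smul, ← smul_sub]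
    refine S.smul_mem _ ?_
    induction n generalizing w with
    | zero => simp
    | succ n ih =>
      have h1 : (N ^ (n + 1)) (f w) - f ((M ^ (n + 1)) w) =
          (N ^ n) (N (f w) - f (M w)) + ((N ^ n) (f (M w)) - f ((M ^ n) (M w))) := by
        rw [pow_succ, pow_succ, Module.End.mul_apply, Module.End.mul_apply, map_sub]; abel
      rw [h1]
      refine add_mem ?_ (ih _)
      have := aeval_mem hN (X ^ n) (hf w)
      rwa [map_pow, aeval_X] at this

theorem aeval_commute {N : Module.End ℂ V} {M : Module.End ℂ W} (f : W →ₗ[ℂ] V)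
    (hf : ∀ w, N (f w) = f (M w)) (G : ℂ[X]) (w : W) : aeval N G (f w) = f (aeval M G w) := by
  have := aeval_intertwine (N := N) (M := M) (S := ⊥)
    (fun v hv => by rw [(Submodule.mem_bot ℂ).1 hv, map_zero]; exact zero_mem _) f
    (fun w => by rw [hf, sub_self]; exact zero_mem _) G w
  exact sub_eq_zero.1 this

theorem aeval_apply_of_apply_eq_zero {N : Module.End ℂ V} {v : V} (h : N v = 0) (G : ℂ[X]) :
    aeval N G v = G.eval 0 • v := by
  have h0 : Module.End.HasEigenvector N 0 v ∨ v = 0 := by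
    by_cases hv : v = 0
    · exact Or.inr hv
    · exact Or.inl ⟨Module.End.mem_eigenspace_iff.2 (by rw [h, zero_smul]), hv⟩
  rcases h0 with h0 | h0
  · exact Module.End.aeval_apply_of_hasEigenvector h0
  · rw [h0, map_zero, smul_zero]

theorem aeval_mul_apply (N : Module.End ℂ V) (F G : ℂ[X]) (v : V) :
    aeval N (F * G) v = aeval N F (aeval N G v) := by
  rw [map_mul, Module.End.mul_apply]

end Poly

/-! ### The Clifford calculus on the endomorphisms of an exterior algebra -/

section Calculus

variable {M : Type*} [AddCommGroup M] [Module ℂ M]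

theorem extMul_apply (m : M) (x : ExteriorAlgebra ℂ M) :
    extMul m x = ExteriorAlgebra.ι ℂ m * x := rfl

theorem extMul_add (m m' : M) : extMul (m + m') = extMul m + extMul m' := by
  ext x; simp [extMul_apply, add_mul]

theorem extMul_smul (c : ℂ) (m : M) : extMul (c • m) = c • extMul m := by
  refine LinearMap.ext fun x => ?_; simp [extMul_apply]

theorem extMul_mul_self (m : M) : extMul m * extMul m = 0 := by
  refine LinearMap.ext fun x => ?_
  rw [Module.End.mul_apply, extMul_apply, extMul_apply, ← mul_assoc, ExteriorAlgebra.ι_sq_zero,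
    zero_mul, LinearMap.zero_apply]

theorem extMul_mul_extMul (m m' : M) : extMul m * extMul m' = -(extMul m' * extMul m) := by
  refine LinearMap.ext fun x => ?_
  rw [Module.End.mul_apply, LinearMap.neg_apply, Module.End.mul_apply]
  simp only [extMul_apply, ← mul_assoc]
  rw [eq_neg_of_add_eq_zero_left (ExteriorAlgebra.ι_add_mul_swap m m'), neg_mul]

theorem intProd_mul_extMul (φ : Module.Dual ℂ M) (m : M) :
    intProd φ * extMul m = φ m • 1 - extMul m * intProd φ := by
  refine LinearMap.ext fun x => ?_
  rw [Module.End.mul_apply, LinearMap.sub_apply, Module.End.mul_apply, LinearMap.smul_apply,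
    extMul_apply, extMul_apply, Module.End.one_apply]
  exact CliffordAlgebra.contractLeft_ι_mul φ m x

theorem intProd_one (φ : Module.Dual ℂ M) : intProd φ 1 = 0 := CliffordAlgebra.contractLeft_one (Q := 0) (d := φ)

theorem intProd_add (φ ψ : Module.Dual ℂ M) : intProd (φ + ψ) = intProd φ + intProd ψ :=
  map_add CliffordAlgebra.contractLeft φ ψ

theorem intProd_smul (c : ℂ) (φ : Module.Dual ℂ M) : intProd (c • φ) = c • intProd φ :=
  map_smul CliffordAlgebra.contractLeft c φ

/-- The graded commutator with `e(m)`. -/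
def extComm (m : M) : Module.End ℂ (Module.End ℂ (ExteriorAlgebra ℂ M)) :=
  gradedComm (endParity M) (extMul m)

theorem extComm_apply (m : M) (T : Module.End ℂ (ExteriorAlgebra ℂ M)) :
    extComm m T = extMul m * T - endParity M T * extMul m := rfl

/-- The operator `T ↦ γ(T) ι(φ)`. -/
def intMul (φ : Module.Dual ℂ M) : Module.End ℂ (Module.End ℂ (ExteriorAlgebra ℂ M)) :=
  LinearMap.mulRight ℂ (intProd φ) ∘ₗ (endParity M).toLinearMap

theorem intMul_apply (φ : Module.Dual ℂ M) (T : Module.End ℂ (ExteriorAlgebra ℂ M)) :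
    intMul φ T = endParity M T * intProd φ := rfl

/-- The canonical anticommutation relations: the graded commutators with `e(m)` and the operators `T
↦ γ(T) ι(φ)` behave like fermionic annihilation and creation operators on `End(∧M)`. -/
theorem extComm_intMul (m : M) (φ : Module.Dual ℂ M) (T : Module.End ℂ (ExteriorAlgebra ℂ M)) :
    extComm m (intMul φ T) = φ m • T - intMul φ (extComm m T) := by
  simp only [extComm_apply, intMul_apply, map_sub, map_mul, endParity_endParity, endParity_intProd,
    endParity_extMul]
  rw [mul_neg, neg_mul, mul_assoc T, intProd_mul_extMul, mul_sub, mul_smul_comm, mul_one]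
  noncomm_ring

theorem extComm_extComm (m m' : M) (T : Module.End ℂ (ExteriorAlgebra ℂ M)) :
    extComm m (extComm m' T) = -extComm m' (extComm m T) := by
  simp only [extComm_apply, map_sub, map_mul, endParity_endParity, endParity_extMul]
  have h := extMul_mul_extMul m m'
  have h1 : extMul m * (extMul m' * T) = -(extMul m' * (extMul m * T)) := by
    rw [← mul_assoc, h, neg_mul, mul_assoc]
  simp only [neg_mul, mul_assoc, h1, h, mul_neg]
  abel

theorem extComm_self (m : M) (T : Module.End ℂ (ExteriorAlgebra ℂ M)) :
    extComm m (extComm m T) = 0 := by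
  have h : (2 : ℂ) • extComm m (extComm m T) = 0 := by
    rw [two_smul]; exact add_eq_zero_iff_eq_neg.2 (extComm_extComm m m T)
  exact (smul_eq_zero.1 h).resolve_left two_ne_zero

theorem ι_mul_involute (m : M) (x : ExteriorAlgebra ℂ M) :
    ExteriorAlgebra.ι ℂ m * CliffordAlgebra.involute x = x * ExteriorAlgebra.ι ℂ m := by
  induction x using ExteriorAlgebra.induction with
  | algebraMap r => rw [AlgHom.commutes, Algebra.commutes]
  | ι m' =>
    have : CliffordAlgebra.involute (ExteriorAlgebra.ι ℂ m') = -ExteriorAlgebra.ι ℂ m' :=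
      CliffordAlgebra.involute_ι m'
    rw [this, mul_neg, eq_neg_of_add_eq_zero_left (ExteriorAlgebra.ι_add_mul_swap m m'), neg_neg]
  | mul a b ha hb => rw [map_mul, ← mul_assoc, ha, mul_assoc, hb, mul_assoc]
  | add a b ha hb => rw [map_add, mul_add, ha, hb, add_mul]

/-- An operator that commutes in the graded sense with all `e(m)` is a left multiplication. -/
theorem eq_mulLeft_of_extComm_eq_zero {T : Module.End ℂ (ExteriorAlgebra ℂ M)}
    (h : ∀ m, extComm m T = 0) : T = LinearMap.mulLeft ℂ (T 1) := by
  have h1 : ∀ m, endParity M T * extMul m = extMul m * T := fun m =>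
    (sub_eq_zero.1 (h m)).symm
  have h2 : ∀ m, T * extMul m = extMul m * endParity M T := fun m => by
    have := congrArg (endParity M) (h1 m)
    rw [map_mul, map_mul, endParity_endParity, endParity_extMul, mul_neg, neg_mul] at this
    exact neg_injective this
  have h3 : endParity M T 1 = CliffordAlgebra.involute (T 1) := by
    rw [endParity_apply, map_one]
  -- Moving `e(m)` past `T` produces `γ(T)` and conversely, so the two must be treated in one
  -- induction.
  have key : ∀ x, T x = T 1 * x ∧ endParity M T x = CliffordAlgebra.involute (T 1) * x := by
    intro x
    induction x using CliffordAlgebra.left_induction with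
    | algebraMap r =>
      rw [Algebra.algebraMap_eq_smul_one, map_smul, map_smul, h3, mul_smul_comm, mul_smul_comm,
        mul_one, mul_one]
      exact ⟨rfl, rfl⟩
    | add x y hx hy => simp only [map_add, mul_add, hx, hy, and_self]
    | ι_mul x m hx =>
      have h4 := DFunLike.congr_fun (h2 m) x
      have h5 := DFunLike.congr_fun (h1 m) x
      simp only [Module.End.mul_apply, extMul_apply] at h4 h5
      change T (ExteriorAlgebra.ι ℂ m * x) = T 1 * (ExteriorAlgebra.ι ℂ m * x) ∧
        endParity M T (ExteriorAlgebra.ι ℂ m * x) =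
          CliffordAlgebra.involute (T 1) * (ExteriorAlgebra.ι ℂ m * x)
      rw [h4, h5, hx.1, hx.2, ← mul_assoc, ← mul_assoc, ι_mul_involute, ← mul_assoc, ← mul_assoc,
        ← ι_mul_involute m (CliffordAlgebra.involute (T 1)), CliffordAlgebra.involute_involute]
      exact ⟨rfl, rfl⟩
  exact LinearMap.ext fun x => (key x).1

variable {n : ℕ} (ξ : Fin n → M) (φ : Fin n → Module.Dual ℂ M)

/-- The number operator `∑ i, Q_i ∂_i`. -/
def numOp : Module.End ℂ (Module.End ℂ (ExteriorAlgebra ℂ M)) :=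
  ∑ i, intMul (φ i) * extComm (ξ i)

theorem numOp_apply (T : Module.End ℂ (ExteriorAlgebra ℂ M)) :
    numOp ξ φ T = ∑ i, intMul (φ i) (extComm (ξ i) T) := by
  simp [numOp, LinearMap.sum_apply]

variable {ξ φ}

/-- By the anticommutation relations, `∂_j` lowers an eigenvalue of the number operator by one. -/
theorem extComm_numOp (h : ∀ i j, φ i (ξ j) = if i = j then 1 else 0) (j : Fin n)
    (T : Module.End ℂ (ExteriorAlgebra ℂ M)) :
    extComm (ξ j) (numOp ξ φ T) = numOp ξ φ (extComm (ξ j) T) + extComm (ξ j) T := by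
  rw [numOp_apply, numOp_apply, map_sum]
  have : ∀ i, extComm (ξ j) (intMul (φ i) (extComm (ξ i) T)) =
      intMul (φ i) (extComm (ξ i) (extComm (ξ j) T)) +
        if i = j then extComm (ξ j) T else 0 := fun i => by
    rw [extComm_intMul, h, extComm_extComm (ξ j) (ξ i), map_neg, sub_neg_eq_add, add_comm]
    split_ifs with hij
    · rw [hij, one_smul]
    · rw [zero_smul]
  rw [Finset.sum_congr rfl fun i _ => this i, Finset.sum_add_distrib, Finset.sum_ite_eq',
    if_pos (Finset.mem_univ _)]

open Polynomial in
theorem extComm_aeval_numOp (h : ∀ i j, φ i (ξ j) = if i = j then 1 else 0) (j : Fin n)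
    (G : ℂ[X]) (T : Module.End ℂ (ExteriorAlgebra ℂ M)) :
    extComm (ξ j) (aeval (numOp ξ φ) G T) =
      aeval (numOp ξ φ) (G.comp (X + 1)) (extComm (ξ j) T) := by
  rw [aeval_comp]
  refine (aeval_commute (extComm (ξ j)) (fun w => ?_) G T).symm
  rw [extComm_numOp h]; simp

/-- Iterated graded commutators. -/
def extComms (l : List (Fin n)) : Module.End ℂ (Module.End ℂ (ExteriorAlgebra ℂ M)) :=
  (l.map fun i => extComm (ξ i)).prod

open Polynomial in
-- Because of the shift by one, induction shows that the factors with roots `1, …, k` send `T` to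
-- the common kernel of the `∂_j`. There `∑ Q_j ∂_j` vanishes, which supplies the root `0`.
theorem aeval_numOp_eq_zero (h : ∀ i j, φ i (ξ j) = if i = j then 1 else 0) (k : ℕ)
    {T : Module.End ℂ (ExteriorAlgebra ℂ M)}
    (hT : ∀ l : List (Fin n), l.length = k → extComms (ξ := ξ) l T = 0) :
    aeval (numOp ξ φ) (shiftPoly 0 k) T = 0 := by
  induction k generalizing T with
  | zero => exact (by simp [shiftPoly] : _ = T).trans (hT [] rfl)
  | succ k ih =>
    have h1 : ∀ j, extComm (ξ j) (aeval (numOp ξ φ) (shiftPoly 1 k) T) = 0 := fun j => by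
      rw [extComm_aeval_numOp h, shiftPoly_comp]
      refine ih fun l hl => ?_
      have := hT (l ++ [j]) (by simp [hl])
      simpa [extComms] using this
    rw [shiftPoly_succ_comp, aeval_mul_apply]
    simp [numOp_apply, h1]

theorem extComms_cons (i : Fin n) (l : List (Fin n)) (T : Module.End ℂ (ExteriorAlgebra ℂ M)) :
    extComms (ξ := ξ) (i :: l) T = extComm (ξ i) (extComms (ξ := ξ) l T) := by
  simp [extComms]

theorem extComms_extComm (j : Fin n) (l : List (Fin n))
    (T : Module.End ℂ (ExteriorAlgebra ℂ M)) :
    extComms (ξ := ξ) l (extComm (ξ j) T) = extComm (ξ j) (extComms (ξ := ξ) l T) ∨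
      extComms (ξ := ξ) l (extComm (ξ j) T) = -extComm (ξ j) (extComms (ξ := ξ) l T) := by
  induction l with
  | nil => left; simp [extComms]
  | cons i l ih =>
    rw [extComms_cons, extComms_cons, extComm_extComm (ξ j) (ξ i)]
    rcases ih with ih | ih
    · right; rw [ih, neg_neg]
    · left; rw [ih, map_neg]

theorem extComms_eq_zero_of_mem (j : Fin n) (l : List (Fin n)) (hj : j ∈ l)
    (T : Module.End ℂ (ExteriorAlgebra ℂ M)) :
    extComms (ξ := ξ) l (extComm (ξ j) T) = 0 := by
  induction l generalizing T with
  | nil => simp at hj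
  | cons i l ih =>
    rw [extComms_cons]
    rcases List.mem_cons.1 hj with rfl | hj
    · rcases extComms_extComm j l T with h | h
      · rw [h, extComm_self]
      · rw [h, map_neg, extComm_self, neg_zero]
    · rw [ih hj, map_zero]

/-- The `∂_j` anticommute and have square zero, and a word of more than `n` letters repeats one of
them. -/
theorem extComms_eq_zero {l : List (Fin n)} (hl : n < l.length)
    (T : Module.End ℂ (ExteriorAlgebra ℂ M)) : extComms (ξ := ξ) l T = 0 := by
  have hd : ¬ l.Nodup := fun hd => by
    have := hd.length_le_card
    rw [Fintype.card_fin] at this; omega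
  clear hl
  induction l generalizing T with
  | nil => simp at hd
  | cons i l ih =>
    rw [extComms_cons]
    by_cases h : l.Nodup
    · have hi : i ∈ l := by
        by_contra hi; exact hd (List.nodup_cons.2 ⟨hi, h⟩)
      have h0 := extComms_eq_zero_of_mem (ξ := ξ) i l hi T
      rcases extComms_extComm (ξ := ξ) i l T with h | h
      · rw [← h, h0]
      · rwa [h, neg_eq_zero] at h0
    · rw [ih T h, map_zero]

open Polynomial in
theorem aeval_numOp_shiftPoly (h : ∀ i j, φ i (ξ j) = if i = j then 1 else 0)
    (T : Module.End ℂ (ExteriorAlgebra ℂ M)) :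
    aeval (numOp ξ φ) (shiftPoly 0 (n + 1)) T = 0 :=
  aeval_numOp_eq_zero h _ fun l hl => extComms_eq_zero (by omega) T

open Polynomial in
-- Omitting the root `0` lands in the common kernel of the `∂_j`. When the `ξ j` span `M`, this
-- kernel consists of left multiplications by `eq_mulLeft_of_extComm_eq_zero`.
theorem extComm_aeval_numOp_shiftPoly (h : ∀ i j, φ i (ξ j) = if i = j then 1 else 0)
    (T : Module.End ℂ (ExteriorAlgebra ℂ M)) (j : Fin n) :
    extComm (ξ j) (aeval (numOp ξ φ) (shiftPoly 1 n) T) = 0 := by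
  rw [extComm_aeval_numOp h, shiftPoly_comp]
  refine aeval_numOp_eq_zero h _ fun l hl => ?_
  have := extComms_eq_zero (ξ := ξ) (l := l ++ [j]) (by simp [hl]) T
  simpa [extComms] using this

end Calculus

/-! ### Weights -/

section Weights

variable {V W : Type*} [AddCommGroup V] [Module ℂ V] [AddCommGroup W] [Module ℂ W]

/-- The sum of the eigenspaces of `D` for negative real eigenvalues. -/
def negSpace (D : Module.End ℂ V) : Submodule ℂ V :=
  ⨆ (t : ℝ) (_ : t < 0), D.eigenspace (t : ℂ)

theorem mem_negSpace {D : Module.End ℂ V} {t : ℝ} (ht : t < 0) {v : V} (hv : D v = (t : ℂ) • v) :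
    v ∈ negSpace D :=
  Submodule.mem_iSup_of_mem t (Submodule.mem_iSup_of_mem ht (Module.End.mem_eigenspace_iff.2 hv))

theorem negSpace_le {D : Module.End ℂ V} {S : Submodule ℂ V}
    (h : ∀ t : ℝ, t < 0 → ∀ v, D v = (t : ℂ) • v → v ∈ S) : negSpace D ≤ S :=
  iSup₂_le fun t ht v hv => h t ht v (Module.End.mem_eigenspace_iff.1 hv)

theorem map_mem_negSpace {D : Module.End ℂ V} {D' : Module.End ℂ W} (f : V →ₗ[ℂ] W)
    (h : ∀ v, D' (f v) = f (D v)) {v : V} (hv : v ∈ negSpace D) : f v ∈ negSpace D' := by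
  have : negSpace D ≤ (negSpace D').comap f := negSpace_le fun t ht v hv => by
    refine mem_negSpace ht ?_
    rw [h, hv, map_smul]
  exact this hv

theorem eq_zero_of_mem_negSpace {D : Module.End ℂ V} {v : V} (hv : v ∈ negSpace D)
    (h : D v = 0) : v = 0 := by
  have hi := (Module.End.eigenspaces_iSupIndep D) 0
  have h1 : negSpace D ≤ ⨆ (μ : ℂ) (_ : μ ≠ 0), D.eigenspace μ := by
    refine iSup₂_le fun t ht => ?_
    refine le_iSup₂_of_le (t : ℂ) (by exact_mod_cast ht.ne) le_rfl
  exact Submodule.disjoint_def.1 hi v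
    (Module.End.mem_eigenspace_iff.2 (by rw [h, zero_smul])) (h1 hv)

/-- A vector of weight zero which is the sum of negative weight vectors modulo a stable subspace
belongs to that subspace. -/
theorem mem_of_sub_mem_negSpace {D : Module.End ℂ V} {S : Submodule ℂ V} (hS : ∀ v ∈ S, D v ∈ S)
    {c : V} (hc : D c = 0) (h : c ∈ S ⊔ negSpace D) : c ∈ S := by
  obtain ⟨s, hs, v, hv, rfl⟩ := Submodule.mem_sup.1 h
  refine add_mem hs ?_
  -- In the quotient by `S`, the vector `v` has weight zero and is also a sum of negative weight
  -- vectors. Independence of eigenspaces makes it vanish.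
  rw [← Submodule.Quotient.mk_eq_zero]
  refine eq_zero_of_mem_negSpace (D := S.mapQ S D hS) (map_mem_negSpace S.mkQ (fun _ => rfl) hv) ?_
  rw [Submodule.mapQ_apply, Submodule.Quotient.mk_eq_zero, eq_neg_of_add_eq_zero_right
    ((map_add D s v).symm.trans hc)]
  exact neg_mem (hS s hs)

variable {A : Type*} [Ring A] [Algebra ℂ A]

/-- The commutator with `a`. -/
def comm (a : A) : Module.End ℂ A := LinearMap.mulLeft ℂ a - LinearMap.mulRight ℂ a

theorem comm_apply (a b : A) : comm a b = a * b - b * a := rfl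

theorem comm_mul (a b c : A) : comm a (b * c) = comm a b * c + b * comm a c := by
  simp only [comm_apply]; noncomm_ring

theorem comm_mul_of_eigen {a b c : A} {s t : ℂ} (hb : comm a b = s • b) (hc : comm a c = t • c) :
    comm a (b * c) = (s + t) • (b * c) := by
  rw [comm_mul, hb, hc, smul_mul_assoc, mul_smul_comm, add_smul]

theorem mul_mem_negSpace {a b c : A} (hb : b ∈ negSpace (comm a)) (hc : c ∈ negSpace (comm a)) :
    b * c ∈ negSpace (comm a) := by
  have : negSpace (comm a) ≤ (negSpace (comm a)).comap (LinearMap.mulRight ℂ c) :=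
    negSpace_le fun t ht b hb => by
      rw [Submodule.mem_comap, LinearMap.mulRight_apply]
      have : negSpace (comm a) ≤ (negSpace (comm a)).comap (LinearMap.mulLeft ℂ b) :=
        negSpace_le fun s hs c hc => by
          refine mem_negSpace (add_neg ht hs) ?_
          rw [LinearMap.mulLeft_apply, comm_mul_of_eigen hb hc, Complex.ofReal_add]
      exact this hc
  exact this hb

theorem mul_mem_negSpace_of_comm_right {a b c : A} (hb : b ∈ negSpace (comm a))
    (hc : comm a c = 0) : b * c ∈ negSpace (comm a) :=
  map_mem_negSpace (LinearMap.mulRight ℂ c) (fun v => by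
    simp only [LinearMap.mulRight_apply]; rw [comm_mul, hc, mul_zero, add_zero]) hb

theorem mul_mem_negSpace_of_comm_left {a b c : A} (hb : comm a b = 0)
    (hc : c ∈ negSpace (comm a)) : b * c ∈ negSpace (comm a) :=
  map_mem_negSpace (LinearMap.mulLeft ℂ b) (fun v => by
    simp only [LinearMap.mulLeft_apply]; rw [comm_mul, hb, zero_mul, zero_add]) hc

/-- The subalgebra of the sums of elements of nonpositive weight with respect to `a`. -/
def nonposAlg (a : A) : Subalgebra ℂ A where
  carrier := (LinearMap.ker (comm a) ⊔ negSpace (comm a) : Submodule ℂ A)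
  mul_mem' {b c} hb hc := by
    obtain ⟨b0, hb0, b1, hb1, rfl⟩ := Submodule.mem_sup.1 hb
    obtain ⟨c0, hc0, c1, hc1, rfl⟩ := Submodule.mem_sup.1 hc
    rw [LinearMap.mem_ker] at hb0 hc0
    have h : (b0 + b1) * (c0 + c1) = b0 * c0 + (b0 * c1 + b1 * c0 + b1 * c1) := by noncomm_ring
    rw [h]
    refine add_mem (Submodule.mem_sup_left ?_) (Submodule.mem_sup_right ?_)
    · rw [LinearMap.mem_ker, comm_mul, hb0, hc0, zero_mul, mul_zero, add_zero]
    · exact add_mem (add_mem (mul_mem_negSpace_of_comm_left hb0 hc1)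
        (mul_mem_negSpace_of_comm_right hb1 hc0)) (mul_mem_negSpace hb1 hc1)
  add_mem' hb hc := Submodule.add_mem _ hb hc
  algebraMap_mem' r := Submodule.mem_sup_left (by
    rw [LinearMap.mem_ker, comm_apply, Algebra.commutes, sub_self])

theorem mem_nonposAlg {a b : A} :
    b ∈ nonposAlg a ↔ b ∈ LinearMap.ker (comm a) ⊔ negSpace (comm a) := Iff.rfl

theorem mul_mem_negSpace_of_nonpos_right {a b c : A} (hb : b ∈ negSpace (comm a))
    (hc : c ∈ nonposAlg a) : b * c ∈ negSpace (comm a) := by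
  obtain ⟨c0, hc0, c1, hc1, rfl⟩ := Submodule.mem_sup.1 (mem_nonposAlg.1 hc)
  rw [mul_add]
  exact add_mem (mul_mem_negSpace_of_comm_right hb hc0) (mul_mem_negSpace hb hc1)

theorem mul_mem_negSpace_of_nonpos_left {a b c : A} (hb : b ∈ nonposAlg a)
    (hc : c ∈ negSpace (comm a)) : b * c ∈ negSpace (comm a) := by
  obtain ⟨b0, hb0, b1, hb1, rfl⟩ := Submodule.mem_sup.1 (mem_nonposAlg.1 hb)
  rw [add_mul]
  exact add_mem (mul_mem_negSpace_of_comm_left hb0 hc) (mul_mem_negSpace hb1 hc)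

end Weights

/-! ### Euler operators on an enveloping algebra -/

section Euler

open UniversalEnvelopingAlgebra (ι)

/-- A representation `ρ` of `L` together with elements `X i` and linear forms `f i` dual to them,
which vanish on a subalgebra containing the image of a complement `P` of the span of the `X i`. -/
structure Frame (L E : Type*) [LieRing L] [LieAlgebra ℂ L] [Ring E] [Algebra ℂ E] (n : ℕ) where
  /-- the representation -/
  rho : L →ₗ⁅ℂ⁆ E
  /-- the linear forms -/
  f : Fin n → Module.Dual ℂ E
  /-- the elements dual to the linear forms -/
  X : Fin n → L
  /-- the subalgebra on which the forms vanish -/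
  S : Subalgebra ℂ E
  /-- the complement -/
  P : Submodule ℂ L
  f_eq_zero : ∀ i, ∀ T ∈ S, f i T = 0
  rho_mem : ∀ x ∈ P, rho x ∈ S
  f_rho_X : ∀ i j, f i (rho (X j)) = if i = j then 1 else 0
  sup_eq_top : P ⊔ Submodule.span ℂ (Set.range X) = ⊤

namespace Frame

variable {L E : Type*} [LieRing L] [LieAlgebra ℂ L] [Ring E] [Algebra ℂ E] {n : ℕ}
  (F : Frame L E n)

/-- The span of the `X i`. -/
def Q : Submodule ℂ L := Submodule.span ℂ (Set.range F.X)

/-- The derivative in the direction dual to `X i`. -/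
def der (i : Fin n) : UniversalEnvelopingAlgebra ℂ L →ₗ[ℂ] UniversalEnvelopingAlgebra ℂ L :=
  coder F.rho (F.f i)

/-- The Euler operator `u ↦ ∑ i, ∂_i(u) X_i`. -/
def euler : Module.End ℂ (UniversalEnvelopingAlgebra ℂ L) :=
  ∑ i, LinearMap.mulRight ℂ (ι ℂ (F.X i)) ∘ₗ F.der i

theorem euler_apply (u : UniversalEnvelopingAlgebra ℂ L) :
    F.euler u = ∑ i, F.der i u * ι ℂ (F.X i) := by
  simp [euler, LinearMap.sum_apply]

/-- The operator `u ↦ euler(u) - c u`. -/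
def eulerShift (c : ℂ) : Module.End ℂ (UniversalEnvelopingAlgebra ℂ L) :=
  F.euler - c • LinearMap.id

theorem eulerShift_apply (c : ℂ) (u : UniversalEnvelopingAlgebra ℂ L) :
    F.eulerShift c u = F.euler u - c • u := rfl

theorem f_one (i : Fin n) : F.f i 1 = 0 := F.f_eq_zero i 1 (one_mem _)

theorem der_mem {p : ℕ} {u : UniversalEnvelopingAlgebra ℂ L} (hu : u ∈ ufil L (p + 1))
    (i : Fin n) : F.der i u ∈ ufil L p := coder_mem_ufil F.rho (F.f_one i) hu

theorem der_mul_iota_sub_mem {p : ℕ} {u : UniversalEnvelopingAlgebra ℂ L} (hu : u ∈ ufil L (p + 1))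
    (x : L) (i : Fin n) :
    F.der i (u * ι ℂ x) - F.der i u * ι ℂ x - F.f i (F.rho x) • u ∈ ufil L p :=
  coder_mul_iota_sub_mem F.rho (F.f i) hu x

theorem der_eq_zero {u : UniversalEnvelopingAlgebra ℂ L}
    (hu : u ∈ Algebra.adjoin ℂ (iotaMap F.P : Set _)) (i : Fin n) : F.der i u = 0 :=
  coder_eq_zero F.rho (F.f i) F.S (F.f_eq_zero i) F.rho_mem hu

theorem euler_eq_zero {u : UniversalEnvelopingAlgebra ℂ L}
    (hu : u ∈ Algebra.adjoin ℂ (iotaMap F.P : Set _)) : F.euler u = 0 := by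
  rw [euler_apply]; exact Finset.sum_eq_zero fun i _ => by rw [F.der_eq_zero hu, zero_mul]

theorem euler_mem {p : ℕ} {u : UniversalEnvelopingAlgebra ℂ L} (hu : u ∈ ufil L p) :
    F.euler u ∈ ufil L p := by
  cases p with
  | zero => rw [(Submodule.mem_bot ℂ).1 hu, map_zero]; exact zero_mem _
  | succ p =>
    rw [euler_apply]; exact sum_mem fun i _ => mul_iota_mem_ufil (F.der_mem hu i) _

/-- The projection to the span of the `X i`. -/
def proj : L →ₗ[ℂ] L := ∑ i, ((F.f i).comp F.rho.toLinearMap).smulRight (F.X i)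

theorem proj_apply (x : L) : F.proj x = ∑ i, F.f i (F.rho x) • F.X i := by
  simp [proj, LinearMap.sum_apply]

theorem proj_eq_self {x : L} (hx : x ∈ F.Q) : F.proj x = x := by
  have : F.Q ≤ LinearMap.eqLocus F.proj LinearMap.id := by
    refine Submodule.span_le.2 ?_
    rintro _ ⟨j, rfl⟩
    change F.proj (F.X j) = F.X j
    rw [proj_apply, Finset.sum_eq_single j]
    · rw [F.f_rho_X, if_pos rfl, one_smul]
    · intro i _ hij; rw [F.f_rho_X, if_neg hij, zero_smul]
    · simp
  exact this hx

theorem proj_eq_zero {x : L} (hx : x ∈ F.P) : F.proj x = 0 := by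
  rw [proj_apply]
  exact Finset.sum_eq_zero fun i _ => by rw [F.f_eq_zero i _ (F.rho_mem x hx), zero_smul]

/-- Differentiating the appended factor gives `u · proj(x)`. Moving `X_i` back past `x` costs the
brackets `[x, X_i]`. Tracking `W` allows two uses: `W = ⊤` for degree estimates, and `W = Q` to keep
the last factor in `Q`. -/
theorem euler_mul_iota_sub_mem {p : ℕ} {u : UniversalEnvelopingAlgebra ℂ L}
    (hu : u ∈ ufil L (p + 1)) (x : L) {W : Submodule ℂ L} (hX : ∀ i, F.X i ∈ W)
    (hW : ∀ i, ⁅x, F.X i⁆ ∈ W) :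
    F.euler (u * ι ℂ x) - F.euler u * ι ℂ x - u * ι ℂ (F.proj x) ∈ ufil L p * iotaMap W := by
  have h : F.euler (u * ι ℂ x) - F.euler u * ι ℂ x - u * ι ℂ (F.proj x) =
      ∑ i, ((F.der i (u * ι ℂ x) - F.der i u * ι ℂ x - F.f i (F.rho x) • u) * ι ℂ (F.X i) +
        F.der i u * ι ℂ ⁅x, F.X i⁆) := by
    rw [euler_apply, euler_apply, proj_apply, map_sum, Finset.mul_sum, Finset.sum_mul,
      ← Finset.sum_sub_distrib, ← Finset.sum_sub_distrib]
    refine Finset.sum_congr rfl fun i _ => ?_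
    rw [LieHom.map_lie, Ring.lie_def, map_smul]
    simp only [sub_mul, mul_sub, smul_mul_assoc, mul_smul_comm, mul_assoc]
    abel
  rw [h]
  exact sum_mem fun i _ => add_mem
    (Submodule.mul_mem_mul (F.der_mul_iota_sub_mem hu x i) (iota_mem_iotaMap (hX i)))
    (Submodule.mul_mem_mul (F.der_mem hu i) (iota_mem_iotaMap (hW i)))

theorem ufil_mul_iotaMap_le (p : ℕ) (W : Submodule ℂ L) :
    ufil L p * iotaMap W ≤ ufil L (p + 1) := by
  refine Submodule.mul_le.2 fun u hu y hy => ?_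
  obtain ⟨x, -, rfl⟩ := hy
  exact mul_iota_mem_ufil hu x

theorem euler_mul_iota_sub_mem_ufil {p : ℕ} {u : UniversalEnvelopingAlgebra ℂ L}
    (hu : u ∈ ufil L (p + 1)) (x : L) :
    F.euler (u * ι ℂ x) - F.euler u * ι ℂ x - u * ι ℂ (F.proj x) ∈ ufil L (p + 1) :=
  ufil_mul_iotaMap_le p ⊤
    (F.euler_mul_iota_sub_mem hu x (fun _ => trivial) (fun _ => trivial))

/-- The span of the products of `p` factors, `a` of which lie in the span of the `X i` and the
others in `ℂ + P`. -/
def typed : ℕ → ℕ → Submodule ℂ (UniversalEnvelopingAlgebra ℂ L)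
  | 0, 0 => 1
  | 0, _ + 1 => ⊥
  | p + 1, 0 => typed p 0 * (1 ⊔ iotaMap F.P)
  | p + 1, a + 1 => typed p (a + 1) * (1 ⊔ iotaMap F.P) ⊔ typed p a * iotaMap F.Q

theorem typed_mul_le (p a : ℕ) : F.typed p a * (1 ⊔ iotaMap F.P) ≤ F.typed (p + 1) a := by
  cases a with
  | zero => exact le_rfl
  | succ a => exact le_sup_left

theorem typed_mul_le' (p a : ℕ) : F.typed p a * iotaMap F.Q ≤ F.typed (p + 1) (a + 1) :=
  le_sup_right

theorem typed_le (p a : ℕ) : F.typed p a ≤ ufil L (p + 1) := by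
  induction p generalizing a with
  | zero =>
    cases a with
    | zero => exact le_of_eq ufil_one.symm
    | succ a => exact bot_le
  | succ p ih =>
    have h1 : ∀ a, F.typed p a * (1 ⊔ iotaMap F.P) ≤ ufil L (p + 2) := fun a => by
      rw [ufil_succ_succ]; exact mul_le_mul' (ih a) (sup_le_sup_left (iotaMap_mono le_top) _)
    cases a with
    | zero => exact h1 0
    | succ a =>
      refine sup_le (h1 _) ?_
      rw [ufil_succ_succ]
      exact mul_le_mul' (ih a) ((iotaMap_mono le_top).trans le_sup_right)

theorem ufil_le_iSup_typed (p : ℕ) : ufil L (p + 1) ≤ ⨆ (a : ℕ) (_ : a ≤ p), F.typed p a := by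
  induction p with
  | zero => exact le_iSup₂_of_le 0 le_rfl (le_of_eq ufil_one)
  | succ p ih =>
    rw [ufil_succ_succ, ← F.sup_eq_top, iotaMap_sup, ← sup_assoc]
    refine Submodule.mul_le.2 fun u hu y hy => ?_
    obtain ⟨y1, hy1, y2, hy2, rfl⟩ := Submodule.mem_sup.1 hy
    rw [mul_add]
    refine add_mem ?_ ?_
    · have : ufil L (p + 1) ≤ (⨆ (a : ℕ) (_ : a ≤ p + 1), F.typed (p + 1) a).comap
          (LinearMap.mulRight ℂ y1) := by
        refine ih.trans (iSup₂_le fun a ha v hv => ?_)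
        exact Submodule.mem_iSup_of_mem a (Submodule.mem_iSup_of_mem (by omega)
          (F.typed_mul_le p a (Submodule.mul_mem_mul hv hy1)))
      exact this hu
    · have : ufil L (p + 1) ≤ (⨆ (a : ℕ) (_ : a ≤ p + 1), F.typed (p + 1) a).comap
          (LinearMap.mulRight ℂ y2) := by
        refine ih.trans (iSup₂_le fun a ha v hv => ?_)
        exact Submodule.mem_iSup_of_mem (a + 1) (Submodule.mem_iSup_of_mem (by omega)
          (F.typed_mul_le' p a (Submodule.mul_mem_mul hv hy2)))
      exact this hu

/-- A factor from `Q` contributes one to the Euler degree and a factor from `ℂ + P` contributes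
nothing. Brackets created by reordering have lower filtration degree. -/
theorem euler_sub_mem {p a : ℕ} {u : UniversalEnvelopingAlgebra ℂ L} (hu : u ∈ F.typed p a) :
    F.euler u - (a : ℂ) • u ∈ ufil L p := by
  induction p generalizing a u with
  | zero =>
    cases a with
    | zero =>
      obtain ⟨c, rfl⟩ := Submodule.mem_one.1 hu
      rw [F.euler_eq_zero (Subalgebra.algebraMap_mem _ c)]; simp
    | succ a => rw [(Submodule.mem_bot ℂ).1 hu]; simp
  | succ p ih =>
    have h1 : ∀ a, F.typed p a * (1 ⊔ iotaMap F.P) ≤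
        (ufil L (p + 1)).comap (F.eulerShift a) := fun a => by
      refine Submodule.mul_le.2 fun u hu y hy => ?_
      obtain ⟨c, x, hx, rfl⟩ := mem_one_sup_iotaMap hy
      have h := F.euler_mul_iota_sub_mem_ufil (F.typed_le p a hu) x
      rw [F.proj_eq_zero hx, map_zero, mul_zero, sub_zero] at h
      have h2 : (F.eulerShift a) (u * (algebraMap ℂ _ c + ι ℂ x)) =
          c • (F.euler u - (a : ℂ) • u) + (F.euler u - (a : ℂ) • u) * ι ℂ x +
          (F.euler (u * ι ℂ x) - F.euler u * ι ℂ x) := by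
        rw [Algebra.algebraMap_eq_smul_one, mul_add, mul_smul_comm, mul_one, map_add, map_smul]
        simp only [eulerShift_apply, sub_mul,
          smul_mul_assoc]
        abel
      rw [Submodule.mem_comap, h2]
      exact add_mem (add_mem (Submodule.smul_mem _ _ (ufil_mono (Nat.le_succ p) (ih hu)))
        (mul_iota_mem_ufil (ih hu) x)) h
    have h2 : ∀ a, F.typed p a * iotaMap F.Q ≤
        (ufil L (p + 1)).comap (F.eulerShift (a + 1 : ℕ)) := fun a => by
      refine Submodule.mul_le.2 fun u hu y hy => ?_
      obtain ⟨x, hx, rfl⟩ := hy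
      have h := F.euler_mul_iota_sub_mem_ufil (F.typed_le p a hu) x
      rw [F.proj_eq_self hx] at h
      have h2 : (F.eulerShift (a + 1 : ℕ)) (u * ι ℂ x) =
          (F.euler u - (a : ℂ) • u) * ι ℂ x +
          (F.euler (u * ι ℂ x) - F.euler u * ι ℂ x - u * ι ℂ x) := by
        simp only [eulerShift_apply, sub_mul,
          smul_mul_assoc, Nat.cast_add, Nat.cast_one, add_smul, one_smul]
        abel
      change _ ∈ Submodule.comap _ _
      rw [Submodule.mem_comap]
      exact h2 ▸ add_mem (mul_iota_mem_ufil (ih hu) x) h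
    cases a with
    | zero => exact h1 0 hu
    | succ a => exact sup_le (h1 (a + 1)) (h2 a) hu

open Polynomial

/-- A polynomial in the Euler operator, with nonzero constant term, that annihilates `U_q · Q`. -/
theorem exists_aeval_euler_eq_zero (hQ : ∀ x ∈ F.Q, ∀ y ∈ F.Q, ⁅x, y⁆ ∈ F.Q) (q : ℕ) :
    ∃ G : ℂ[X], G.eval 0 ≠ 0 ∧ ∀ u ∈ ufil L q * iotaMap F.Q, aeval F.euler G u = 0 := by
  induction q with
  | zero =>
    refine ⟨1, by simp, fun u hu => ?_⟩
    have h0 : ufil L 0 * iotaMap F.Q = ⊥ := Submodule.bot_mul _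
    rw [h0, Submodule.mem_bot] at hu
    rw [hu, map_zero]
  | succ q ih =>
    obtain ⟨G, hG, h⟩ := ih
    -- At most `q` factors followed by one from `Q` have Euler degree between `1` and `q + 1`. These
    -- roots therefore lower the filtration index of the left factor by one.
    refine ⟨G * shiftPoly 1 (q + 1), by
      rw [eval_mul]; exact mul_ne_zero hG (shiftPoly_eval_zero_ne 0 _), fun u hu => ?_⟩
    rw [aeval_mul_apply]
    refine h _ ?_
    have hX : ∀ i, F.X i ∈ F.Q := fun i => Submodule.subset_span ⟨i, rfl⟩
    -- Here closure of `Q` under brackets is needed: the errors of the Leibniz rule again end with a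
    -- factor in `Q`.
    have hstab : ∀ v ∈ ufil L q * iotaMap F.Q, F.euler v ∈ ufil L q * iotaMap F.Q := by
      cases q with
      | zero =>
        have h0 : ufil L 0 * iotaMap F.Q = ⊥ := Submodule.bot_mul _
        intro v hv
        rw [h0, Submodule.mem_bot] at hv
        rw [hv, map_zero]; exact zero_mem _
      | succ q =>
        change _ ≤ (ufil L (q + 1) * iotaMap F.Q).comap F.euler
        refine Submodule.mul_le.2 fun u hu y hy => ?_
        obtain ⟨x, hx, rfl⟩ := hy
        have h := F.euler_mul_iota_sub_mem hu x hX (fun i => hQ x hx _ (hX i))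
        rw [F.proj_eq_self hx, sub_sub] at h
        have h1 := add_mem (mul_le_mul_left (ufil_mono (Nat.le_succ q)) _ h)
          (add_mem (Submodule.mul_mem_mul (F.euler_mem hu) (iota_mem_iotaMap hx))
            (Submodule.mul_mem_mul hu (iota_mem_iotaMap hx)))
        rwa [sub_add_cancel] at h1
    have key : ∀ a ≤ q, ∀ v ∈ F.typed q a, ∀ x ∈ F.Q,
        aeval F.euler (shiftPoly 1 (q + 1)) (v * ι ℂ x) ∈ ufil L q * iotaMap F.Q := by
      intro a ha v hv x hx
      obtain ⟨H, hH⟩ := X_sub_dvd_shiftPoly (a := 1) (m := q + 1) (b := a + 1) (by omega) (by omega)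
      rw [hH, mul_comm, aeval_mul_apply]
      refine aeval_mem hstab _ ?_
      have h := F.euler_mul_iota_sub_mem (F.typed_le q a hv) x hX (fun i => hQ x hx _ (hX i))
      rw [F.proj_eq_self hx] at h
      have h2 : aeval F.euler (Polynomial.X - C ((a + 1 : ℕ) : ℂ)) (v * ι ℂ x) =
          (F.euler v - (a : ℂ) • v) * ι ℂ x +
          (F.euler (v * ι ℂ x) - F.euler v * ι ℂ x - v * ι ℂ x) := by
        simp only [map_sub, aeval_X, aeval_C, LinearMap.sub_apply, Module.algebraMap_end_apply,
          sub_mul, smul_mul_assoc, Nat.cast_add, Nat.cast_one, add_smul, one_smul]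
        abel
      rw [h2]
      exact add_mem (Submodule.mul_mem_mul (F.euler_sub_mem hv) (iota_mem_iotaMap hx)) h
    have : ufil L (q + 1) * iotaMap F.Q ≤
        (ufil L q * iotaMap F.Q).comap (aeval F.euler (shiftPoly 1 (q + 1))) := by
      refine Submodule.mul_le.2 fun u hu y hy => ?_
      obtain ⟨x, hx, rfl⟩ := hy
      have h3 : ufil L (q + 1) ≤ ((ufil L q * iotaMap F.Q).comap
          (aeval F.euler (shiftPoly 1 (q + 1)))).comap (LinearMap.mulRight ℂ (ι ℂ x)) :=
        (F.ufil_le_iSup_typed q).trans (iSup₂_le fun a ha v hv => key a ha v hv x hx)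
      exact h3 hu
    exact this hu

/-- `U(P) ∩ U(L) Q = 0`, where `U(P)` is the subalgebra generated by `P`. -/
theorem adjoin_disjoint (hQ : ∀ x ∈ F.Q, ∀ y ∈ F.Q, ⁅x, y⁆ ∈ F.Q)
    {u : UniversalEnvelopingAlgebra ℂ L} (hu : u ∈ Algebra.adjoin ℂ (iotaMap F.P : Set _))
    (hu' : u ∈ ⊤ * iotaMap F.Q) : u = 0 := by
  have h : ∃ q, u ∈ ufil L q * iotaMap F.Q := by
    clear hu
    induction hu' using Submodule.mul_induction_on' with
    | mem_mul_mem a _ b hb =>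
      obtain ⟨q, hq⟩ := exists_mem_ufil a
      exact ⟨q, Submodule.mul_mem_mul hq hb⟩
    | add a _ b _ ha hb =>
      obtain ⟨p, hp⟩ := ha
      obtain ⟨q, hq⟩ := hb
      exact ⟨max p q, add_mem (mul_le_mul_left (ufil_mono (le_max_left _ _)) _ hp)
        (mul_le_mul_left (ufil_mono (le_max_right _ _)) _ hq)⟩
  obtain ⟨q, hq⟩ := h
  obtain ⟨G, hG, hG'⟩ := F.exists_aeval_euler_eq_zero hQ q
  -- The Euler operator annihilates `u`, so `G` of it multiplies `u` by the nonzero number `G(0)`.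
  have h1 := hG' u hq
  rw [aeval_apply_of_apply_eq_zero (F.euler_eq_zero hu)] at h1
  exact (smul_eq_zero.1 h1).resolve_left hG

/-- If `P = 0`, the Euler operator is multiplication with the degree up to terms of lower degree. -/
theorem euler_sub_mem_of_P_eq_bot (hP : F.P = ⊥) {p : ℕ} {u : UniversalEnvelopingAlgebra ℂ L}
    (hu : u ∈ ufil L (p + 1)) : F.euler u - (p : ℂ) • u ∈ ufil L p := by
  induction p generalizing u with
  | zero =>
    rw [ufil_one] at hu
    obtain ⟨c, rfl⟩ := Submodule.mem_one.1 hu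
    rw [F.euler_eq_zero (Subalgebra.algebraMap_mem _ c)]; simp
  | succ p ih =>
    have hQ : ∀ x, x ∈ F.Q := fun x => by
      have := F.sup_eq_top
      rw [hP, bot_sup_eq] at this
      change x ∈ Submodule.span ℂ (Set.range F.X)
      rw [this]; trivial
    have : ufil L (p + 2) ≤
        (ufil L (p + 1)).comap (F.eulerShift (p + 1 : ℕ)) := by
      rw [ufil_succ_succ]
      refine Submodule.mul_le.2 fun u hu y hy => ?_
      obtain ⟨c, x, -, rfl⟩ := mem_one_sup_iotaMap hy
      have h := F.euler_mul_iota_sub_mem_ufil hu x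
      rw [F.proj_eq_self (hQ x)] at h
      have h2 : (F.eulerShift (p + 1 : ℕ)) (u * (algebraMap ℂ _ c + ι ℂ x)) =
          c • F.euler u - (((p + 1 : ℕ) : ℂ) * c) • u + (F.euler u - (p : ℂ) • u) * ι ℂ x +
          (F.euler (u * ι ℂ x) - F.euler u * ι ℂ x - u * ι ℂ x) := by
        rw [Algebra.algebraMap_eq_smul_one, mul_add, mul_smul_comm, mul_one, map_add, map_smul]
        simp only [eulerShift_apply, sub_mul,
          smul_mul_assoc, Nat.cast_add, Nat.cast_one, add_smul, one_smul, add_mul, one_mul,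
          smul_sub, smul_add, smul_smul, mul_comm c]
        abel
      rw [Submodule.mem_comap, h2]
      exact add_mem (add_mem (sub_mem (Submodule.smul_mem _ _ (F.euler_mem hu))
        (Submodule.smul_mem _ _ hu)) (mul_iota_mem_ufil (ih hu) x)) h
    exact this hu

end Frame

end Euler

/-! ### The triangular decomposition -/

section Triangular

variable {𝔤 : Type*} [LieRing 𝔤] [LieAlgebra ℂ 𝔤] {ξ₀ : 𝔤}

theorem mem_levi {Y : 𝔤} : Y ∈ levi ξ₀ ↔ ⁅ξ₀, Y⁆ = 0 := Iff.rfl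

theorem mem_nilNeg {x : 𝔤} : x ∈ nilNeg ξ₀ ↔ x ∈ negSpace (LieAlgebra.ad ℂ 𝔤 ξ₀) := Iff.rfl

theorem mem_nilNeg_of_lie {x : 𝔤} {t : ℝ} (ht : t < 0) (hx : ⁅ξ₀, x⁆ = (t : ℂ) • x) :
    x ∈ nilNeg ξ₀ := mem_nilNeg.2 (mem_negSpace ht hx)

theorem nilNeg_le {S : Submodule ℂ 𝔤}
    (h : ∀ t : ℝ, t < 0 → ∀ x, ⁅ξ₀, x⁆ = (t : ℂ) • x → x ∈ S) : (nilNeg ξ₀).toSubmodule ≤ S :=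
  negSpace_le (D := LieAlgebra.ad ℂ 𝔤 ξ₀) h

theorem nilPos_eq_negSpace : nilPos ξ₀ = negSpace (-LieAlgebra.ad ℂ 𝔤 ξ₀) := by
  refine le_antisymm (iSup₂_le fun t ht x hx => ?_) (negSpace_le fun t ht x hx => ?_)
  · refine mem_negSpace (neg_lt_zero.2 ht) ?_
    rw [LinearMap.neg_apply, Module.End.mem_eigenspace_iff.1 hx, Complex.ofReal_neg, neg_smul]
  · refine Submodule.mem_iSup_of_mem (-t) (Submodule.mem_iSup_of_mem (neg_pos.2 ht) ?_)
    rw [LinearMap.neg_apply] at hx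
    rw [Module.End.mem_eigenspace_iff, Complex.ofReal_neg, neg_smul, ← hx, neg_neg]

theorem mem_nilPos_of_lie {x : 𝔤} {t : ℝ} (ht : 0 < t) (hx : ⁅ξ₀, x⁆ = (t : ℂ) • x) :
    x ∈ nilPos ξ₀ :=
  Submodule.mem_iSup_of_mem t (Submodule.mem_iSup_of_mem ht (Module.End.mem_eigenspace_iff.2 hx))

theorem nilPos_le {S : Submodule ℂ 𝔤}
    (h : ∀ t : ℝ, 0 < t → ∀ x, ⁅ξ₀, x⁆ = (t : ℂ) • x → x ∈ S) : nilPos ξ₀ ≤ S :=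
  iSup₂_le fun t ht x hx => h t ht x (Module.End.mem_eigenspace_iff.1 hx)

theorem lie_eigen {x y : 𝔤} {s t : ℂ} (hx : ⁅ξ₀, x⁆ = s • x) (hy : ⁅ξ₀, y⁆ = t • y) :
    ⁅ξ₀, ⁅x, y⁆⁆ = (s + t) • ⁅x, y⁆ := by
  rw [leibniz_lie, hx, hy, smul_lie, lie_smul, add_smul]

theorem nilPos_lie_mem {x y : 𝔤} (hx : x ∈ nilPos ξ₀) (hy : y ∈ nilPos ξ₀) :
    ⁅x, y⁆ ∈ nilPos ξ₀ := by
  have h1 : nilPos ξ₀ ≤ (nilPos ξ₀).comap (-LieAlgebra.ad ℂ 𝔤 y) := nilPos_le fun s hs x hx => by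
    have h2 : nilPos ξ₀ ≤ (nilPos ξ₀).comap (LieAlgebra.ad ℂ 𝔤 x) := nilPos_le fun t ht y hy => by
      refine mem_nilPos_of_lie (add_pos hs ht) ?_
      rw [LieAlgebra.ad_apply, lie_eigen hx hy, Complex.ofReal_add]
    rw [Submodule.mem_comap, LinearMap.neg_apply, LieAlgebra.ad_apply, lie_skew]
    exact h2 hy
  have := h1 hx
  rwa [Submodule.mem_comap, LinearMap.neg_apply, LieAlgebra.ad_apply, lie_skew] at this

theorem levi_lie_nilPos_mem {Y x : 𝔤} (hY : Y ∈ levi ξ₀) (hx : x ∈ nilPos ξ₀) :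
    ⁅Y, x⁆ ∈ nilPos ξ₀ := by
  have h1 : nilPos ξ₀ ≤ (nilPos ξ₀).comap (LieAlgebra.ad ℂ 𝔤 Y) := nilPos_le fun s hs x hx => by
    refine mem_nilPos_of_lie hs ?_
    rw [LieAlgebra.ad_apply, leibniz_lie, mem_levi.1 hY, zero_lie, zero_add, hx, lie_smul]
  exact h1 hx

theorem levi_lie_nilNeg_mem {Y x : 𝔤} (hY : Y ∈ levi ξ₀) (hx : x ∈ nilNeg ξ₀) :
    ⁅Y, x⁆ ∈ nilNeg ξ₀ :=
  (nilNeg ξ₀).lie_mem (x := (⟨Y, hY⟩ : levi ξ₀)) hx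

/-- The opposite parabolic subspace `𝔥 + 𝔲bar`. -/
def parNeg (ξ₀ : 𝔤) : Submodule ℂ 𝔤 := (levi ξ₀).toSubmodule ⊔ (nilNeg ξ₀).toSubmodule

theorem parNeg_sup_nilPos (hξ₀ : ⨆ t : ℝ, (LieAlgebra.ad ℂ 𝔤 ξ₀).eigenspace (t : ℂ) = ⊤) :
    parNeg ξ₀ ⊔ nilPos ξ₀ = ⊤ := by
  rw [eq_top_iff, ← hξ₀]
  refine iSup_le fun t x hx => ?_
  have hx' : ⁅ξ₀, x⁆ = (t : ℂ) • x := Module.End.mem_eigenspace_iff.1 hx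
  rcases lt_trichotomy t 0 with h | h | h
  · exact Submodule.mem_sup_left (Submodule.mem_sup_right (mem_nilNeg_of_lie h hx'))
  · refine Submodule.mem_sup_left (Submodule.mem_sup_left ?_)
    change ⁅ξ₀, x⁆ = 0
    rw [hx', h, Complex.ofReal_zero, zero_smul]
  · exact Submodule.mem_sup_right (mem_nilPos_of_lie h hx')

theorem eq_zero_of_mem_nilPos {x : 𝔤} (hx : x ∈ nilPos ξ₀) (h : ⁅ξ₀, x⁆ = 0) : x = 0 := by
  rw [nilPos_eq_negSpace] at hx
  refine eq_zero_of_mem_negSpace hx ?_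
  rw [LinearMap.neg_apply, LieAlgebra.ad_apply, h, neg_zero]

theorem eq_zero_of_mem_nilNeg {x : 𝔤} (hx : x ∈ nilNeg ξ₀) (h : ⁅ξ₀, x⁆ = 0) : x = 0 :=
  eq_zero_of_mem_negSpace (mem_nilNeg.1 hx) h

/-- Invariance under `ξ₀` says `(s + t) Φ(x, y) = 0`: only opposite weights can pair nontrivially.
-/
theorem form_eq_zero {Φ : LinearMap.BilinForm ℂ 𝔤} (hΦ : Φ.lieInvariant 𝔤) {x y : 𝔤} {s t : ℂ}
    (hx : ⁅ξ₀, x⁆ = s • x) (hy : ⁅ξ₀, y⁆ = t • y) (h : s + t ≠ 0) : Φ x y = 0 := by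
  have := hΦ ξ₀ x y
  rw [hx, hy, map_smul, map_smul, LinearMap.smul_apply, smul_eq_mul, smul_eq_mul,
    ← add_eq_zero_iff_eq_neg, ← add_mul] at this
  exact (mul_eq_zero.1 this).resolve_left h

theorem form_parNeg_nilNeg {Φ : LinearMap.BilinForm ℂ 𝔤} (hΦ : Φ.lieInvariant 𝔤) {x y : 𝔤}
    (hx : x ∈ parNeg ξ₀) (hy : y ∈ nilNeg ξ₀) : Φ x y = 0 := by
  have h1 : (nilNeg ξ₀).toSubmodule ≤ LinearMap.ker (Φ x) := nilNeg_le fun t ht y hy => by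
    have h2 : parNeg ξ₀ ≤ LinearMap.ker (Φ.flip y) := by
      refine sup_le (fun Y hY => ?_) (nilNeg_le fun s hs x hx => ?_)
      · have hY' : ⁅ξ₀, Y⁆ = (0 : ℂ) • Y := by rw [zero_smul]; exact hY
        exact form_eq_zero hΦ hY' hy (by rw [zero_add]; exact_mod_cast ht.ne)
      · exact form_eq_zero hΦ hx hy (by exact_mod_cast (add_neg hs ht).ne)
    exact h2 hx
  exact h1 hy

theorem form_nilPos_nilPos {Φ : LinearMap.BilinForm ℂ 𝔤} (hΦ : Φ.lieInvariant 𝔤) {x y : 𝔤}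
    (hx : x ∈ nilPos ξ₀) (hy : y ∈ nilPos ξ₀) : Φ x y = 0 := by
  have h1 : nilPos ξ₀ ≤ LinearMap.ker (Φ x) := nilPos_le fun t ht y hy => by
    have h2 : nilPos ξ₀ ≤ LinearMap.ker (Φ.flip y) := nilPos_le fun s hs x hx =>
      form_eq_zero hΦ hx hy (by exact_mod_cast (add_pos hs ht).ne')
    exact h2 hx
  exact h1 hy

theorem form_nilPos_levi {Φ : LinearMap.BilinForm ℂ 𝔤} (hΦ : Φ.lieInvariant 𝔤) {x y : 𝔤}
    (hx : x ∈ nilPos ξ₀) (hy : y ∈ levi ξ₀) : Φ x y = 0 := by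
  have h2 : nilPos ξ₀ ≤ LinearMap.ker (Φ.flip y) := nilPos_le fun s hs x hx => by
    have hY' : ⁅ξ₀, y⁆ = (0 : ℂ) • y := by rw [zero_smul]; exact hy
    exact form_eq_zero hΦ hx hY' (by rw [add_zero]; exact_mod_cast hs.ne')
  exact h2 hx

theorem mem_derived_of_lie {x : 𝔤} {t : ℂ} (ht : t ≠ 0) (hx : ⁅ξ₀, x⁆ = t • x) :
    x ∈ LieAlgebra.derivedSeries ℂ 𝔤 1 := by
  have h : x = t⁻¹ • ⁅ξ₀, x⁆ := by rw [hx, smul_smul, inv_mul_cancel₀ ht, one_smul]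
  rw [h]
  refine Submodule.smul_mem _ _ ?_
  exact LieSubmodule.lie_mem_lie (N := (⊤ : LieIdeal ℂ 𝔤)) (I := (⊤ : LieIdeal ℂ 𝔤)) trivial trivial

theorem nilPos_le_derived :
    nilPos ξ₀ ≤ (LieAlgebra.derivedSeries ℂ 𝔤 1).toSubmodule :=
  nilPos_le fun _ ht _ hx => mem_derived_of_lie (by exact_mod_cast ht.ne') hx

theorem nilNeg_le_derived :
    (nilNeg ξ₀).toSubmodule ≤ (LieAlgebra.derivedSeries ℂ 𝔤 1).toSubmodule :=
  nilNeg_le fun _ ht _ hx => mem_derived_of_lie (by exact_mod_cast ht.ne) hx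

theorem killingForm_center {x : 𝔤} (h : ∀ y : 𝔤, ⁅y, x⁆ = 0) (y : 𝔤) : killingForm ℂ 𝔤 x y = 0 := by
  have : LieAlgebra.ad ℂ 𝔤 x = 0 := by
    ext z; rw [LieAlgebra.ad_apply, ← lie_skew, h, neg_zero, LinearMap.zero_apply]
  rw [killingForm_apply_apply, this, LinearMap.zero_comp, map_zero]

variable [FiniteDimensional ℂ 𝔤]

/-- By weights, only the `𝔲` component of `x` pairs with `ξ`. Vectors of nonzero weight are brackets
with `ξ₀`, so both arguments lie in the derived algebra, where `B` is prescribed; the Killing form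
of an ideal is the restriction. -/
theorem form_eq_killingForm {B : LinearMap.BilinForm ℂ 𝔤} (hBinv : B.lieInvariant 𝔤)
    (hB : ∀ x y : LieAlgebra.derivedSeries ℂ 𝔤 1,
      B x y = killingForm ℂ (LieAlgebra.derivedSeries ℂ 𝔤 1) x y)
    (hξ₀ : ⨆ t : ℝ, (LieAlgebra.ad ℂ 𝔤 ξ₀).eigenspace (t : ℂ) = ⊤)
    (x : 𝔤) {ξ : 𝔤} (hξ : ξ ∈ nilNeg ξ₀) : B x ξ = killingForm ℂ 𝔤 x ξ := by
  have hx : x ∈ parNeg ξ₀ ⊔ nilPos ξ₀ := by rw [parNeg_sup_nilPos hξ₀]; trivial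
  obtain ⟨y, hy, z, hz, rfl⟩ := Submodule.mem_sup.1 hx
  have hκ := LieModule.traceForm_lieInvariant ℂ 𝔤 𝔤
  rw [map_add, map_add, LinearMap.add_apply, LinearMap.add_apply, form_parNeg_nilNeg hBinv hy hξ,
    form_parNeg_nilNeg hκ hy hξ, zero_add, zero_add]
  have h := hB ⟨z, nilPos_le_derived hz⟩ ⟨ξ, nilNeg_le_derived hξ⟩
  rw [LieIdeal.killingForm_eq] at h
  exact h

/-- In finite dimension, the range of a symmetric form is the annihilator of its kernel. -/
theorem exists_killingForm_eq (ψ : Module.Dual ℂ 𝔤)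
    (h : ∀ x, (∀ y, killingForm ℂ 𝔤 x y = 0) → ψ x = 0) :
    ∃ a, ∀ x, killingForm ℂ 𝔤 a x = ψ x := by
  have h1 : ψ ∈ LinearMap.range (killingForm ℂ 𝔤).dualMap := by
    rw [LinearMap.range_dualMap_eq_dualAnnihilator_ker, Submodule.mem_dualAnnihilator]
    exact fun x hx => h x fun y => by rw [LinearMap.mem_ker.1 hx, LinearMap.zero_apply]
  obtain ⟨Ψ, hΨ⟩ := h1
  obtain ⟨a, rfl⟩ := (Module.evalEquiv ℂ 𝔤).surjective Ψ
  refine ⟨a, fun x => ?_⟩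
  rw [← hΨ, LieModule.traceForm_comm]
  rfl

variable [LieAlgebra.HasCentralRadical ℂ 𝔤]

/-- The kernel of the Killing form is contained in the solvable radical, which is the center by
reductivity. -/
theorem mem_center_of_killingForm_eq_zero {x : 𝔤} (h : ∀ y, killingForm ℂ 𝔤 x y = 0) (y : 𝔤) :
    ⁅y, x⁆ = 0 := by
  have h1 : x ∈ LieIdeal.killingCompl ℂ 𝔤 ⊤ := by
    rw [LieIdeal.mem_killingCompl]
    intro y _
    rw [LieModule.traceForm_comm]; exact h y
  have h2 := LieAlgebra.killingCompl_top_le_radical ℂ 𝔤 h1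
  rw [LieAlgebra.radical_eq_center] at h2
  exact (LieModule.mem_maxTrivSubmodule ℂ 𝔤 𝔤 x).1 h2 y

/-- Weights make `x` orthogonal to `𝔥 + 𝔲` in any case. Orthogonality to `𝔲bar` therefore puts it in
the center, hence in weight zero, which meets `𝔲` trivially. -/
theorem eq_zero_of_killingForm_nilPos
    (hξ₀ : ⨆ t : ℝ, (LieAlgebra.ad ℂ 𝔤 ξ₀).eigenspace (t : ℂ) = ⊤) {x : 𝔤} (hx : x ∈ nilPos ξ₀)
    (h : ∀ ξ ∈ nilNeg ξ₀, killingForm ℂ 𝔤 x ξ = 0) : x = 0 := by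
  refine eq_zero_of_mem_nilPos hx (mem_center_of_killingForm_eq_zero (fun y => ?_) ξ₀)
  have hκ := LieModule.traceForm_lieInvariant ℂ 𝔤 𝔤
  have hy : y ∈ parNeg ξ₀ ⊔ nilPos ξ₀ := by rw [parNeg_sup_nilPos hξ₀]; trivial
  obtain ⟨y', hy', z, hz, rfl⟩ := Submodule.mem_sup.1 hy
  obtain ⟨Y, hY, ξ, hξ, rfl⟩ := Submodule.mem_sup.1 hy'
  rw [map_add, map_add, h ξ hξ]
  have h1 := form_nilPos_levi hκ hx hY
  have h2 := form_nilPos_nilPos hκ hx hz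
  rw [h1, h2]; simp

theorem eq_zero_of_killingForm_nilNeg
    (hξ₀ : ⨆ t : ℝ, (LieAlgebra.ad ℂ 𝔤 ξ₀).eigenspace (t : ℂ) = ⊤) {ξ : 𝔤} (hξ : ξ ∈ nilNeg ξ₀)
    (h : ∀ x ∈ nilPos ξ₀, killingForm ℂ 𝔤 x ξ = 0) : ξ = 0 := by
  refine eq_zero_of_mem_nilNeg hξ (mem_center_of_killingForm_eq_zero (fun y => ?_) ξ₀)
  have hκ := LieModule.traceForm_lieInvariant ℂ 𝔤 𝔤
  have hy : y ∈ parNeg ξ₀ ⊔ nilPos ξ₀ := by rw [parNeg_sup_nilPos hξ₀]; trivial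
  obtain ⟨y', hy', z, hz, rfl⟩ := Submodule.mem_sup.1 hy
  rw [LieModule.traceForm_comm, map_add, LinearMap.add_apply]
  have h1 := form_parNeg_nilNeg hκ hy' hξ
  rw [h1, zero_add]; exact h z hz

/-- A basis of `𝔲` has a dual basis in `𝔲bar`. -/
theorem exists_dual_basis {B : LinearMap.BilinForm ℂ 𝔤} (hBinv : B.lieInvariant 𝔤)
    (hB : ∀ x y : LieAlgebra.derivedSeries ℂ 𝔤 1,
      B x y = killingForm ℂ (LieAlgebra.derivedSeries ℂ 𝔤 1) x y)
    (hξ₀ : ⨆ t : ℝ, (LieAlgebra.ad ℂ 𝔤 ξ₀).eigenspace (t : ℂ) = ⊤)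
    {n : ℕ} (X : Module.Basis (Fin n) ℂ (nilPos ξ₀)) :
    ∃ ξ : Module.Basis (Fin n) ℂ (nilNeg ξ₀),
      (∀ i j, B (X i : 𝔤) (ξ j : 𝔤) = if i = j then 1 else 0) ∧
      ∀ ξ' : Fin n → nilNeg ξ₀,
        (∀ i j, B (X i : 𝔤) (ξ' j : 𝔤) = if i = j then 1 else 0) → ξ' = ξ := by
  let b : nilPos ξ₀ →ₗ[ℂ] nilNeg ξ₀ →ₗ[ℂ] ℂ :=
    LinearMap.mk₂ ℂ (fun x y => B (x : 𝔤) (y : 𝔤)) (fun x x' y => by simp) (fun c x y => by simp)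
      (fun x y y' => by simp) (fun c x y => by simp)
  have hb : ∀ (x : nilPos ξ₀) (y : nilNeg ξ₀), b x y = killingForm ℂ 𝔤 x y := fun x y =>
    form_eq_killingForm hBinv hB hξ₀ x y.2
  have h1 : Function.Injective b := (injective_iff_map_eq_zero _).2 fun x hx =>
    Subtype.ext (eq_zero_of_killingForm_nilPos hξ₀ x.2 fun ξ hξ => by
      rw [← hb x ⟨ξ, hξ⟩, hx, LinearMap.zero_apply])
  have h2 : Function.Injective b.flip := (injective_iff_map_eq_zero _).2 fun y hy =>
    Subtype.ext (eq_zero_of_killingForm_nilNeg hξ₀ y.2 fun x hx => by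
      rw [← hb ⟨x, hx⟩ y, ← LinearMap.flip_apply, hy, LinearMap.zero_apply])
  have h3 : Module.finrank ℂ (nilNeg ξ₀) = Module.finrank ℂ (Module.Dual ℂ (nilPos ξ₀)) := by
    refine le_antisymm (LinearMap.finrank_le_finrank_of_injective h2) ?_
    rw [Subspace.dual_finrank_eq]
    refine (LinearMap.finrank_le_finrank_of_injective h1).trans (le_of_eq ?_)
    exact Subspace.dual_finrank_eq
  let e : nilNeg ξ₀ ≃ₗ[ℂ] Module.Dual ℂ (nilPos ξ₀) :=
    LinearMap.linearEquivOfInjective b.flip h2 h3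
  have he : ∀ (x : nilPos ξ₀) (y : nilNeg ξ₀), e y x = B x y := fun _ _ => rfl
  have h4 : ∀ i j, B (X i : 𝔤) ((X.dualBasis.map e.symm) j : 𝔤) = if i = j then 1 else 0 :=
    fun i j => by
      rw [← he, Module.Basis.map_apply, LinearEquiv.apply_symm_apply, Module.Basis.coe_dualBasis,
        Module.Basis.coord_apply, Module.Basis.repr_self, Finsupp.single_apply]
  refine ⟨X.dualBasis.map e.symm, h4, fun ξ' hξ' => funext fun j => e.injective ?_⟩
  refine X.ext fun i => ?_
  rw [he, he, hξ', h4]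

/-! ### Linear forms on a reductive Lie algebra -/

/-- A linear form evaluated on brackets is the Killing form with a fixed element evaluated on
brackets: the second cohomology of a semisimple Lie algebra vanishes. -/
theorem exists_killingForm_lie (φ : Module.Dual ℂ 𝔤) :
    ∃ a, ∀ x y : 𝔤, φ ⁅x, y⁆ = killingForm ℂ 𝔤 a ⁅x, y⁆ := by
  set κ := killingForm ℂ 𝔤 with hκ
  have hinv : κ.lieInvariant 𝔤 := LieModule.traceForm_lieInvariant ℂ 𝔤 𝔤
  have hcenter : ∀ x, (∀ y, κ x y = 0) → ∀ y, ⁅y, x⁆ = 0 := fun x =>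
    mem_center_of_killingForm_eq_zero
  have hω : ∀ x, φ.comp (LieAlgebra.ad ℂ 𝔤 x) ∈ LinearMap.range κ := fun x => by
    obtain ⟨a, ha⟩ := exists_killingForm_eq (φ.comp (LieAlgebra.ad ℂ 𝔤 x)) fun z hz => by
      rw [LinearMap.comp_apply, LieAlgebra.ad_apply, hcenter z hz, map_zero]
    exact ⟨a, LinearMap.ext ha⟩
  let ω : 𝔤 →ₗ[ℂ] LinearMap.range κ :=
    { toFun := fun x => ⟨φ.comp (LieAlgebra.ad ℂ 𝔤 x), hω x⟩
      map_add' := fun x y => Subtype.ext (by ext z; simp)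
      map_smul' := fun c x => Subtype.ext (by ext z; simp) }
  -- The forms `φ ∘ ad x` vanish on the center, so each is represented by the Killing form. The lift
  -- `D` represents them linearly in `x`, and invariance will make it a derivation modulo the
  -- center.
  obtain ⟨D, hD⟩ := Module.projective_lifting_property κ.rangeRestrict ω
    κ.surjective_rangeRestrict
  have hD' : ∀ x y, κ (D x) y = φ ⁅x, y⁆ := fun x y => by
    have := congrArg Subtype.val (DFunLike.congr_fun hD x)
    exact DFunLike.congr_fun this y
  let ψ : Module.Dual ℂ 𝔤 := LinearMap.trace ℂ 𝔤 ∘ₗ LinearMap.mulLeft ℂ D ∘ₗ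
    (LieAlgebra.ad ℂ 𝔤).toLinearMap
  have hψ : ∀ x, ψ x = LinearMap.trace ℂ 𝔤 (D * LieAlgebra.ad ℂ 𝔤 x) := fun _ => rfl
  -- The element `a` is chosen so that subtracting `ad a` makes `E` trace-orthogonal to every `ad
  -- x`.
  obtain ⟨a, ha⟩ := exists_killingForm_eq ψ fun x hx => by
    have : LieAlgebra.ad ℂ 𝔤 x = 0 := by
      ext z
      rw [LieAlgebra.ad_apply, ← lie_skew, hcenter x hx, neg_zero, LinearMap.zero_apply]
    rw [hψ, this, mul_zero, map_zero]
  set E : Module.End ℂ 𝔤 := D - LieAlgebra.ad ℂ 𝔤 a with hE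
  have htr : ∀ x, LinearMap.trace ℂ 𝔤 (E * LieAlgebra.ad ℂ 𝔤 x) = 0 := fun x => by
    rw [hE, sub_mul, map_sub, ← hψ, ← ha, killingForm_apply_apply]
    exact sub_self _
  have hder : ∀ x y w, ⁅w, E ⁅x, y⁆ - ⁅E x, y⁆ - ⁅x, E y⁆⁆ = 0 := fun x y w => by
    refine hcenter _ (fun z => ?_) w
    have e1 : E ⁅x, y⁆ - ⁅E x, y⁆ - ⁅x, E y⁆ = D ⁅x, y⁆ - ⁅D x, y⁆ - ⁅x, D y⁆ := by
      simp only [hE, LinearMap.sub_apply, LieAlgebra.ad_apply, sub_lie, lie_sub]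
      rw [leibniz_lie a x y]; abel
    have e2 : κ ⁅D x, y⁆ z = φ ⁅x, ⁅y, z⁆⁆ := by
      rw [← lie_skew, map_neg, LinearMap.neg_apply, hinv, neg_neg, hD']
    rw [e1, map_sub, map_sub, LinearMap.sub_apply, LinearMap.sub_apply, hD', e2, hinv, hD',
      leibniz_lie x y z, map_add]
    ring
  refine ⟨a, fun x y => ?_⟩
  -- Modulo center-valued maps, which `ad y` annihilates, `ad(E x)` is `[E, ad x]`. Cyclicity of the
  -- trace then gives `κ(E x, y) = tr(E ad [x, y]) = 0`.
  have key : κ (E x) y = 0 := by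
    rw [hκ, killingForm_apply_apply]
    have e3 : LieAlgebra.ad ℂ 𝔤 (E x) * LieAlgebra.ad ℂ 𝔤 y =
        E * LieAlgebra.ad ℂ 𝔤 x * LieAlgebra.ad ℂ 𝔤 y
          - LieAlgebra.ad ℂ 𝔤 x * E * LieAlgebra.ad ℂ 𝔤 y
          - (E * LieAlgebra.ad ℂ 𝔤 x - LieAlgebra.ad ℂ 𝔤 (E x) - LieAlgebra.ad ℂ 𝔤 x * E)
            * LieAlgebra.ad ℂ 𝔤 y := by noncomm_ring
    have e4 : LinearMap.trace ℂ 𝔤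
        ((E * LieAlgebra.ad ℂ 𝔤 x - LieAlgebra.ad ℂ 𝔤 (E x) - LieAlgebra.ad ℂ 𝔤 x * E)
            * LieAlgebra.ad ℂ 𝔤 y) = 0 := by
      rw [LinearMap.trace_mul_comm]
      have : LieAlgebra.ad ℂ 𝔤 y * (E * LieAlgebra.ad ℂ 𝔤 x - LieAlgebra.ad ℂ 𝔤 (E x) -
          LieAlgebra.ad ℂ 𝔤 x * E) = 0 := LinearMap.ext fun z => hder x z y
      rw [this, map_zero]
    have e5 : LinearMap.trace ℂ 𝔤 (LieAlgebra.ad ℂ 𝔤 x * E * LieAlgebra.ad ℂ 𝔤 y) =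
        LinearMap.trace ℂ 𝔤 (E * LieAlgebra.ad ℂ 𝔤 y * LieAlgebra.ad ℂ 𝔤 x) := by
      rw [mul_assoc, LinearMap.trace_mul_comm, mul_assoc]
    have e6 := htr ⁅x, y⁆
    rw [LieHom.map_lie, Ring.lie_def, mul_sub, map_sub, ← mul_assoc, ← mul_assoc] at e6
    change LinearMap.trace ℂ 𝔤 (LieAlgebra.ad ℂ 𝔤 (E x) * LieAlgebra.ad ℂ 𝔤 y) = 0
    rw [e3, map_sub, map_sub, e4, e5, sub_zero, e6]
  rw [hE, LinearMap.sub_apply, map_sub, LinearMap.sub_apply, hD', LieAlgebra.ad_apply,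
    sub_eq_zero] at key
  rw [key, ← lie_skew, map_neg, LinearMap.neg_apply, hinv, neg_neg]

/-- The center of a reductive Lie algebra is separated by the linear forms that vanish on
brackets. -/
theorem exists_form_ne_zero {x : 𝔤} (hx : ∀ y : 𝔤, ⁅y, x⁆ = 0) (hx0 : x ≠ 0) :
    ∃ ψ : Module.Dual ℂ 𝔤, (∀ y z : 𝔤, ψ ⁅y, z⁆ = 0) ∧ ψ x ≠ 0 := by
  obtain ⟨φ, hφ⟩ : ∃ φ : Module.Dual ℂ 𝔤, φ x ≠ 0 := by
    by_contra! h
    exact hx0 ((Module.forall_dual_apply_eq_zero_iff ℂ x).1 h)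
  obtain ⟨a, ha⟩ := exists_killingForm_lie φ
  refine ⟨φ - killingForm ℂ 𝔤 a, fun y z => ?_, ?_⟩
  · rw [LinearMap.sub_apply, ha, sub_self]
  · rw [LinearMap.sub_apply, LieModule.traceForm_comm, killingForm_center hx, sub_zero]
    exact hφ

variable (𝔤) in
/-- The linear forms that vanish on brackets. -/
abbrev AbelForms : Type _ := {ψ : Module.Dual ℂ 𝔤 // ∀ y z : 𝔤, ψ ⁅y, z⁆ = 0}

variable (𝔤) in
/-- A representation of `𝔤` in an algebra, which is faithful if `𝔤` is reductive. -/
def faithfulRep : 𝔤 →ₗ⁅ℂ⁆ Module.End ℂ 𝔤 × (AbelForms 𝔤 → DualNumber ℂ) where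
  toFun x := (LieAlgebra.ad ℂ 𝔤 x, fun ψ => TrivSqZeroExt.inr (ψ.1 x))
  map_add' x y := by
    refine Prod.ext (map_add _ x y) (funext fun ψ => ?_)
    simp [add_smul]
  map_smul' c x := by
    refine Prod.ext (map_smul _ c x) (funext fun ψ => ?_)
    simp [mul_smul]
  map_lie' {x y} := by
    refine Prod.ext ?_ (funext fun ψ => ?_)
    · simp [Ring.lie_def]
    · simp [Ring.lie_def, ψ.2 x y]

/-- The representation `faithfulRep` has a linear left inverse that annihilates `1`. -/
theorem exists_leftInverse_faithfulRep :
    ∃ s : (Module.End ℂ 𝔤 × (AbelForms 𝔤 → DualNumber ℂ)) →ₗ[ℂ] 𝔤,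
      s 1 = 0 ∧ ∀ x, s (faithfulRep 𝔤 x) = x := by
  -- Adjoining `ℂ · 1` to the image and inverting on the sum provides a left inverse that vanishes
  -- on `1`.
  let g : (𝔤 × ℂ) →ₗ[ℂ] Module.End ℂ 𝔤 × (AbelForms 𝔤 → DualNumber ℂ) :=
    (faithfulRep 𝔤).toLinearMap.coprod (LinearMap.toSpanSingleton ℂ _ 1)
  have hg : ∀ x c, g (x, c) = faithfulRep 𝔤 x + c • 1 := fun x c => by
    simp [g, LinearMap.coprod_apply, LinearMap.toSpanSingleton_apply]
  have hinj : LinearMap.ker g = ⊥ := by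
    rw [LinearMap.ker_eq_bot']
    rintro ⟨x, c⟩ h
    rw [hg] at h
    -- The image of `𝔤` has only multiples of `ε` in the dual number coordinates, so the coordinate
    -- of the zero form detects `c`.
    have hc : c = 0 := by
      have := congrArg (fun z => (z.2 ⟨0, fun _ _ => rfl⟩).fst) h
      simpa [faithfulRep] using this
    rw [hc, zero_smul, add_zero] at h
    have h1 : ∀ y : 𝔤, ⁅y, x⁆ = 0 := fun y => by
      have := DFunLike.congr_fun (congrArg Prod.fst h) y
      have : ⁅x, y⁆ = 0 := this
      rw [← lie_skew, this, neg_zero]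
    -- The adjoint coordinate shows that `x` is central; the coordinates of the forms vanishing on
    -- brackets then separate it from zero.
    have h2 : x = 0 := by
      by_contra hx
      obtain ⟨ψ, hψ, hψx⟩ := exists_form_ne_zero h1 hx
      have := congrArg (fun z => (z.2 ⟨ψ, hψ⟩).snd) h
      exact hψx (by simpa [faithfulRep] using this)
    rw [hc, h2]; rfl
  obtain ⟨s, hs⟩ := g.exists_leftInverse_of_injective hinj
  refine ⟨LinearMap.fst ℂ 𝔤 ℂ ∘ₗ s, ?_, fun x => ?_⟩
  · have := congrArg Prod.fst (DFunLike.congr_fun hs ((0 : 𝔤), (1 : ℂ)))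
    simpa [hg] using this
  · have := congrArg Prod.fst (DFunLike.congr_fun hs (x, (0 : ℂ)))
    simpa [hg] using this

end Triangular

/-! ### The decomposition of the enveloping algebra -/

section Decomposition

open UniversalEnvelopingAlgebra (ι)

variable {𝔤 : Type*} [LieRing 𝔤] [LieAlgebra ℂ 𝔤] {ξ₀ : 𝔤}

theorem leviIncl_iota (Y : levi ξ₀) : leviIncl ξ₀ (ι ℂ Y) = ι ℂ (Y : 𝔤) :=
  UniversalEnvelopingAlgebra.lift_ι_apply ℂ _ Y

/-- The trivial representation of an enveloping algebra. -/
def counit (L : Type*) [LieRing L] [LieAlgebra ℂ L] : UniversalEnvelopingAlgebra ℂ L →ₐ[ℂ] ℂ :=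
  UniversalEnvelopingAlgebra.lift ℂ 0

theorem algebraMap_env_injective {L : Type*} [LieRing L] [LieAlgebra ℂ L] {c : ℂ}
    (h : algebraMap ℂ (UniversalEnvelopingAlgebra ℂ L) c = 0) : c = 0 := by
  have := congrArg (counit L) h
  rwa [AlgHom.commutes, map_zero] at this

/-! ### Injectivity of `U(𝔥) → U(𝔤)`. -/

section Injective

variable [FiniteDimensional ℂ 𝔤] [LieAlgebra.HasCentralRadical ℂ 𝔤]

-- Taking `P = ⊥` makes the Euler operator of `U(𝔥)` measure the total degree. The representation is
-- restricted from `𝔤`, so the derivatives descend along `U(𝔥) → U(𝔤)` by `coder_natural`.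
variable (ξ₀) in
theorem exists_levi_frame : ∃ F : Frame (levi ξ₀)
    (Module.End ℂ 𝔤 × (AbelForms 𝔤 → DualNumber ℂ)) (Module.finrank ℂ (levi ξ₀)),
    F.rho = (faithfulRep 𝔤).comp (levi ξ₀).incl ∧ F.P = ⊥ := by
  obtain ⟨s, hs1, hs⟩ := exists_leftInverse_faithfulRep (𝔤 := 𝔤)
  obtain ⟨r, hr⟩ := (levi ξ₀).toSubmodule.subtype.exists_leftInverse_of_injective
    (levi ξ₀).toSubmodule.ker_subtype
  have hr' : ∀ Y : levi ξ₀, r Y = Y := fun Y => DFunLike.congr_fun hr Y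
  let b := Module.finBasis ℂ (levi ξ₀)
  refine ⟨{ rho := (faithfulRep 𝔤).comp (levi ξ₀).incl
            f := fun i => b.coord i ∘ₗ r ∘ₗ s
            X := b
            S := ⊥
            P := ⊥
            f_eq_zero := ?_
            rho_mem := ?_
            f_rho_X := ?_
            sup_eq_top := ?_ }, rfl, rfl⟩
  · intro i T hT
    obtain ⟨c, rfl⟩ := Algebra.mem_bot.1 hT
    simp only [LinearMap.comp_apply]
    rw [Algebra.algebraMap_eq_smul_one, map_smul, hs1, smul_zero, map_zero, map_zero]
  · intro x hx
    rw [(Submodule.mem_bot ℂ).1 hx, map_zero]; exact zero_mem _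
  · intro i j
    have h1 : ((faithfulRep 𝔤).comp (levi ξ₀).incl) (b j) = faithfulRep 𝔤 (b j : 𝔤) := rfl
    simp only [LinearMap.comp_apply]
    rw [h1, hs, hr', Module.Basis.coord_apply, Module.Basis.repr_self, Finsupp.single_apply]
    simp only [eq_comm]
  · rw [bot_sup_eq, b.span_eq]

variable (ξ₀) in
/-- The map `U(𝔥) → U(𝔤)` is injective. -/
theorem leviIncl_injective : Function.Injective (leviIncl ξ₀) := by
  obtain ⟨F, hF, hP⟩ := exists_levi_frame ξ₀
  -- The kernel of `U(𝔥) → U(𝔤)` is stable under all derivatives.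
  have hder : ∀ i w, leviIncl ξ₀ w = 0 → leviIncl ξ₀ (F.der i w) = 0 := fun i w hw => by
    have := coder_natural (levi ξ₀).incl (faithfulRep 𝔤) (F.f i) w
    rw [Frame.der, hF]
    refine this.trans ?_
    change coder _ _ (leviIncl ξ₀ w) = 0
    rw [hw, map_zero]
  have key : ∀ p, ∀ w ∈ ufil (levi ξ₀) p, leviIncl ξ₀ w = 0 → w = 0 := by
    intro p
    induction p with
    | zero => exact fun w hw _ => (Submodule.mem_bot ℂ).1 hw
    | succ p ih =>
      intro w hw h
      cases p with
      | zero =>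
        rw [ufil_one] at hw
        obtain ⟨c, rfl⟩ := Submodule.mem_one.1 hw
        rw [AlgHom.commutes] at h
        rw [algebraMap_env_injective h, map_zero]
      | succ p =>
        refine ih w ?_ h
        -- The derivatives of `w` have lower degree and stay in the kernel, so they vanish by
        -- induction. But the Euler operator multiplies `w` by `p + 1` modulo lower terms, which
        -- forces `w` itself into lower degree.
        have h1 : F.euler w = 0 := by
          rw [F.euler_apply]
          exact Finset.sum_eq_zero fun i _ => by
            rw [ih _ (F.der_mem hw i) (hder i w h), zero_mul]
        have h2 := F.euler_sub_mem_of_P_eq_bot hP hw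
        rw [h1, zero_sub, neg_mem_iff] at h2
        exact (Submodule.smul_mem_iff _ (by exact_mod_cast Nat.succ_ne_zero p)).1 h2
  refine (injective_iff_map_eq_zero _).2 fun w hw => ?_
  obtain ⟨p, hp⟩ := exists_mem_ufil w
  exact key p w hp hw

end Injective

/-! ### The derivatives of `U(𝔤)` dual to a basis of `𝔲`. -/

section MainFrame

/-- An eigenvector of `[a, ·]` with nonzero eigenvalue is a multiple of a commutator, and
commutators have trace zero. -/
theorem trace_eq_zero_of_mem_negSpace {a T : Module.End ℂ 𝔤} (hT : T ∈ negSpace (comm a)) :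
    LinearMap.trace ℂ 𝔤 T = 0 := by
  have : negSpace (comm a) ≤ LinearMap.ker (LinearMap.trace ℂ 𝔤) :=
    negSpace_le fun t ht T hT => by
      have h := congrArg (LinearMap.trace ℂ 𝔤) hT
      rw [comm_apply, map_sub, LinearMap.trace_mul_comm, sub_self, map_smul, smul_eq_mul] at h
      exact (mul_eq_zero.1 h.symm).resolve_left (by exact_mod_cast ht.ne)
  exact this hT

theorem ad_mem_negSpace {x : 𝔤} (hx : x ∈ nilNeg ξ₀) :
    LieAlgebra.ad ℂ 𝔤 x ∈ negSpace (comm (LieAlgebra.ad ℂ 𝔤 ξ₀)) :=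
  map_mem_negSpace (LieAlgebra.ad ℂ 𝔤).toLinearMap (fun y => by
    change comm (LieAlgebra.ad ℂ 𝔤 ξ₀) (LieAlgebra.ad ℂ 𝔤 y) = LieAlgebra.ad ℂ 𝔤 ⁅ξ₀, y⁆
    rw [LieHom.map_lie]; rfl) (mem_nilNeg.1 hx)

theorem ad_mem_nonposAlg {x : 𝔤} (hx : x ∈ parNeg ξ₀) :
    LieAlgebra.ad ℂ 𝔤 x ∈ nonposAlg (LieAlgebra.ad ℂ 𝔤 ξ₀) := by
  obtain ⟨Y, hY, ξ, hξ, rfl⟩ := Submodule.mem_sup.1 hx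
  rw [map_add]
  refine add_mem (mem_nonposAlg.2 (Submodule.mem_sup_left ?_))
    (mem_nonposAlg.2 (Submodule.mem_sup_right (ad_mem_negSpace hξ)))
  rw [LinearMap.mem_ker]
  have h : comm (LieAlgebra.ad ℂ 𝔤 ξ₀) (LieAlgebra.ad ℂ 𝔤 Y) = LieAlgebra.ad ℂ 𝔤 ⁅ξ₀, Y⁆ := by
    rw [LieHom.map_lie]; rfl
  rw [h, mem_levi.1 hY, map_zero]

/-- The linear form `T ↦ tr(T ad ξ)` on `End 𝔤`. -/
def traceAd (ξ : 𝔤) : Module.Dual ℂ (Module.End ℂ 𝔤) :=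
  LinearMap.trace ℂ 𝔤 ∘ₗ LinearMap.mulRight ℂ (LieAlgebra.ad ℂ 𝔤 ξ)

theorem traceAd_apply (ξ : 𝔤) (T : Module.End ℂ 𝔤) :
    traceAd ξ T = LinearMap.trace ℂ 𝔤 (T * LieAlgebra.ad ℂ 𝔤 ξ) := rfl

theorem traceAd_ad (ξ x : 𝔤) : traceAd ξ (LieAlgebra.ad ℂ 𝔤 x) = killingForm ℂ 𝔤 x ξ := rfl

theorem traceAd_lie (Y ξ : 𝔤) (T : Module.End ℂ 𝔤) :
    traceAd ξ (LieAlgebra.ad ℂ 𝔤 Y * T - T * LieAlgebra.ad ℂ 𝔤 Y) = -traceAd ⁅Y, ξ⁆ T := by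
  rw [traceAd_apply, traceAd_apply, LieHom.map_lie, Ring.lie_def, sub_mul, mul_sub, map_sub,
    map_sub, neg_sub, mul_assoc, LinearMap.trace_mul_comm, mul_assoc, mul_assoc]

/-- The frame of `𝔤` given by dual bases of `𝔲` and `𝔲bar`. -/
def mainFrame (hξ₀ : ⨆ t : ℝ, (LieAlgebra.ad ℂ 𝔤 ξ₀).eigenspace (t : ℂ) = ⊤) {n : ℕ}
    (X : Module.Basis (Fin n) ℂ (nilPos ξ₀)) (ξ : Fin n → nilNeg ξ₀)
    (hX : ∀ i j, killingForm ℂ 𝔤 (X i) (ξ j) = if i = j then 1 else 0) :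
    Frame 𝔤 (Module.End ℂ 𝔤) n where
  rho := LieAlgebra.ad ℂ 𝔤
  f j := traceAd (ξ j)
  X i := X i
  S := nonposAlg (LieAlgebra.ad ℂ 𝔤 ξ₀)
  P := parNeg ξ₀
  -- A nonpositive weight endomorphism times `ad ξ_j` has negative weight, hence trace zero.
  f_eq_zero j T hT := trace_eq_zero_of_mem_negSpace
    (mul_mem_negSpace_of_nonpos_left hT (ad_mem_negSpace (ξ j).2))
  rho_mem x hx := ad_mem_nonposAlg hx
  f_rho_X i j := by
    rw [traceAd_ad, hX]
    simp only [eq_comm]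
  sup_eq_top := by
    have h : Submodule.span ℂ (Set.range fun i => (X i : 𝔤)) = nilPos ξ₀ := by
      have h1 : (Set.range fun i => (X i : 𝔤)) = (nilPos ξ₀).subtype '' Set.range X := by
        rw [← Set.range_comp]; rfl
      rw [h1, Submodule.span_image, X.span_eq, Submodule.map_subtype_top]
    rw [h, parNeg_sup_nilPos hξ₀]

theorem mainFrame_Q (hξ₀ : ⨆ t : ℝ, (LieAlgebra.ad ℂ 𝔤 ξ₀).eigenspace (t : ℂ) = ⊤) {n : ℕ}
    (X : Module.Basis (Fin n) ℂ (nilPos ξ₀)) (ξ : Fin n → nilNeg ξ₀)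
    (hX : ∀ i j, killingForm ℂ 𝔤 (X i) (ξ j) = if i = j then 1 else 0) :
    (mainFrame hξ₀ X ξ hX).Q = nilPos ξ₀ := by
  have h1 : (Set.range fun i => (X i : 𝔤)) = (nilPos ξ₀).subtype '' Set.range X := by
    rw [← Set.range_comp]; rfl
  change Submodule.span ℂ (Set.range fun i => (X i : 𝔤)) = _
  rw [h1, Submodule.span_image, X.span_eq, Submodule.map_subtype_top]

end MainFrame

/-- The subalgebra of `U(𝔤)` generated by `𝔥 + 𝔲bar`. -/
def envPar (ξ₀ : 𝔤) : Subalgebra ℂ (UniversalEnvelopingAlgebra ℂ 𝔤) :=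
  Algebra.adjoin ℂ (iotaMap (parNeg ξ₀) : Set _)

theorem iota_mem_envPar {x : 𝔤} (hx : x ∈ parNeg ξ₀) : ι ℂ x ∈ envPar ξ₀ :=
  Algebra.subset_adjoin (iota_mem_iotaMap hx)

theorem leviIncl_mem_envPar (w : UniversalEnvelopingAlgebra ℂ (levi ξ₀)) :
    leviIncl ξ₀ w ∈ envPar ξ₀ := by
  induction w using env_induction with
  | one => rw [map_one]; exact one_mem _
  | smul c u h => rw [map_smul]; exact Subalgebra.smul_mem _ h c
  | add u v hu hv => rw [map_add]; exact add_mem hu hv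
  | mul Y u h =>
    rw [map_mul, leviIncl_iota]
    exact mul_mem (iota_mem_envPar (Submodule.mem_sup_left Y.2)) h

/-- The left ideal `U(𝔤) 𝔲`. -/
def envIdeal (ξ₀ : 𝔤) : Submodule ℂ (UniversalEnvelopingAlgebra ℂ 𝔤) := ⊤ * iotaMap (nilPos ξ₀)

theorem mul_mem_envIdeal (u : UniversalEnvelopingAlgebra ℂ 𝔤) {v : UniversalEnvelopingAlgebra ℂ 𝔤}
    (hv : v ∈ envIdeal ξ₀) : u * v ∈ envIdeal ξ₀ := by
  have : envIdeal ξ₀ ≤ (envIdeal ξ₀).comap (LinearMap.mulLeft ℂ u) :=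
    Submodule.mul_le.2 fun a _ b hb => by
      rw [Submodule.mem_comap, LinearMap.mulLeft_apply, ← mul_assoc]
      exact Submodule.mul_mem_mul trivial hb
  exact this hv

theorem envPar_sup_envIdeal
    (hξ₀ : ⨆ t : ℝ, (LieAlgebra.ad ℂ 𝔤 ξ₀).eigenspace (t : ℂ) = ⊤) :
    Subalgebra.toSubmodule (envPar ξ₀) ⊔ envIdeal ξ₀ = ⊤ := by
  have key : ∀ p, ufil 𝔤 p ≤ Subalgebra.toSubmodule (envPar ξ₀) ⊔ envIdeal ξ₀ := by
    intro p
    cases p with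
    | zero => exact bot_le
    | succ p =>
      suffices h : ufil 𝔤 (p + 1) ≤ Subalgebra.toSubmodule (envPar ξ₀) ⊓ ufil 𝔤 (p + 1) ⊔
          envIdeal ξ₀ from h.trans (sup_le_sup_right inf_le_left _)
      induction p with
      | zero =>
        refine fun u hu => Submodule.mem_sup_left ⟨?_, hu⟩
        rw [ufil_one] at hu
        obtain ⟨c, rfl⟩ := Submodule.mem_one.1 hu
        exact Subalgebra.algebraMap_mem _ c
      | succ p ih =>
        set W := Subalgebra.toSubmodule (envPar ξ₀) ⊓ ufil 𝔤 (p + 1 + 1) ⊔ envIdeal ξ₀ with hW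
        have ih' : ufil 𝔤 (p + 1) ≤ W :=
          ih.trans (sup_le_sup_right (inf_le_inf_left _ (ufil_mono (Nat.le_succ _))) _)
        have hpar : ∀ x ∈ parNeg ξ₀, ∀ u ∈ ufil 𝔤 (p + 1), ι ℂ x * u ∈ W := fun x hx u hu => by
          obtain ⟨a, ha, b, hb, rfl⟩ := Submodule.mem_sup.1 (ih hu)
          rw [mul_add]
          exact add_mem (Submodule.mem_sup_left ⟨(envPar ξ₀).mul_mem (iota_mem_envPar hx) ha.1,
            iota_mul_mem_ufil ha.2 x⟩) (Submodule.mem_sup_right (mul_mem_envIdeal _ hb))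
        -- Moving a factor of `𝔲` to the right end costs only a commutator, which the induction
        -- hypothesis covers because the filtration index has not increased.
        have hpos : ∀ x ∈ nilPos ξ₀, ∀ u ∈ ufil 𝔤 (p + 1), ι ℂ x * u ∈ W := fun x hx u hu => by
          have h1 : ι ℂ x * u = (ι ℂ x * u - u * ι ℂ x) + u * ι ℂ x := by abel
          rw [h1]
          exact add_mem (ih' (commutator_mem_ufil x hu)) (Submodule.mem_sup_right
            (Submodule.mul_mem_mul trivial (iota_mem_iotaMap hx)))
        rw [ufil_succ_succ']
        refine Submodule.mul_le.2 fun y hy u hu => ?_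
        obtain ⟨c, x, -, rfl⟩ := mem_one_sup_iotaMap hy
        have hx : x ∈ parNeg ξ₀ ⊔ nilPos ξ₀ := by rw [parNeg_sup_nilPos hξ₀]; trivial
        obtain ⟨x1, hx1, x2, hx2, rfl⟩ := Submodule.mem_sup.1 hx
        rw [map_add, add_mul, add_mul, ← Algebra.smul_def]
        exact add_mem (Submodule.smul_mem _ _ (ih' hu))
          (add_mem (hpar x1 hx1 u hu) (hpos x2 hx2 u hu))
  refine eq_top_iff.2 fun u _ => ?_
  obtain ⟨p, hp⟩ := exists_mem_ufil u
  exact key p hp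

/-- The right ideal of `envPar ξ₀` generated by `𝔲bar`. -/
def envNeg (ξ₀ : 𝔤) : Submodule ℂ (UniversalEnvelopingAlgebra ℂ 𝔤) :=
  iotaMap (nilNeg ξ₀).toSubmodule * Subalgebra.toSubmodule (envPar ξ₀)

theorem envNeg_le : envNeg ξ₀ ≤ Subalgebra.toSubmodule (envPar ξ₀) :=
  Submodule.mul_le.2 fun y hy u hu => by
    obtain ⟨x, hx, rfl⟩ := hy
    exact (envPar ξ₀).mul_mem (iota_mem_envPar (Submodule.mem_sup_right hx)) hu

/-- Since `𝔥` normalizes `𝔲bar`, factors in `𝔲bar` can be moved to the left of factors in `𝔥`. -/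
theorem envPar_le :
    Subalgebra.toSubmodule (envPar ξ₀) ≤
      LinearMap.range (leviIncl ξ₀).toLinearMap ⊔ envNeg ξ₀ := by
  set W := LinearMap.range (leviIncl ξ₀).toLinearMap ⊔ envNeg ξ₀ with hW
  have hpar : ∀ x ∈ parNeg ξ₀, ∀ u ∈ W, ι ℂ x * u ∈ W := by
    intro x hx u hu
    obtain ⟨Y, hY, ξ, hξ, rfl⟩ := Submodule.mem_sup.1 hx
    rw [map_add, add_mul]
    refine add_mem ?_ (Submodule.mem_sup_right
      (Submodule.mul_mem_mul (iota_mem_iotaMap hξ) ?_))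
    · obtain ⟨a, ⟨w, rfl⟩, b, hb, rfl⟩ := Submodule.mem_sup.1 hu
      rw [mul_add]
      refine add_mem (Submodule.mem_sup_left ⟨ι ℂ (⟨Y, hY⟩ : levi ξ₀) * w, ?_⟩)
        (Submodule.mem_sup_right ?_)
      · change leviIncl ξ₀ _ = _
        rw [map_mul, leviIncl_iota]; rfl
      · have : envNeg ξ₀ ≤ (envNeg ξ₀).comap (LinearMap.mulLeft ℂ (ι ℂ Y)) :=
          Submodule.mul_le.2 fun y hy v hv => by
            obtain ⟨η, hη, rfl⟩ := hy
            have h1 : ι ℂ Y * (ι ℂ η * v) = ι ℂ η * (ι ℂ Y * v) + ι ℂ ⁅Y, η⁆ * v := by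
              rw [← mul_assoc, iota_mul_iota, add_mul, mul_assoc]
            rw [Submodule.mem_comap, LinearMap.mulLeft_apply]
            exact h1 ▸ add_mem (Submodule.mul_mem_mul (iota_mem_iotaMap hη)
              ((envPar ξ₀).mul_mem (iota_mem_envPar (Submodule.mem_sup_left hY)) hv))
              (Submodule.mul_mem_mul (iota_mem_iotaMap (levi_lie_nilNeg_mem hY hη)) hv)
        exact this hb
    · obtain ⟨a, ⟨w, rfl⟩, b, hb, rfl⟩ := Submodule.mem_sup.1 hu
      exact add_mem (leviIncl_mem_envPar w) (envNeg_le hb)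
  have key : ∀ v ∈ envPar ξ₀, ∀ u ∈ W, v * u ∈ W := by
    intro v hv
    induction hv using Algebra.adjoin_induction with
    | mem y hy => obtain ⟨x, hx, rfl⟩ := hy; exact hpar x hx
    | algebraMap r => intro u hu; rw [← Algebra.smul_def]; exact Submodule.smul_mem _ _ hu
    | add x y _ _ hx hy => intro u hu; rw [add_mul]; exact add_mem (hx u hu) (hy u hu)
    | mul x y _ _ hx hy => intro u hu; rw [mul_assoc]; exact hx _ (hy u hu)
  intro v hv
  have := key v hv 1 (Submodule.mem_sup_left ⟨1, map_one (leviIncl ξ₀)⟩)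
  rwa [mul_one] at this

theorem comm_iota (x y : 𝔤) : comm (ι ℂ x) (ι ℂ y) = ι ℂ ⁅x, y⁆ := by
  rw [LieHom.map_lie, Ring.lie_def, comm_apply]

theorem comm_leviIncl (w : UniversalEnvelopingAlgebra ℂ (levi ξ₀)) :
    comm (ι ℂ ξ₀) (leviIncl ξ₀ w) = 0 := by
  induction w using env_induction with
  | one => rw [map_one, comm_apply, mul_one, one_mul, sub_self]
  | smul c u h => rw [map_smul, map_smul, h, smul_zero]
  | add u v hu hv => rw [map_add, map_add, hu, hv, add_zero]
  | mul Y u h => rw [map_mul, leviIncl_iota, comm_mul, h, comm_iota, mem_levi.1 Y.2]; simp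

theorem iota_mem_negSpace {x : 𝔤} (hx : x ∈ nilNeg ξ₀) : ι ℂ x ∈ negSpace (comm (ι ℂ ξ₀)) :=
  map_mem_negSpace (ι ℂ : 𝔤 →ₗ⁅ℂ⁆ _).toLinearMap (fun y => comm_iota ξ₀ y) (mem_nilNeg.1 hx)

theorem envPar_le_nonposAlg : envPar ξ₀ ≤ nonposAlg (ι ℂ ξ₀) := by
  refine Algebra.adjoin_le ?_
  rintro _ ⟨x, hx, rfl⟩
  obtain ⟨Y, hY, ξ, hξ, rfl⟩ := Submodule.mem_sup.1 hx
  change ι ℂ (Y + ξ) ∈ _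
  rw [map_add]
  refine add_mem (mem_nonposAlg.2 (Submodule.mem_sup_left ?_))
    (mem_nonposAlg.2 (Submodule.mem_sup_right (iota_mem_negSpace hξ)))
  rw [LinearMap.mem_ker, comm_iota, mem_levi.1 hY, map_zero]

theorem envNeg_le_negSpace : envNeg ξ₀ ≤ negSpace (comm (ι ℂ ξ₀)) :=
  Submodule.mul_le.2 fun y hy u hu => by
    obtain ⟨x, hx, rfl⟩ := hy
    exact mul_mem_negSpace_of_nonpos_right (iota_mem_negSpace hx) (envPar_le_nonposAlg hu)

/-- In `𝔲bar U(𝔤)` the second factor splits into a part generated by `𝔥 + 𝔲bar` and a part in `U(𝔤)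
𝔲`, which is absorbed by the other summand. The remaining right ideal has negative weight. -/
theorem pbwCompl_eq (hξ₀ : ⨆ t : ℝ, (LieAlgebra.ad ℂ 𝔤 ξ₀).eigenspace (t : ℂ) = ⊤) :
    pbwCompl ξ₀ = envNeg ξ₀ ⊔ envIdeal ξ₀ := by
  change iotaMap (nilNeg ξ₀).toSubmodule * ⊤ ⊔ envIdeal ξ₀ = _
  refine le_antisymm (sup_le ?_ le_sup_right) (sup_le_sup_right (mul_le_mul_right le_top _) _)
  rw [← envPar_sup_envIdeal hξ₀, Submodule.mul_sup]
  exact sup_le_sup_left (Submodule.mul_le.2 fun y _ u hu => mul_mem_envIdeal y hu) _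

/-- `U(𝔤) = U(𝔥) ⊕ (𝔲bar U(𝔤) + U(𝔤) 𝔲)`. -/
theorem isCompl_pbwCompl (hξ₀ : ⨆ t : ℝ, (LieAlgebra.ad ℂ 𝔤 ξ₀).eigenspace (t : ℂ) = ⊤) {n : ℕ}
    (X : Module.Basis (Fin n) ℂ (nilPos ξ₀)) (ξ : Fin n → nilNeg ξ₀)
    (hX : ∀ i j, killingForm ℂ 𝔤 (X i) (ξ j) = if i = j then 1 else 0) :
    IsCompl (LinearMap.range (leviIncl ξ₀).toLinearMap) (pbwCompl ξ₀) := by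
  rw [pbwCompl_eq hξ₀]
  refine IsCompl.of_eq ?_ ?_
  · rw [Submodule.eq_bot_iff]
    rintro u ⟨⟨w, hw⟩, hu⟩
    obtain ⟨y, hy, v, hv, rfl⟩ := Submodule.mem_sup.1 hu
    have hw' : leviIncl ξ₀ w = y + v := hw
    -- As a difference of elements of the algebra of `𝔥 + 𝔲bar`, `v` lies in that algebra as well as
    -- in `U(𝔤) 𝔲`; the Euler argument applies.
    have hv0 : v = 0 := by
      have hQ := mainFrame_Q hξ₀ X ξ hX
      refine (mainFrame hξ₀ X ξ hX).adjoin_disjoint (fun a ha b hb => ?_) (u := v) ?_ ?_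
      · rw [hQ] at ha hb ⊢; exact nilPos_lie_mem ha hb
      · have h1 : v = leviIncl ξ₀ w - y := by rw [hw']; abel
        rw [h1]
        exact sub_mem (leviIncl_mem_envPar w) (envNeg_le hy)
      · rw [hQ]; exact hv
    rw [hv0, add_zero] at hw' ⊢
    -- What remains has negative weight as an element of `envNeg` and weight zero as an element of
    -- `U(𝔥)`.
    refine eq_zero_of_mem_negSpace (envNeg_le_negSpace hy) ?_
    rw [← hw', comm_leviIncl]
  · rw [← sup_assoc, eq_top_iff, ← envPar_sup_envIdeal hξ₀]
    exact sup_le_sup_right envPar_le _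

end Decomposition

/-! ### Invariance of the Dolbeault operator -/

section Invariance

open UniversalEnvelopingAlgebra (ι)

variable {𝔤 : Type*} [LieRing 𝔤] [LieAlgebra ℂ 𝔤] {ξ₀ : 𝔤}

theorem comm_tmul (a : UniversalEnvelopingAlgebra ℂ 𝔤) (S : Module.End ℂ (ExtNeg ξ₀))
    (u : UniversalEnvelopingAlgebra ℂ 𝔤) (T : Module.End ℂ (ExtNeg ξ₀)) :
    comm (a ⊗ₜ[ℂ] 1 + 1 ⊗ₜ[ℂ] S : BigAlg ξ₀) (u ⊗ₜ[ℂ] T) =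
      comm a u ⊗ₜ[ℂ] T + u ⊗ₜ[ℂ] comm S T := by
  simp only [comm_apply, add_mul, mul_add, Algebra.TensorProduct.tmul_mul_tmul, one_mul, mul_one,
    TensorProduct.sub_tmul, TensorProduct.tmul_sub]
  abel

theorem comm_deltaLie_tmul (Y : levi ξ₀) (u : UniversalEnvelopingAlgebra ℂ 𝔤)
    (T : Module.End ℂ (ExtNeg ξ₀)) :
    comm (deltaLie ξ₀ Y) (u ⊗ₜ[ℂ] T) =
      comm (ι ℂ (Y : 𝔤)) u ⊗ₜ[ℂ] T + u ⊗ₜ[ℂ] comm (leviAct ξ₀ Y) T :=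
  comm_tmul _ _ u T

theorem mem_invAlg_iff {b : BigAlg ξ₀} : b ∈ invAlg ξ₀ ↔ ∀ Y, comm (deltaLie ξ₀ Y) b = 0 := by
  rw [invAlg, Subalgebra.mem_centralizer_iff]
  constructor
  · exact fun h Y => sub_eq_zero.2 (h _ ⟨Y, rfl⟩)
  · rintro h _ ⟨Y, rfl⟩
    exact sub_eq_zero.1 (h Y)

section Ext

variable {M : Type*} [AddCommGroup M] [Module ℂ M]

theorem comm_extDer_extMul (f : Module.End ℂ M) (m : M) :
    comm (extDer f) (extMul m) = extMul (f m) := by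
  refine LinearMap.ext fun x => ?_
  rw [comm_apply, LinearMap.sub_apply, Module.End.mul_apply, Module.End.mul_apply, extMul_apply,
    extMul_apply, extMul_apply, extDer_mul, extDer_ι]
  abel

/-- An operator that commutes with all `e(m)` and annihilates `1` vanishes. -/
theorem eq_zero_of_comm_extMul {T : Module.End ℂ (ExteriorAlgebra ℂ M)}
    (h : ∀ m, T * extMul m = extMul m * T) (h1 : T 1 = 0) : T = 0 := by
  refine LinearMap.ext fun x => ?_
  induction x using CliffordAlgebra.left_induction with
  | algebraMap r => rw [Algebra.algebraMap_eq_smul_one, map_smul]; simp [h1]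
  | add x y hx hy => rw [map_add, hx, hy]; simp
  | ι_mul x m hx =>
    have := DFunLike.congr_fun (h m) x
    rw [Module.End.mul_apply, Module.End.mul_apply, hx] at this
    exact this.trans (by simp)

/-- An operator that anticommutes with all `e(m)` and annihilates `1` vanishes. -/
theorem eq_zero_of_anticomm_extMul {T : Module.End ℂ (ExteriorAlgebra ℂ M)}
    (h : ∀ m, T * extMul m = -(extMul m * T)) (h1 : T 1 = 0) : T = 0 := by
  refine LinearMap.ext fun x => ?_
  induction x using CliffordAlgebra.left_induction with
  | algebraMap r => rw [Algebra.algebraMap_eq_smul_one, map_smul]; simp [h1]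
  | add x y hx hy => rw [map_add, hx, hy]; simp
  | ι_mul x m hx =>
    have := DFunLike.congr_fun (h m) x
    rw [LinearMap.neg_apply, Module.End.mul_apply, Module.End.mul_apply, hx] at this
    exact this.trans (by simp)

theorem extDer_one (f : Module.End ℂ M) : extDer f 1 = 0 := by
  have := extDer_algebraMap f 1
  rwa [map_one] at this

/-- The sum of the commutator and `ι(φ ∘ f)` anticommutes with all `e(m)` and annihilates `1`, and
such an operator is zero. -/
theorem comm_extDer_intProd (f : Module.End ℂ M) (φ : Module.Dual ℂ M) :
    comm (extDer f) (intProd φ) = -intProd (φ ∘ₗ f) := by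
  rw [← add_eq_zero_iff_eq_neg]
  refine eq_zero_of_anticomm_extMul (fun m => ?_) ?_
  · have h1 := intProd_mul_extMul φ m
    have h2 := intProd_mul_extMul φ (f m)
    have h3 := intProd_mul_extMul (φ ∘ₗ f) m
    have h4 : extDer f * extMul m = extMul (f m) + extMul m * extDer f := by
      rw [← comm_extDer_extMul, comm_apply]; abel
    have h5 : comm (extDer f) (intProd φ) * extMul m =
        extDer f * (intProd φ * extMul m) - intProd φ * (extDer f * extMul m) := by
      rw [comm_apply]; noncomm_ring
    rw [add_mul, h3, h5, h4, h1, mul_add, ← mul_assoc (intProd φ), h1, h2, comm_apply]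
    simp only [mul_sub, sub_mul, mul_smul_comm, smul_mul_assoc, mul_one, one_mul, ← mul_assoc, h4,
      add_mul, mul_add, LinearMap.comp_apply]
    noncomm_ring
  · rw [comm_apply, LinearMap.add_apply, LinearMap.sub_apply, Module.End.mul_apply,
      Module.End.mul_apply, intProd_one, intProd_one, extDer_one, map_zero, map_zero]
    simp

end Ext

theorem comm_leviAct_extMul (Y : levi ξ₀) (m : nilNeg ξ₀) :
    comm (leviAct ξ₀ Y) (extMul m) = extMul ⁅Y, m⁆ :=
  comm_extDer_extMul _ m

variable {B : LinearMap.BilinForm ℂ 𝔤}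

/-- The linear form `B(Z, ·)` on `𝔲bar`, as a function of `Z`. -/
def formNeg (B : LinearMap.BilinForm ℂ 𝔤) (ξ₀ : 𝔤) : 𝔤 →ₗ[ℂ] Module.Dual ℂ (nilNeg ξ₀) where
  toFun Z := (B Z).comp (nilNeg ξ₀).toSubmodule.subtype
  map_add' Z W := by rw [map_add]; rfl
  map_smul' c Z := by rw [map_smul]; rfl

theorem intProdLie_eq (Z : 𝔤) : intProdLie B ξ₀ Z = intProd (formNeg B ξ₀ Z) := rfl

theorem intProdLie_add (Z W : 𝔤) :
    intProdLie B ξ₀ (Z + W) = intProdLie B ξ₀ Z + intProdLie B ξ₀ W := by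
  rw [intProdLie_eq, intProdLie_eq, intProdLie_eq, map_add, intProd_add]

theorem intProdLie_smul (c : ℂ) (Z : 𝔤) :
    intProdLie B ξ₀ (c • Z) = c • intProdLie B ξ₀ Z := by
  rw [intProdLie_eq, intProdLie_eq, map_smul, intProd_smul]

variable (B ξ₀) in
/-- The interior product as a linear map. -/
def intProdHom : 𝔤 →ₗ[ℂ] Module.End ℂ (ExtNeg ξ₀) where
  toFun := intProdLie B ξ₀
  map_add' := intProdLie_add
  map_smul' := intProdLie_smul

variable (ξ₀) in
/-- The exterior product as a linear map. -/
def extMulHom : nilNeg ξ₀ →ₗ[ℂ] Module.End ℂ (ExtNeg ξ₀) where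
  toFun := extMul
  map_add' := extMul_add
  map_smul' := extMul_smul

theorem comm_leviAct_intProdLie (hB : B.lieInvariant 𝔤) (Y : levi ξ₀) (Z : 𝔤) :
    comm (leviAct ξ₀ Y) (intProdLie B ξ₀ Z) = intProdLie B ξ₀ ⁅(Y : 𝔤), Z⁆ := by
  refine (comm_extDer_intProd _ _).trans ?_
  rw [intProdLie, ← neg_one_smul ℂ, ← intProd_smul]
  congr 1
  refine LinearMap.ext fun m => ?_
  have h := hB (Y : 𝔤) Z (m : 𝔤)
  change (-1 : ℂ) • B Z ⁅(Y : 𝔤), (m : 𝔤)⁆ = B ⁅(Y : 𝔤), Z⁆ m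
  rw [h, neg_one_smul]

variable {n : ℕ}

theorem sum_form_smul_nilPos {X : Module.Basis (Fin n) ℂ (nilPos ξ₀)} {ξ : Fin n → nilNeg ξ₀}
    (hX : ∀ i j, B (X i : 𝔤) (ξ j : 𝔤) = if i = j then 1 else 0) {x : 𝔤} (hx : x ∈ nilPos ξ₀) :
    ∑ k, B x (ξ k) • (X k : 𝔤) = x := by
  have h := X.sum_repr ⟨x, hx⟩
  have h' : ∑ i, X.repr ⟨x, hx⟩ i • (X i : 𝔤) = x := by
    have := congrArg (nilPos ξ₀).subtype h
    rwa [map_sum] at this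
  have h2 : ∀ k, B x (ξ k) = X.repr ⟨x, hx⟩ k := fun k => by
    conv_lhs => rw [← h']
    simp [hX, LinearMap.sum_apply]
  simp only [h2]; exact h'

theorem sum_form_smul_nilNeg {X : Fin n → nilPos ξ₀} {ξ : Module.Basis (Fin n) ℂ (nilNeg ξ₀)}
    (hX : ∀ i j, B (X i : 𝔤) (ξ j : 𝔤) = if i = j then 1 else 0) (m : nilNeg ξ₀) :
    ∑ k, B (X k : 𝔤) m • ξ k = m := by
  have h := ξ.sum_repr m
  have h' : ∑ i, ξ.repr m i • (ξ i : 𝔤) = m := by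
    have := congrArg (nilNeg ξ₀).toSubmodule.subtype h
    rwa [map_sum] at this
  have h2 : ∀ k, B (X k : 𝔤) m = ξ.repr m k := fun k => by
    conv_lhs => rw [← h']
    simp [hX]
  simp only [h2]; exact h

variable {X : Module.Basis (Fin n) ℂ (nilPos ξ₀)} {ξ : Module.Basis (Fin n) ℂ (nilNeg ξ₀)}
  (hB : B.lieInvariant 𝔤) (hX : ∀ i j, B (X i : 𝔤) (ξ j : 𝔤) = if i = j then 1 else 0)

include hB hX

/-- The element `∑ i, X i ⊗ ξ i` is invariant. -/
theorem sum_lie_add_lie {V : Type*} [AddCommGroup V] [Module ℂ V]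
    (β : 𝔤 →ₗ[ℂ] nilNeg ξ₀ →ₗ[ℂ] V) (Y : levi ξ₀) :
    ∑ i, (β ⁅(Y : 𝔤), (X i : 𝔤)⁆ (ξ i) + β (X i) ⁅Y, ξ i⁆) = 0 := by
  have h1 : ∀ i, β ⁅(Y : 𝔤), (X i : 𝔤)⁆ (ξ i) =
      ∑ k, B ⁅(Y : 𝔤), (X i : 𝔤)⁆ (ξ k) • β (X k) (ξ i) := fun i => by
    conv_lhs => rw [← sum_form_smul_nilPos hX (levi_lie_nilPos_mem Y.2 (X i).2)]
    simp [LinearMap.sum_apply]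
  have h2 : ∀ i, β (X i) ⁅Y, ξ i⁆ = ∑ k, B (X k) (⁅Y, ξ i⁆ : nilNeg ξ₀) • β (X i) (ξ k) :=
    fun i => by
      conv_lhs => rw [← sum_form_smul_nilNeg hX ⁅Y, ξ i⁆]
      simp
  rw [Finset.sum_add_distrib, Finset.sum_congr rfl fun i _ => h1 i,
    Finset.sum_congr rfl fun i _ => h2 i, Finset.sum_comm (γ := Fin n), ← Finset.sum_add_distrib]
  refine Finset.sum_eq_zero fun i _ => ?_
  rw [← Finset.sum_add_distrib]
  refine Finset.sum_eq_zero fun k _ => ?_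
  -- By invariance of `B`, the matrices of `ad Y` in the two dual bases are negative transposes of
  -- each other.
  rw [← add_smul, hB]
  have : ((⁅Y, ξ i⁆ : nilNeg ξ₀) : 𝔤) = ⁅(Y : 𝔤), (ξ i : 𝔤)⁆ := rfl
  rw [this, neg_add_cancel, zero_smul]

omit hB hX

theorem sum_sum_eq_two_smul {V : Type*} [AddCommGroup V] [Module ℂ V] {g : Fin n → Fin n → V}
    (hs : ∀ i j, g i j = g j i) (h0 : ∀ i, g i i = 0) :
    ∑ i, ∑ j, g i j = (2 : ℂ) • ∑ i, ∑ j ∈ Finset.Ioi i, g i j := by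
  have h1 : ∀ i, ∑ j, g i j = ∑ j ∈ Finset.Ioi i, g i j + ∑ j ∈ Finset.Iio i, g i j := fun i => by
    rw [← Finset.sum_filter_add_sum_filter_not Finset.univ (fun j => i < j)]
    congr 1
    · exact Finset.sum_congr (by ext; simp) fun _ _ => rfl
    · refine (Finset.sum_subset (fun j => by simp; exact le_of_lt) fun j hj hj' => ?_).symm
      have : j = i := by
        simp at hj hj'; exact le_antisymm hj hj'
      rw [this, h0]
  rw [Finset.sum_congr rfl fun i _ => h1 i, Finset.sum_add_distrib, two_smul]
  congr 1
  rw [Finset.sum_comm' (t' := Finset.univ) (s' := fun j => Finset.Ioi j) (by simp)]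
  exact Finset.sum_congr rfl fun i _ => Finset.sum_congr rfl fun j _ => hs _ _

/-- The quadratic-linear part of the Dolbeault operator, as a sum over all pairs of indices. -/
def cubic (B : LinearMap.BilinForm ℂ 𝔤) (X : Fin n → nilPos ξ₀) (ξ : Fin n → nilNeg ξ₀) :
    Module.End ℂ (ExtNeg ξ₀) :=
  ∑ i, ∑ j, extMul (ξ i) * extMul (ξ j) * intProdLie B ξ₀ ⁅(X i : 𝔤), (X j : 𝔤)⁆

theorem dolbeault_eq (B : LinearMap.BilinForm ℂ 𝔤) (X : Fin n → nilPos ξ₀)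
    (ξ : Fin n → nilNeg ξ₀) :
    dolbeault B ξ₀ X ξ = ∑ i, ι ℂ (X i : 𝔤) ⊗ₜ[ℂ] extMul (ξ i) -
      (2⁻¹ : ℂ) • (1 ⊗ₜ[ℂ] cubic B X ξ) := by
  rw [dolbeault, cubic]
  congr 1
  have h := sum_sum_eq_two_smul
    (g := fun i j => extMul (ξ i) * extMul (ξ j) * intProdLie B ξ₀ ⁅(X i : 𝔤), (X j : 𝔤)⁆)
    (fun i j => by
      rw [extMul_mul_extMul, ← lie_skew (X i : 𝔤), ← neg_one_smul ℂ ⁅(X j : 𝔤), (X i : 𝔤)⁆,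
        intProdLie_smul, neg_one_smul, neg_mul_neg])
    (fun i => by rw [extMul_mul_self, zero_mul])
  rw [h, TensorProduct.tmul_smul, smul_smul, inv_mul_cancel₀ two_ne_zero, one_smul,
    TensorProduct.tmul_sum]
  exact Finset.sum_congr rfl fun i _ => (TensorProduct.tmul_sum _ _ _).symm

-- The invariance of `∑ X i ⊗ ξ i` is applied in each of the two summation indices separately. The
-- maps `f` and `g` stand for `e` and `ι`, of which only linearity matters.
include hB hX in
theorem sum_sum_lie_eq_zero {E : Type*} [Ring E] [Algebra ℂ E] (f : nilNeg ξ₀ →ₗ[ℂ] E)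
    (g : 𝔤 →ₗ[ℂ] E) (Y : levi ξ₀) :
    ∑ i, ∑ j, ((f ⁅Y, ξ i⁆ * f (ξ j) + f (ξ i) * f ⁅Y, ξ j⁆) * g ⁅(X i : 𝔤), (X j : 𝔤)⁆ +
      f (ξ i) * f (ξ j) * (g ⁅⁅(Y : 𝔤), (X i : 𝔤)⁆, (X j : 𝔤)⁆ +
        g ⁅(X i : 𝔤), ⁅(Y : 𝔤), (X j : 𝔤)⁆⁆)) = 0 := by
  let β1 : Fin n → 𝔤 →ₗ[ℂ] nilNeg ξ₀ →ₗ[ℂ] E := fun j =>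
    LinearMap.mk₂ ℂ (fun x m => f m * f (ξ j) * g ⁅x, (X j : 𝔤)⁆)
      (fun x y m => by rw [add_lie, map_add, mul_add])
      (fun c x m => by rw [smul_lie, map_smul, mul_smul_comm])
      (fun x m m' => by rw [map_add, add_mul, add_mul])
      (fun c x m => by rw [map_smul, smul_mul_assoc, smul_mul_assoc])
  let β2 : Fin n → 𝔤 →ₗ[ℂ] nilNeg ξ₀ →ₗ[ℂ] E := fun i =>
    LinearMap.mk₂ ℂ (fun x m => f (ξ i) * f m * g ⁅(X i : 𝔤), x⁆)
      (fun x y m => by rw [lie_add, map_add, mul_add])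
      (fun c x m => by rw [lie_smul, map_smul, mul_smul_comm])
      (fun x m m' => by rw [map_add, mul_add, add_mul])
      (fun c x m => by rw [map_smul, mul_smul_comm, smul_mul_assoc])
  have h1 : ∀ i j, (f ⁅Y, ξ i⁆ * f (ξ j) + f (ξ i) * f ⁅Y, ξ j⁆) * g ⁅(X i : 𝔤), (X j : 𝔤)⁆ +
      f (ξ i) * f (ξ j) * (g ⁅⁅(Y : 𝔤), (X i : 𝔤)⁆, (X j : 𝔤)⁆ +
        g ⁅(X i : 𝔤), ⁅(Y : 𝔤), (X j : 𝔤)⁆⁆) =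
      (β1 j ⁅(Y : 𝔤), (X i : 𝔤)⁆ (ξ i) + β1 j (X i) ⁅Y, ξ i⁆) +
      (β2 i ⁅(Y : 𝔤), (X j : 𝔤)⁆ (ξ j) + β2 i (X j) ⁅Y, ξ j⁆) := fun i j => by
    simp only [β1, β2, LinearMap.mk₂_apply, add_mul, mul_add]
    abel
  rw [Finset.sum_congr rfl fun i _ => Finset.sum_congr rfl fun j _ => h1 i j,
    Finset.sum_congr rfl fun i _ => Finset.sum_add_distrib, Finset.sum_add_distrib,
    Finset.sum_comm, Finset.sum_congr rfl fun j _ => sum_lie_add_lie hB hX (β1 j) Y,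
    Finset.sum_const_zero, zero_add,
    Finset.sum_congr rfl fun i _ => sum_lie_add_lie hB hX (β2 i) Y, Finset.sum_const_zero]

include hB hX in
theorem comm_leviAct_cubic (Y : levi ξ₀) : comm (leviAct ξ₀ Y) (cubic B X ξ) = 0 := by
  have h1 : ∀ i j, comm (leviAct ξ₀ Y)
      (extMul (ξ i) * extMul (ξ j) * intProdLie B ξ₀ ⁅(X i : 𝔤), (X j : 𝔤)⁆) =
      (extMul ⁅Y, ξ i⁆ * extMul (ξ j) + extMul (ξ i) * extMul ⁅Y, ξ j⁆) *
        intProdLie B ξ₀ ⁅(X i : 𝔤), (X j : 𝔤)⁆ +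
      extMul (ξ i) * extMul (ξ j) * (intProdLie B ξ₀ ⁅⁅(Y : 𝔤), (X i : 𝔤)⁆, (X j : 𝔤)⁆ +
        intProdLie B ξ₀ ⁅(X i : 𝔤), ⁅(Y : 𝔤), (X j : 𝔤)⁆⁆) := fun i j => by
    rw [comm_mul, comm_mul, comm_leviAct_extMul, comm_leviAct_extMul,
      comm_leviAct_intProdLie hB, leibniz_lie, intProdLie_add]
  rw [cubic, map_sum, Finset.sum_congr rfl fun i _ => map_sum _ _ _,
    Finset.sum_congr rfl fun i _ => Finset.sum_congr rfl fun j _ => h1 i j]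
  exact sum_sum_lie_eq_zero hB hX (extMulHom ξ₀) (intProdHom ξ₀ B) Y

include hB hX in
/-- The Dolbeault operator is `𝔥`-invariant. -/
theorem dolbeault_mem_invAlg : dolbeault B ξ₀ X ξ ∈ invAlg ξ₀ := by
  rw [mem_invAlg_iff]
  intro Y
  let β : 𝔤 →ₗ[ℂ] nilNeg ξ₀ →ₗ[ℂ] BigAlg ξ₀ :=
    LinearMap.mk₂ ℂ (fun x m => ι ℂ x ⊗ₜ[ℂ] extMul m)
      (fun x y m => by rw [map_add, TensorProduct.add_tmul])
      (fun c x m => by rw [map_smul, TensorProduct.smul_tmul'])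
      (fun x m m' => by rw [extMul_add, TensorProduct.tmul_add])
      (fun c x m => by rw [extMul_smul, TensorProduct.tmul_smul])
  have h1 : ∀ i, comm (deltaLie ξ₀ Y) (ι ℂ (X i : 𝔤) ⊗ₜ[ℂ] extMul (ξ i)) =
      β ⁅(Y : 𝔤), (X i : 𝔤)⁆ (ξ i) + β (X i) ⁅Y, ξ i⁆ := fun i => by
    rw [comm_deltaLie_tmul, comm_iota, comm_leviAct_extMul]; rfl
  have h2 : comm (deltaLie ξ₀ Y) (1 ⊗ₜ[ℂ] cubic B X ξ) = 0 := by
    rw [comm_deltaLie_tmul, comm_leviAct_cubic hB hX, comm_apply, mul_one, one_mul, sub_self]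
    simp
  rw [dolbeault_eq, map_sub, map_smul, h2, map_sum]
  simp only [h1, sum_lie_add_lie hB hX, smul_zero, sub_zero]

/-! ### The square of the Dolbeault operator -/

/-- The structure constants. -/
def quad (B : LinearMap.BilinForm ℂ 𝔤) (X : Fin n → nilPos ξ₀) (ξ : Fin n → nilNeg ξ₀) (k : Fin n) :
    Module.End ℂ (ExtNeg ξ₀) :=
  ∑ i, ∑ j, B ⁅(X i : 𝔤), (X j : 𝔤)⁆ (ξ k) • (extMul (ξ i) * extMul (ξ j))

theorem intProdLie_mul_extMul (Z : 𝔤) (m : nilNeg ξ₀) :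
    intProdLie B ξ₀ Z * extMul m = B Z m • 1 - extMul m * intProdLie B ξ₀ Z :=
  intProd_mul_extMul _ m

/-- Moving `e(ξ k)` past two exterior products costs no sign, while the interior product contributes
the structure constants collected in `quad`. -/
theorem cubic_mul_extMul (X : Fin n → nilPos ξ₀) (ξ : Fin n → nilNeg ξ₀) (k : Fin n) :
    cubic B X ξ * extMul (ξ k) = quad B X ξ k - extMul (ξ k) * cubic B X ξ := by
  rw [cubic, quad, Finset.sum_mul, Finset.mul_sum, ← Finset.sum_sub_distrib]
  refine Finset.sum_congr rfl fun i _ => ?_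
  rw [Finset.sum_mul, Finset.mul_sum, ← Finset.sum_sub_distrib]
  refine Finset.sum_congr rfl fun j _ => ?_
  rw [mul_assoc, intProdLie_mul_extMul, mul_sub, mul_smul_comm, mul_one]
  congr 1
  rw [← mul_assoc, mul_assoc (extMul (ξ i)), extMul_mul_extMul (ξ j) (ξ k), mul_neg, ← mul_assoc,
    extMul_mul_extMul (ξ i) (ξ k)]
  simp only [neg_mul, neg_neg, mul_assoc]

theorem quad_mul_extMul (X : Fin n → nilPos ξ₀) (ξ : Fin n → nilNeg ξ₀) (k l : Fin n) :
    quad B X ξ k * extMul (ξ l) = extMul (ξ l) * quad B X ξ k := by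
  rw [quad, Finset.sum_mul, Finset.mul_sum]
  refine Finset.sum_congr rfl fun i _ => ?_
  rw [Finset.sum_mul, Finset.mul_sum]
  refine Finset.sum_congr rfl fun j _ => ?_
  rw [smul_mul_assoc, mul_smul_comm, mul_assoc, extMul_mul_extMul (ξ j) (ξ l), mul_neg,
    ← mul_assoc, extMul_mul_extMul (ξ i) (ξ l), neg_mul, neg_neg, mul_assoc]

-- This is the Jacobi identity: inserting `quad` gives `∑ B([[X i, X j], X b], ξ k) e(ξ i) e(ξ j)
-- e(ξ b)`, and the triple product is invariant under cyclic permutations.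
include hX in
theorem sum_quad_mul_extMul (k : Fin n) :
    ∑ a, ∑ b, B ⁅(X a : 𝔤), (X b : 𝔤)⁆ (ξ k) • (quad B X ξ a * extMul (ξ b)) = 0 := by
  let g : Fin n → Fin n → Fin n → Module.End ℂ (ExtNeg ξ₀) := fun i j b =>
    B ⁅⁅(X i : 𝔤), (X j : 𝔤)⁆, (X b : 𝔤)⁆ (ξ k) • (extMul (ξ i) * extMul (ξ j) * extMul (ξ b))
  have h1 : ∑ a, ∑ b, B ⁅(X a : 𝔤), (X b : 𝔤)⁆ (ξ k) • (quad B X ξ a * extMul (ξ b)) =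
      ∑ i, ∑ j, ∑ b, g i j b := by
    have h2 : ∀ i j b, g i j b = ∑ a, (B ⁅(X a : 𝔤), (X b : 𝔤)⁆ (ξ k) *
        B ⁅(X i : 𝔤), (X j : 𝔤)⁆ (ξ a)) • (extMul (ξ i) * extMul (ξ j) * extMul (ξ b)) := by
      intro i j b
      simp only [g]
      rw [← Finset.sum_smul]
      congr 1
      conv_lhs => rw [← sum_form_smul_nilPos hX (nilPos_lie_mem (X i).2 (X j).2)]
      simp only [sum_lie, smul_lie, map_sum, map_smul, LinearMap.sum_apply,
        LinearMap.smul_apply, smul_eq_mul]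
      exact Finset.sum_congr rfl fun a _ => mul_comm _ _
    simp only [h2, quad, Finset.sum_mul, Finset.smul_sum, smul_mul_assoc, smul_smul]
    rw [Finset.sum_comm' (t' := Finset.univ) (s' := fun _ => Finset.univ) (by simp)]
    rw [Finset.sum_congr rfl fun b _ => Finset.sum_comm]
    rw [Finset.sum_comm]
    refine Finset.sum_congr rfl fun i _ => ?_
    rw [Finset.sum_congr rfl fun b _ => Finset.sum_comm]
    rw [Finset.sum_comm]
  have hcyc : ∀ i j b, extMul (ξ j) * extMul (ξ b) * extMul (ξ i) =
      extMul (ξ i) * extMul (ξ j) * extMul (ξ b) := fun i j b => by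
    rw [mul_assoc, extMul_mul_extMul (ξ b) (ξ i), mul_neg, ← mul_assoc,
      extMul_mul_extMul (ξ j) (ξ i), neg_mul, neg_neg]
  have h3 : ∑ i, ∑ j, ∑ b, g i j b = ∑ i, ∑ j, ∑ b, g j b i := by
    rw [Finset.sum_comm (f := fun i j => ∑ b, g j b i)]
    exact Finset.sum_congr rfl fun i _ => Finset.sum_comm
  have h4 : ∑ i, ∑ j, ∑ b, g i j b = ∑ i, ∑ j, ∑ b, g b i j := by
    rw [Finset.sum_congr rfl fun i _ => Finset.sum_comm (f := fun j b => g b i j),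
      Finset.sum_comm (f := fun i b => ∑ j, g b i j)]
  have h5 : ∀ i j b, g i j b + g j b i + g b i j = 0 := fun i j b => by
    simp only [g]
    rw [hcyc i j b, ← hcyc b i j, ← add_smul, ← add_smul, ← LinearMap.add_apply,
      ← LinearMap.add_apply, ← map_add, ← map_add]
    have : ⁅⁅(X i : 𝔤), (X j : 𝔤)⁆, (X b : 𝔤)⁆ + ⁅⁅(X j : 𝔤), (X b : 𝔤)⁆, (X i : 𝔤)⁆ +
        ⁅⁅(X b : 𝔤), (X i : 𝔤)⁆, (X j : 𝔤)⁆ = 0 := by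
      have := lie_jacobi (X i : 𝔤) (X j : 𝔤) (X b : 𝔤)
      have e : ∀ x y z : 𝔤, ⁅⁅x, y⁆, z⁆ = -⁅z, ⁅x, y⁆⁆ := fun x y z => (lie_skew _ _).symm
      rw [e, e, e, ← neg_zero, ← this]
      abel
    rw [this, map_zero, LinearMap.zero_apply, zero_smul]
  -- Relabelling shows that the three cyclic versions of the sum are equal; their total vanishes
  -- term by term.
  have h6 : (3 : ℂ) • ∑ i, ∑ j, ∑ b, g i j b = 0 := by
    have : (3 : ℂ) • ∑ i, ∑ j, ∑ b, g i j b =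
        ∑ i, ∑ j, ∑ b, g i j b + ∑ i, ∑ j, ∑ b, g j b i + ∑ i, ∑ j, ∑ b, g b i j := by
      rw [← h3, ← h4, show (3 : ℂ) = 1 + 1 + 1 by norm_num, add_smul, add_smul, one_smul]
    rw [this]
    simp only [← Finset.sum_add_distrib, h5, Finset.sum_const_zero]
  rw [h1]
  exact (smul_eq_zero.1 h6).resolve_left three_ne_zero

-- The anticommutator of `cubic` with `e(ξ a)` is `quad a`. Its commutator with `e(ξ a) e(ξ b)` is
-- therefore `quad a e(ξ b) - quad b e(ξ a)`, which sums to zero by the Jacobi identity.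
include hX in
theorem cubic_mul_quad (k : Fin n) :
    cubic B X ξ * quad B X ξ k = quad B X ξ k * cubic B X ξ := by
  have h1 : ∀ a b, cubic B X ξ * (extMul (ξ a) * extMul (ξ b)) =
      extMul (ξ a) * extMul (ξ b) * cubic B X ξ +
        (quad B X ξ a * extMul (ξ b) - quad B X ξ b * extMul (ξ a)) := fun a b => by
    rw [← mul_assoc, cubic_mul_extMul, sub_mul, mul_assoc (extMul (ξ a)), cubic_mul_extMul, mul_sub,
      quad_mul_extMul X ξ b a, mul_assoc]
    abel
  have h2 : cubic B X ξ * quad B X ξ k = quad B X ξ k * cubic B X ξ +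
      (∑ a, ∑ b, B ⁅(X a : 𝔤), (X b : 𝔤)⁆ (ξ k) • (quad B X ξ a * extMul (ξ b)) -
       ∑ a, ∑ b, B ⁅(X a : 𝔤), (X b : 𝔤)⁆ (ξ k) • (quad B X ξ b * extMul (ξ a))) := by
    conv_lhs => rw [quad, Finset.mul_sum]
    conv_rhs => rw [quad, Finset.sum_mul, ← Finset.sum_sub_distrib, ← Finset.sum_add_distrib]
    refine Finset.sum_congr rfl fun a _ => ?_
    rw [Finset.mul_sum, Finset.sum_mul, ← Finset.sum_sub_distrib, ← Finset.sum_add_distrib]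
    refine Finset.sum_congr rfl fun b _ => ?_
    rw [mul_smul_comm, h1, smul_add, smul_sub, smul_mul_assoc]
  have h3 : ∑ a, ∑ b, B ⁅(X a : 𝔤), (X b : 𝔤)⁆ (ξ k) • (quad B X ξ b * extMul (ξ a)) = 0 := by
    rw [Finset.sum_comm]
    have : ∀ b a, B ⁅(X a : 𝔤), (X b : 𝔤)⁆ (ξ k) • (quad B X ξ b * extMul (ξ a)) =
        -(B ⁅(X b : 𝔤), (X a : 𝔤)⁆ (ξ k) • (quad B X ξ b * extMul (ξ a))) := fun b a => by
      rw [← lie_skew (X a : 𝔤), map_neg, LinearMap.neg_apply, neg_smul]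
    simp only [this, Finset.sum_neg_distrib, sum_quad_mul_extMul hX, neg_zero]
  rw [h2, h3, sum_quad_mul_extMul hX, sub_zero, add_zero]

-- Up to a scalar, `cubic` is the Chevalley–Eilenberg differential of `𝔲`. Its square commutes with
-- every `e(m)` and annihilates `1`, so it vanishes.
include hX in
theorem cubic_mul_cubic : cubic B X ξ * cubic B X ξ = 0 := by
  have h0 : ∀ k, cubic B X ξ * cubic B X ξ * extMul (ξ k) =
      extMul (ξ k) * (cubic B X ξ * cubic B X ξ) := fun k => by
    rw [mul_assoc, cubic_mul_extMul, mul_sub, ← mul_assoc, cubic_mul_extMul, sub_mul,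
      cubic_mul_quad hX, mul_assoc]
    abel
  refine eq_zero_of_comm_extMul (fun m => ?_) ?_
  · rw [← ξ.sum_repr m]
    have hs : ∀ (c : Fin n → ℂ), extMul (∑ i, c i • ξ i) = ∑ i, c i • extMul (ξ i) := fun c => by
      let f : nilNeg ξ₀ →ₗ[ℂ] Module.End ℂ (ExtNeg ξ₀) :=
        { toFun := extMul, map_add' := extMul_add, map_smul' := extMul_smul }
      change f _ = ∑ i, c i • f (ξ i)
      rw [map_sum]; simp
    rw [hs, Finset.mul_sum, Finset.sum_mul]
    refine Finset.sum_congr rfl fun i _ => ?_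
    rw [mul_smul_comm, h0, smul_mul_assoc]
  · have h1 : cubic B X ξ 1 = 0 := by
      rw [cubic, LinearMap.sum_apply]
      refine Finset.sum_eq_zero fun i _ => ?_
      rw [LinearMap.sum_apply]
      refine Finset.sum_eq_zero fun j _ => ?_
      have : intProdLie B ξ₀ ⁅(X i : 𝔤), (X j : 𝔤)⁆ 1 = 0 := intProd_one _
      rw [Module.End.mul_apply, this, map_zero]
    rw [Module.End.mul_apply, h1, map_zero]

/-! ### The square of an operator `∑ x_i ⊗ e_i - ½ (1 ⊗ C)`. -/

section Square

variable {U E : Type*} [Ring U] [Algebra ℂ U] [Ring E] [Algebra ℂ E] {x : Fin n → U} {e : Fin n → E}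
  {C : E} {c : Fin n → Fin n → Fin n → ℂ}

/-- The `e_i` anticommute, so symmetrizing the double sum turns the products `x_i x_j` into
commutators. -/
theorem sum_tmul_mul_self (he : ∀ i j, e i * e j = -(e j * e i))
    (hx : ∀ i j, ∑ k, c i j k • x k = x i * x j - x j * x i) :
    (2 : ℂ) • ((∑ i, x i ⊗ₜ[ℂ] e i) * ∑ i, x i ⊗ₜ[ℂ] e i) =
      ∑ i, ∑ j, (∑ k, c i j k • x k) ⊗ₜ[ℂ] (e i * e j) := by
  have h1 : (∑ i, x i ⊗ₜ[ℂ] e i) * ∑ i, x i ⊗ₜ[ℂ] e i =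
      ∑ i, ∑ j, (x i * x j) ⊗ₜ[ℂ] (e i * e j) := by
    rw [Finset.sum_mul_sum]
    simp only [Algebra.TensorProduct.tmul_mul_tmul]
  have h2 : ∑ i, ∑ j, (x i * x j) ⊗ₜ[ℂ] (e i * e j) =
      -∑ i, ∑ j, (x j * x i) ⊗ₜ[ℂ] (e i * e j) := by
    rw [Finset.sum_comm, ← Finset.sum_neg_distrib]
    refine Finset.sum_congr rfl fun i _ => ?_
    rw [← Finset.sum_neg_distrib]
    refine Finset.sum_congr rfl fun j _ => ?_
    rw [he, TensorProduct.tmul_neg]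
  rw [h1, two_smul]
  nth_rewrite 2 [h2]
  rw [← sub_eq_add_neg, ← Finset.sum_sub_distrib]
  refine Finset.sum_congr rfl fun i _ => ?_
  rw [← Finset.sum_sub_distrib]
  refine Finset.sum_congr rfl fun j _ => ?_
  rw [← TensorProduct.sub_tmul, hx]

theorem sum_tmul_mul_add (hC : ∀ k, C * e k + e k * C = ∑ i, ∑ j, c i j k • (e i * e j)) :
    (∑ i, x i ⊗ₜ[ℂ] e i) * (1 ⊗ₜ[ℂ] C) + (1 ⊗ₜ[ℂ] C) * (∑ i, x i ⊗ₜ[ℂ] e i) =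
      ∑ i, ∑ j, (∑ k, c i j k • x k) ⊗ₜ[ℂ] (e i * e j) := by
  have h1 : ∀ k, x k ⊗ₜ[ℂ] e k * (1 ⊗ₜ[ℂ] C) + (1 ⊗ₜ[ℂ] C) * x k ⊗ₜ[ℂ] e k =
      ∑ i, ∑ j, (c i j k • x k) ⊗ₜ[ℂ] (e i * e j) := fun k => by
    rw [Algebra.TensorProduct.tmul_mul_tmul, Algebra.TensorProduct.tmul_mul_tmul, mul_one,
      one_mul, ← TensorProduct.tmul_add, add_comm, hC, TensorProduct.tmul_sum]
    refine Finset.sum_congr rfl fun i _ => ?_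
    rw [TensorProduct.tmul_sum]
    refine Finset.sum_congr rfl fun j _ => ?_
    rw [TensorProduct.tmul_smul, TensorProduct.smul_tmul']
  rw [Finset.sum_mul, Finset.mul_sum, ← Finset.sum_add_distrib,
    Finset.sum_congr rfl fun k _ => h1 k, Finset.sum_comm]
  refine Finset.sum_congr rfl fun i _ => ?_
  rw [Finset.sum_comm]
  refine Finset.sum_congr rfl fun j _ => ?_
  rw [TensorProduct.sum_tmul]

/-- The factor `½` is forced: `D1²` is half of the same sum `S` that the anticommutator of `D1` and
`D2` produces. -/
theorem sub_smul_mul_self_eq_zero {D1 D2 S : U} (h11 : (2 : ℂ) • (D1 * D1) = S)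
    (h12 : D1 * D2 + D2 * D1 = S) (h22 : D2 * D2 = 0) :
    (D1 - (2⁻¹ : ℂ) • D2) * (D1 - (2⁻¹ : ℂ) • D2) = 0 := by
  have h : (D1 - (2⁻¹ : ℂ) • D2) * (D1 - (2⁻¹ : ℂ) • D2) =
      D1 * D1 - (2⁻¹ : ℂ) • (D1 * D2 + D2 * D1) + (2⁻¹ * 2⁻¹ : ℂ) • (D2 * D2) := by
    simp only [sub_mul, mul_sub, smul_mul_assoc, mul_smul_comm, smul_add, smul_sub, mul_smul]
    abel
  rw [h, h22, h12, ← h11, smul_smul, inv_mul_cancel₀ two_ne_zero, one_smul, sub_self, smul_zero,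
    zero_add]

end Square

include hX in
/-- The square of the Dolbeault operator vanishes. -/
theorem dolbeault_mul_dolbeault : dolbeault B ξ₀ X ξ * dolbeault B ξ₀ X ξ = 0 := by
  rw [dolbeault_eq]
  refine sub_smul_mul_self_eq_zero
    (sum_tmul_mul_self (c := fun i j k => B ⁅(X i : 𝔤), (X j : 𝔤)⁆ (ξ k))
      (fun i j => extMul_mul_extMul _ _) fun i j => ?_) (sum_tmul_mul_add fun k => ?_) ?_
  · rw [← Ring.lie_def, ← LieHom.map_lie]
    conv_rhs => rw [← sum_form_smul_nilPos hX (nilPos_lie_mem (X i).2 (X j).2)]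
    rw [map_sum]
    exact Finset.sum_congr rfl fun k _ => (map_smul _ _ _).symm
  · rw [cubic_mul_extMul, sub_add_cancel]; rfl
  · rw [Algebra.TensorProduct.tmul_mul_tmul, cubic_mul_cubic hX, TensorProduct.tmul_zero]

end Invariance

/-! ### The Laplacian on an enveloping algebra with coefficients -/

theorem gradedComm_gradedComm {A : Type*} [Ring A] [Algebra ℂ A] {γ : A →ₐ[ℂ] A} {D : A}
    (hγ : ∀ b, γ (γ b) = b) (hD : γ D = -D) (hD2 : D * D = 0) (b : A) :
    gradedComm γ D (gradedComm γ D b) = 0 := by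
  have h : gradedComm γ D (gradedComm γ D b) = D * D * b - b * (D * D) := by
    simp only [gradedComm_apply, map_sub, map_mul, hγ, hD]
    noncomm_ring
  rw [h, hD2, zero_mul, mul_zero, sub_self]

section Laplace

open UniversalEnvelopingAlgebra (ι)

/-- The operator `d P + P d`. -/
def laplace {V : Type*} [AddCommGroup V] [Module ℂ V] (d P : Module.End ℂ V) : Module.End ℂ V :=
  d * P + P * d

theorem laplace_apply {V : Type*} [AddCommGroup V] [Module ℂ V] (d P : Module.End ℂ V) (v : V) :
    laplace d P v = d (P v) + P (d v) := rfl

variable {L R E : Type*} [LieRing L] [LieAlgebra ℂ L] [Ring R] [Algebra ℂ R] [Ring E] [Algebra ℂ E]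
  {n : ℕ} (F : Frame L R n)

/-- The contraction operator `∑ i, ∂_i ⊗ Q_i`. -/
def contr (Q : Fin n → Module.End ℂ E) : Module.End ℂ (UniversalEnvelopingAlgebra ℂ L ⊗[ℂ] E) :=
  ∑ i, TensorProduct.map (F.der i) (Q i)

theorem contr_tmul (Q : Fin n → Module.End ℂ E) (u : UniversalEnvelopingAlgebra ℂ L) (T : E) :
    contr F Q (u ⊗ₜ[ℂ] T) = ∑ i, F.der i u ⊗ₜ[ℂ] Q i T := by
  simp [contr, LinearMap.sum_apply]

/-- The Koszul operator `u ⊗ T ↦ ∑ i, u X_i ⊗ ∂_i T`. -/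
def koszul (d : Fin n → Module.End ℂ E) : Module.End ℂ (UniversalEnvelopingAlgebra ℂ L ⊗[ℂ] E) :=
  ∑ i, TensorProduct.map (LinearMap.mulRight ℂ (ι ℂ (F.X i))) (d i)

theorem koszul_tmul (d : Fin n → Module.End ℂ E) (u : UniversalEnvelopingAlgebra ℂ L) (T : E) :
    koszul F d (u ⊗ₜ[ℂ] T) = ∑ i, (u * ι ℂ (F.X i)) ⊗ₜ[ℂ] d i T := by
  simp [koszul, LinearMap.sum_apply]

variable (E) in
/-- The filtration of `U(L) ⊗ E` induced by that of `U(L)`. -/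
def bfil (L : Type*) [LieRing L] [LieAlgebra ℂ L] (p : ℕ) :
    Submodule ℂ (UniversalEnvelopingAlgebra ℂ L ⊗[ℂ] E) := tens E (ufil L p)

theorem tmul_mem_bfil {p : ℕ} {u : UniversalEnvelopingAlgebra ℂ L} (hu : u ∈ ufil L p) (T : E) :
    u ⊗ₜ[ℂ] T ∈ bfil E L p := tmul_mem_tens hu T

theorem bfil_le {p : ℕ} {W : Submodule ℂ (UniversalEnvelopingAlgebra ℂ L ⊗[ℂ] E)} :
    bfil E L p ≤ W ↔ ∀ u ∈ ufil L p, ∀ T, u ⊗ₜ[ℂ] T ∈ W := tens_le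

theorem bfil_zero : bfil E L 0 = ⊥ := tens_bot

theorem bfil_mono {p q : ℕ} (h : p ≤ q) : bfil E L p ≤ bfil E L q := tens_mono (ufil_mono h)

theorem exists_mem_bfil (z : UniversalEnvelopingAlgebra ℂ L ⊗[ℂ] E) : ∃ p, z ∈ bfil E L p := by
  induction z using TensorProduct.induction_on with
  | zero => exact ⟨0, zero_mem _⟩
  | tmul u T =>
    obtain ⟨p, hp⟩ := exists_mem_ufil u
    exact ⟨p, tmul_mem_bfil hp T⟩
  | add x y hx hy =>
    obtain ⟨p, hp⟩ := hx
    obtain ⟨q, hq⟩ := hy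
    exact ⟨max p q, add_mem (bfil_mono (le_max_left _ _) hp) (bfil_mono (le_max_right _ _) hq)⟩

theorem contr_mem (Q : Fin n → Module.End ℂ E) {p : ℕ}
    {z : UniversalEnvelopingAlgebra ℂ L ⊗[ℂ] E} (hz : z ∈ bfil E L (p + 1)) :
    contr F Q z ∈ bfil E L p := by
  have : bfil E L (p + 1) ≤ (bfil E L p).comap (contr F Q) := bfil_le.2 fun u hu T => by
    rw [Submodule.mem_comap, contr_tmul]
    exact sum_mem fun i _ => tmul_mem_bfil (F.der_mem hu i) _
  exact this hz

/-- The mixed terms of `d P` and `P d` have opposite signs and cancel except for the Leibniz terms.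
Those with equal indices give the number operator; the anticommutator of `d_i` and `Q_i` gives the
Euler operator. -/
theorem laplace_koszul_sub_mem {d Q : Fin n → Module.End ℂ E}
    (h : ∀ i j T, d i (Q j T) = (if j = i then (1 : ℂ) else 0) • T - Q j (d i T)) {p : ℕ}
    {u : UniversalEnvelopingAlgebra ℂ L} (hu : u ∈ ufil L (p + 1)) (T : E) :
    laplace (koszul F d) (contr F Q) (u ⊗ₜ[ℂ] T) -
      (F.euler u ⊗ₜ[ℂ] T + u ⊗ₜ[ℂ] ∑ i, Q i (d i T)) ∈ bfil E L p := by
  have e1 : koszul F d (contr F Q (u ⊗ₜ[ℂ] T)) =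
      F.euler u ⊗ₜ[ℂ] T - ∑ j, ∑ i, (F.der j u * ι ℂ (F.X i)) ⊗ₜ[ℂ] Q j (d i T) := by
    rw [contr_tmul, map_sum, Frame.euler_apply, TensorProduct.sum_tmul, ← Finset.sum_sub_distrib]
    refine Finset.sum_congr rfl fun j _ => ?_
    rw [koszul_tmul, Finset.sum_congr rfl fun i _ => by rw [h, TensorProduct.tmul_sub],
      Finset.sum_sub_distrib]
    congr 1
    rw [Finset.sum_eq_single j]
    · rw [if_pos rfl, one_smul]
    · intro i _ hi
      rw [if_neg (Ne.symm hi), zero_smul, TensorProduct.tmul_zero]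
    · simp
  have e2 : contr F Q (koszul F d (u ⊗ₜ[ℂ] T)) =
      ∑ j, ∑ i, F.der j (u * ι ℂ (F.X i)) ⊗ₜ[ℂ] Q j (d i T) := by
    rw [koszul_tmul, map_sum, Finset.sum_congr rfl fun i _ => contr_tmul F Q _ _, Finset.sum_comm]
  have e3 : u ⊗ₜ[ℂ] ∑ i, Q i (d i T) =
      ∑ j, ∑ i, (F.f j (F.rho (F.X i)) • u) ⊗ₜ[ℂ] Q j (d i T) := by
    rw [TensorProduct.tmul_sum]
    refine Finset.sum_congr rfl fun j _ => ?_
    rw [Finset.sum_eq_single j]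
    · rw [F.f_rho_X, if_pos rfl, one_smul]
    · intro i _ hi
      rw [F.f_rho_X, if_neg (Ne.symm hi), zero_smul, TensorProduct.zero_tmul]
    · simp
  have e4 : laplace (koszul F d) (contr F Q) (u ⊗ₜ[ℂ] T) -
      (F.euler u ⊗ₜ[ℂ] T + u ⊗ₜ[ℂ] ∑ i, Q i (d i T)) =
      ∑ j, ∑ i, (F.der j (u * ι ℂ (F.X i)) - F.der j u * ι ℂ (F.X i) -
        F.f j (F.rho (F.X i)) • u) ⊗ₜ[ℂ] Q j (d i T) := by
    simp only [TensorProduct.sub_tmul, Finset.sum_sub_distrib]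
    rw [laplace_apply, e1, e2, e3]
    abel
  rw [e4]
  exact sum_mem fun j _ => sum_mem fun i _ => tmul_mem_bfil (F.der_mul_iota_sub_mem hu _ _) _

theorem laplace_sub_laplace_mem {d d' P : Module.End ℂ (UniversalEnvelopingAlgebra ℂ L ⊗[ℂ] E)}
    (hd : ∀ p, ∀ z ∈ bfil E L p, d z - d' z ∈ bfil E L p)
    (hP : ∀ p, ∀ z ∈ bfil E L (p + 1), P z ∈ bfil E L p) {p : ℕ}
    {z : UniversalEnvelopingAlgebra ℂ L ⊗[ℂ] E} (hz : z ∈ bfil E L (p + 1)) :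
    laplace d P z - laplace d' P z ∈ bfil E L p := by
  have : laplace d P z - laplace d' P z = (d (P z) - d' (P z)) + P (d z - d' z) := by
    rw [laplace_apply, laplace_apply, map_sub]; abel
  rw [this]
  exact add_mem (hd _ _ (hP _ _ hz)) (hP _ _ (hd _ _ hz))

/-- Replacing `X_i u` by `u X_i` costs a commutator that preserves the filtration, and `1 ⊗ C`
preserves it too. Thus the Koszul operator is the part of `d` that raises degree. -/
theorem gradedComm_sub_koszul_mem (γ : E →ₐ[ℂ] E) (e : Fin n → E) (C : E) {p : ℕ}
    {z : UniversalEnvelopingAlgebra ℂ L ⊗[ℂ] E} (hz : z ∈ bfil E L p) :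
    gradedComm (Algebra.TensorProduct.map (AlgHom.id ℂ (UniversalEnvelopingAlgebra ℂ L)) γ)
      (∑ i, ι ℂ (F.X i) ⊗ₜ[ℂ] e i + 1 ⊗ₜ[ℂ] C) z -
        koszul F (fun i => gradedComm γ (e i)) z ∈ bfil E L p := by
  set d := gradedComm (Algebra.TensorProduct.map (AlgHom.id ℂ (UniversalEnvelopingAlgebra ℂ L)) γ)
      (∑ i, ι ℂ (F.X i) ⊗ₜ[ℂ] e i + 1 ⊗ₜ[ℂ] C) with hd
  suffices bfil E L p ≤ (bfil E L p).comap (d - koszul F (fun i => gradedComm γ (e i))) from this hz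
  refine bfil_le.2 fun u hu T => ?_
  rw [Submodule.mem_comap, LinearMap.sub_apply]
  have h1 : d (u ⊗ₜ[ℂ] T) - koszul F (fun i => gradedComm γ (e i)) (u ⊗ₜ[ℂ] T) =
      ∑ i, (ι ℂ (F.X i) * u - u * ι ℂ (F.X i)) ⊗ₜ[ℂ] (e i * T) + u ⊗ₜ[ℂ] gradedComm γ C T := by
    rw [hd, koszul_tmul, gradedComm_apply, Algebra.TensorProduct.map_tmul, AlgHom.id_apply, add_mul,
      mul_add, Finset.sum_mul, Finset.mul_sum]
    simp only [Algebra.TensorProduct.tmul_mul_tmul, one_mul, mul_one, gradedComm_apply,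
      TensorProduct.tmul_sub, TensorProduct.sub_tmul, Finset.sum_sub_distrib]
    abel
  rw [h1]
  exact add_mem (sum_mem fun i _ => tmul_mem_bfil (commutator_mem_ufil _ hu) _) (tmul_mem_bfil hu _)

/-- The Laplacian preserves the filtration, and its leading part is given by the Euler operator and
by the number operator. -/
theorem laplace_sub_mem {γ : E →ₐ[ℂ] E} {e : Fin n → E} {C : E} {Q : Fin n → Module.End ℂ E}
    (h : ∀ i j T, gradedComm γ (e i) (Q j T) =
      (if j = i then (1 : ℂ) else 0) • T - Q j (gradedComm γ (e i) T)) {p : ℕ}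
    {u : UniversalEnvelopingAlgebra ℂ L} (hu : u ∈ ufil L (p + 1)) (T : E) :
    laplace (gradedComm
      (Algebra.TensorProduct.map (AlgHom.id ℂ (UniversalEnvelopingAlgebra ℂ L)) γ)
      (∑ i, ι ℂ (F.X i) ⊗ₜ[ℂ] e i + 1 ⊗ₜ[ℂ] C)) (contr F Q) (u ⊗ₜ[ℂ] T) -
      (F.euler u ⊗ₜ[ℂ] T + u ⊗ₜ[ℂ] ∑ i, Q i (gradedComm γ (e i) T)) ∈ bfil E L p := by
  have h1 := laplace_koszul_sub_mem F h hu T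
  have h2 := laplace_sub_laplace_mem (fun p z hz => gradedComm_sub_koszul_mem F γ e C hz)
    (fun p z hz => contr_mem F Q hz) (tmul_mem_bfil hu T)
  simpa using add_mem h2 h1

end Laplace

section ExtLaplace

open UniversalEnvelopingAlgebra (ι)
open Polynomial

variable {L R M : Type*} [LieRing L] [LieAlgebra ℂ L] [Ring R] [Algebra ℂ R] [AddCommGroup M]
  [Module ℂ M] {n : ℕ} {F : Frame L R n} {ξ : Module.Basis (Fin n) ℂ M}
  {φ : Fin n → Module.Dual ℂ M}
  {N : Module.End ℂ (UniversalEnvelopingAlgebra ℂ L ⊗[ℂ] Module.End ℂ (ExteriorAlgebra ℂ M))}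
  (hN : ∀ (p : ℕ) (u : UniversalEnvelopingAlgebra ℂ L), u ∈ ufil L (p + 1) → ∀ T,
    N (u ⊗ₜ[ℂ] T) - (F.euler u ⊗ₜ[ℂ] T + u ⊗ₜ[ℂ] numOp ξ φ T) ∈
      bfil (Module.End ℂ (ExteriorAlgebra ℂ M)) L p)

include hN

theorem map_mem_bfil (p : ℕ) : ∀ z ∈ bfil (Module.End ℂ (ExteriorAlgebra ℂ M)) L p,
    N z ∈ bfil (Module.End ℂ (ExteriorAlgebra ℂ M)) L p := by
  cases p with
  | zero =>
    intro z hz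
    rw [bfil_zero, Submodule.mem_bot] at hz
    rw [hz, map_zero]; exact zero_mem _
  | succ p =>
    suffices bfil (Module.End ℂ (ExteriorAlgebra ℂ M)) L (p + 1) ≤
      (bfil (Module.End ℂ (ExteriorAlgebra ℂ M)) L (p + 1)).comap N from this
    refine bfil_le.2 fun u hu T => ?_
    have h := add_mem (bfil_mono p.le_succ (hN p u hu T))
      (add_mem (tmul_mem_bfil (F.euler_mem hu) T) (tmul_mem_bfil hu (numOp ξ φ T)))
    rwa [sub_add_cancel] at h

/-- On products with `a` factors in the span of the `X i`, the Euler operator becomes the scalar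
`a`; only the number operator remains. -/
theorem map_tmul_sub_mem {p a : ℕ} {u : UniversalEnvelopingAlgebra ℂ L} (hu : u ∈ F.typed p a)
    (T : Module.End ℂ (ExteriorAlgebra ℂ M)) :
    N (u ⊗ₜ[ℂ] T) - u ⊗ₜ[ℂ] (numOp ξ φ + algebraMap ℂ _ (a : ℂ)) T ∈
      bfil (Module.End ℂ (ExteriorAlgebra ℂ M)) L p := by
  have h := add_mem (hN p u (F.typed_le p a hu) T) (tmul_mem_bfil (F.euler_sub_mem hu) T)
  convert h using 1
  rw [LinearMap.add_apply, Module.algebraMap_end_apply, TensorProduct.tmul_add,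
    TensorProduct.sub_tmul, TensorProduct.tmul_smul, TensorProduct.smul_tmul']
  abel

theorem aeval_tmul_sub_mem {p a : ℕ} {u : UniversalEnvelopingAlgebra ℂ L} (hu : u ∈ F.typed p a)
    (T : Module.End ℂ (ExteriorAlgebra ℂ M)) (G : ℂ[X]) :
    aeval N G (u ⊗ₜ[ℂ] T) - u ⊗ₜ[ℂ] aeval (numOp ξ φ) (G.comp (X + C (a : ℂ))) T ∈
      bfil (Module.End ℂ (ExteriorAlgebra ℂ M)) L p := by
  have h := aeval_intertwine (map_mem_bfil hN p)
    (TensorProduct.mk ℂ (UniversalEnvelopingAlgebra ℂ L) _ u)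
    (fun T => map_tmul_sub_mem hN hu T) G T
  have e : aeval (numOp ξ φ) (G.comp (X + C (a : ℂ))) =
      aeval (numOp ξ φ + algebraMap ℂ _ (a : ℂ)) G := by
    rw [aeval_comp, map_add, aeval_X, aeval_C]
  rw [e]
  exact h

/-- A polynomial in the Laplacian maps a filtered piece to the sum of the next lower one and of the
space of left multiplications with coefficients in the products of elements of `ℂ + P`. -/
theorem aeval_shiftPoly_mem (h : ∀ i j, φ i (ξ j) = if i = j then 1 else 0) {p : ℕ}
    {z : UniversalEnvelopingAlgebra ℂ L ⊗[ℂ] Module.End ℂ (ExteriorAlgebra ℂ M)}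
    (hz : z ∈ bfil (Module.End ℂ (ExteriorAlgebra ℂ M)) L (p + 1)) :
    aeval N (shiftPoly 1 (p + n)) z ∈
      Submodule.map₂ (TensorProduct.mk ℂ (UniversalEnvelopingAlgebra ℂ L) _) (F.typed p 0)
        (LinearMap.range (LinearMap.mul ℂ (ExteriorAlgebra ℂ M))) ⊔
      bfil (Module.End ℂ (ExteriorAlgebra ℂ M)) L p := by
  set W := Submodule.map₂ (TensorProduct.mk ℂ (UniversalEnvelopingAlgebra ℂ L) _) (F.typed p 0)
        (LinearMap.range (LinearMap.mul ℂ (ExteriorAlgebra ℂ M))) ⊔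
      bfil (Module.End ℂ (ExteriorAlgebra ℂ M)) L p with hW
  suffices bfil (Module.End ℂ (ExteriorAlgebra ℂ M)) L (p + 1) ≤
    W.comap (aeval N (shiftPoly 1 (p + n))) from this hz
  refine bfil_le.2 fun u hu T => ?_
  suffices ⨆ (a : ℕ) (_ : a ≤ p), F.typed p a ≤
      (W.comap (aeval N (shiftPoly 1 (p + n)))).comap
        ((TensorProduct.mk ℂ (UniversalEnvelopingAlgebra ℂ L) _).flip T) from
    this (F.ufil_le_iSup_typed p hu)
  refine iSup₂_le fun a ha v hv => ?_
  rw [Submodule.mem_comap, Submodule.mem_comap, LinearMap.flip_apply, TensorProduct.mk_apply]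
  have h1 := aeval_tmul_sub_mem hN hv T (shiftPoly 1 (p + n))
  suffices v ⊗ₜ[ℂ] aeval (numOp ξ φ) ((shiftPoly 1 (p + n)).comp (X + C (a : ℂ))) T ∈ W by
    have := add_mem (Submodule.mem_sup_right h1 : _ ∈ W) this
    rwa [sub_add_cancel] at this
  cases a with
  | succ a =>
    -- With `a + 1` factors from the span of the `X i`, `1 ≤ a + 1 ≤ p`, the Laplacian has its
    -- possible eigenvalues in `{a + 1, …, a + 1 + n}`. All of these are roots, so nothing survives.
    have h2 : shiftPoly 1 (p + n) = shiftPoly 1 a * shiftPoly (a + 1 + (n + 1)) (p - (a + 1)) *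
        shiftPoly (0 + (a + 1)) (n + 1) := by
      have e : p + n = a + ((n + 1) + (p - (a + 1))) := by omega
      rw [e, shiftPoly_add, shiftPoly_add, zero_add, add_comm 1 a]; ring
    rw [h2, mul_comp, shiftPoly_comp_add, aeval_mul_apply, aeval_numOp_shiftPoly h, map_zero,
      TensorProduct.tmul_zero]
    exact zero_mem _
  | zero =>
    -- Without factors from that span, the roots `1, …, n` eliminate every number eigenvalue except
    -- `0`.
    rw [Nat.cast_zero, C_0, add_zero, comp_X, add_comm p n, shiftPoly_add, aeval_mul_apply]
    set T' := aeval (numOp ξ φ) (shiftPoly 1 n) (aeval (numOp ξ φ) (shiftPoly (1 + n) p) T)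
    have h3 : ∀ m, extComm m T' = 0 := fun m => by
      let f : M →ₗ[ℂ] Module.End ℂ (ExteriorAlgebra ℂ M) :=
        { toFun := fun m => extComm m T'
          map_add' := fun m m' => by
            simp only [extComm_apply, extMul_add, add_mul, mul_add]; abel
          map_smul' := fun c m => by
            simp only [extComm_apply, extMul_smul, smul_mul_assoc, mul_smul_comm, smul_sub,
              RingHom.id_apply] }
      have : f = 0 := ξ.ext fun j => extComm_aeval_numOp_shiftPoly h _ j
      exact DFunLike.congr_fun this m
    refine Submodule.mem_sup_left (Submodule.apply_mem_map₂ _ hv ⟨T' 1, ?_⟩)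
    exact (eq_mulLeft_of_extComm_eq_zero h3).symm

end ExtLaplace

/-! ### Weights in `U(𝔤) ⊗ End(∧𝔲bar)` -/

section WeightAlg

open UniversalEnvelopingAlgebra (ι)

section TensorWeight

variable {A E : Type*} [Ring A] [Algebra ℂ A] [Ring E] [Algebra ℂ E]

theorem mul_mem_one_sup_negSpace (a : A) {x y : A}
    (hx : x ∈ 1 ⊔ negSpace (comm a)) (hy : y ∈ 1 ⊔ negSpace (comm a)) :
    x * y ∈ 1 ⊔ negSpace (comm a) := by
  obtain ⟨x0, hx0, x, hx', rfl⟩ := Submodule.mem_sup.1 hx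
  obtain ⟨r, rfl⟩ := Submodule.mem_one.1 hx0
  rw [add_mul, ← Algebra.smul_def]
  refine add_mem (Submodule.smul_mem _ _ hy) (Submodule.mem_sup_right ?_)
  obtain ⟨y0, hy0, y, hy', rfl⟩ := Submodule.mem_sup.1 hy
  obtain ⟨s, rfl⟩ := Submodule.mem_one.1 hy0
  rw [mul_add, ← Algebra.commutes, ← Algebra.smul_def]
  exact add_mem (Submodule.smul_mem _ _ hx') (mul_mem_negSpace hx' hy')

theorem comm_add_tmul (a u : A) (S T : E) :
    comm (a ⊗ₜ[ℂ] 1 + 1 ⊗ₜ[ℂ] S : A ⊗[ℂ] E) (u ⊗ₜ[ℂ] T) =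
      comm a u ⊗ₜ[ℂ] T + u ⊗ₜ[ℂ] comm S T := by
  simp only [comm_apply, add_mul, mul_add, Algebra.TensorProduct.tmul_mul_tmul, one_mul, mul_one,
    TensorProduct.sub_tmul, TensorProduct.tmul_sub]
  abel

variable {a u : A} {S T : E}

theorem tmul_mem_negSpace (hu : u ∈ negSpace (comm a)) (hT : T ∈ negSpace (comm S)) :
    u ⊗ₜ[ℂ] T ∈ negSpace (comm (a ⊗ₜ[ℂ] 1 + 1 ⊗ₜ[ℂ] S : A ⊗[ℂ] E)) := by
  suffices negSpace (comm a) ≤ (negSpace (comm (a ⊗ₜ[ℂ] 1 + 1 ⊗ₜ[ℂ] S : A ⊗[ℂ] E))).comap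
    ((TensorProduct.mk ℂ A E).flip T) from this hu
  refine negSpace_le fun t ht v hv => ?_
  suffices negSpace (comm S) ≤ (negSpace (comm (a ⊗ₜ[ℂ] 1 + 1 ⊗ₜ[ℂ] S : A ⊗[ℂ] E))).comap
    (TensorProduct.mk ℂ A E v) from this hT
  refine negSpace_le fun s hs R hR => ?_
  refine mem_negSpace (add_neg ht hs) ?_
  rw [TensorProduct.mk_apply, comm_add_tmul, hv, hR, Complex.ofReal_add, add_smul,
    TensorProduct.tmul_smul, ← TensorProduct.smul_tmul']

theorem tmul_mem_negSpace_of_comm_left (hu : comm a u = 0) (hT : T ∈ negSpace (comm S)) :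
    u ⊗ₜ[ℂ] T ∈ negSpace (comm (a ⊗ₜ[ℂ] 1 + 1 ⊗ₜ[ℂ] S : A ⊗[ℂ] E)) :=
  map_mem_negSpace (TensorProduct.mk ℂ A E u) (fun R => by
    rw [TensorProduct.mk_apply, comm_add_tmul, hu, TensorProduct.zero_tmul, zero_add]; rfl) hT

theorem tmul_one_mem_negSpace (hu : u ∈ negSpace (comm a)) :
    u ⊗ₜ[ℂ] 1 ∈ negSpace (comm (a ⊗ₜ[ℂ] 1 + 1 ⊗ₜ[ℂ] S : A ⊗[ℂ] E)) :=
  map_mem_negSpace ((TensorProduct.mk ℂ A E).flip 1) (fun v => by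
    rw [LinearMap.flip_apply, TensorProduct.mk_apply, comm_add_tmul,
      comm_apply S, mul_one, one_mul, sub_self, TensorProduct.tmul_zero, add_zero]
    rfl) hu

theorem map₂_le_sup_negSpace {A' : Type*} [Ring A'] [Algebra ℂ A'] (f : A' →ₐ[ℂ] A)
    (hf : ∀ w, comm a (f w) = 0) {V : Submodule ℂ A} {V' : Submodule ℂ A'} {W : Submodule ℂ E}
    (hV : V ≤ V'.map f.toLinearMap ⊔ negSpace (comm a)) (hW : W ≤ 1 ⊔ negSpace (comm S)) :
    Submodule.map₂ (TensorProduct.mk ℂ A E) V W ≤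
      V'.map ((TensorProduct.mk ℂ A E).flip 1 ∘ₗ f.toLinearMap) ⊔
        negSpace (comm (a ⊗ₜ[ℂ] 1 + 1 ⊗ₜ[ℂ] S : A ⊗[ℂ] E)) := by
  rw [Submodule.map₂_le]
  intro u hu R hR
  obtain ⟨_, ⟨w, hw, rfl⟩, v, hv, rfl⟩ := Submodule.mem_sup.1 (hV hu)
  obtain ⟨R0, hR0, T, hT, rfl⟩ := Submodule.mem_sup.1 (hW hR)
  obtain ⟨r, rfl⟩ := Submodule.mem_one.1 hR0
  rw [Algebra.algebraMap_eq_smul_one, TensorProduct.mk_apply, TensorProduct.tmul_add,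
    TensorProduct.add_tmul, TensorProduct.add_tmul, TensorProduct.tmul_smul,
    TensorProduct.tmul_smul]
  refine add_mem (add_mem (Submodule.smul_mem _ _ (Submodule.mem_sup_left ⟨w, hw, rfl⟩))
    (Submodule.smul_mem _ _ (Submodule.mem_sup_right (tmul_one_mem_negSpace hv))))
    (Submodule.mem_sup_right (add_mem ?_ (tmul_mem_negSpace hv hT)))
  exact tmul_mem_negSpace_of_comm_left (hf w) hT

theorem mul_comm_of_iota {L : Type*} [LieRing L] [LieAlgebra ℂ L]
    (f : UniversalEnvelopingAlgebra ℂ L →ₐ[ℂ] A) {b : A} (h : ∀ x, comm (f (ι ℂ x)) b = 0)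
    (w : UniversalEnvelopingAlgebra ℂ L) : f w * b = b * f w := by
  induction w using env_induction with
  | one => rw [map_one, mul_one, one_mul]
  | smul c u h => rw [map_smul, smul_mul_assoc, mul_smul_comm, h]
  | add u v hu hv => rw [map_add, add_mul, mul_add, hu, hv]
  | mul x u hu =>
    have hx : f (ι ℂ x) * b = b * f (ι ℂ x) := sub_eq_zero.1 (h x)
    rw [map_mul, mul_assoc, hu, ← mul_assoc, ← mul_assoc, hx]

theorem comm_gradedComm {γ : A →ₐ[ℂ] A} {D a : A} (hD : comm a D = 0) (ha : γ a = a) (b : A) :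
    comm a (gradedComm γ D b) = gradedComm γ D (comm a b) := by
  have hγ : γ (comm a b) = comm a (γ b) := by
    rw [comm_apply, comm_apply, map_sub, map_mul, map_mul, ha]
  rw [gradedComm_apply, gradedComm_apply, map_sub, comm_mul, comm_mul, hD, hγ, zero_mul, mul_zero,
    zero_add, add_zero]

theorem mem_center_of_comm {L : Type*} [LieRing L] [LieAlgebra ℂ L]
    {w : UniversalEnvelopingAlgebra ℂ L} (h : ∀ x : L, comm (ι ℂ x) w = 0) : w ∈ ZU L :=
  Subalgebra.mem_center_iff.2 fun u => mul_comm_of_iota (AlgHom.id ℂ _) h u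

end TensorWeight

theorem ufil_map_lift {L L' : Type*} [LieRing L] [LieAlgebra ℂ L] [LieRing L'] [LieAlgebra ℂ L']
    {f : UniversalEnvelopingAlgebra ℂ L →ₐ[ℂ] UniversalEnvelopingAlgebra ℂ L'} {g : L → L'}
    (hf : ∀ x, f (ι ℂ x) = ι ℂ (g x)) (p : ℕ) : (ufil L p).map f.toLinearMap ≤ ufil L' p := by
  cases p with
  | zero => exact (Submodule.map_bot _).le
  | succ p =>
    have h : (1 ⊔ iotaMap (⊤ : Submodule ℂ L)).map f.toLinearMap ≤
        1 ⊔ iotaMap (⊤ : Submodule ℂ L') := by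
      rw [Submodule.map_sup, Submodule.map_one]
      refine sup_le_sup_left ?_ _
      rintro _ ⟨_, ⟨x, -, rfl⟩, rfl⟩
      exact (hf x) ▸ iota_mem_iotaMap trivial
    change ((1 ⊔ iotaMap (⊤ : Submodule ℂ L)) ^ p).map f.toLinearMap ≤ _ ^ p
    rw [Submodule.map_pow]
    exact pow_le_pow_left' h p

variable {𝔤 : Type*} [LieRing 𝔤] [LieAlgebra ℂ 𝔤] {ξ₀ : 𝔤}

theorem extMul_mem_negSpace {Y : levi ξ₀} (hY : (Y : 𝔤) = ξ₀) (m : nilNeg ξ₀) :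
    extMul m ∈ negSpace (comm (leviAct ξ₀ Y)) := by
  have key : (nilNeg ξ₀).toSubmodule ≤ Submodule.map (nilNeg ξ₀).toSubmodule.subtype
      ((negSpace (comm (leviAct ξ₀ Y))).comap (extMulHom ξ₀)) := by
    refine iSup₂_le fun t ht v hv => ?_
    have hv' : v ∈ nilNeg ξ₀ := Submodule.mem_iSup_of_mem t (Submodule.mem_iSup_of_mem ht hv)
    refine ⟨⟨v, hv'⟩, mem_negSpace ht ?_, rfl⟩
    have h1 : ⁅Y, (⟨v, hv'⟩ : nilNeg ξ₀)⁆ = (t : ℂ) • ⟨v, hv'⟩ := Subtype.ext (by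
      change ⁅(Y : 𝔤), v⁆ = (t : ℂ) • v
      rw [hY]; exact Module.End.mem_eigenspace_iff.1 hv)
    change comm (leviAct ξ₀ Y) (extMul _) = (t : ℂ) • extMul _
    rw [comm_leviAct_extMul, h1, extMul_smul]
  obtain ⟨m', hm', h⟩ := key m.2
  have : m' = m := Subtype.ext h
  rw [← this]; exact hm'

/-- Each `e(m)` with `m` in `𝔲bar` has negative weights only, and products of such operators remain
negative; scalars account for the weight zero part. -/
theorem mulLeft_mem_one_sup_negSpace {Y : levi ξ₀} (hY : (Y : 𝔤) = ξ₀) (x : ExtNeg ξ₀) :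
    LinearMap.mulLeft ℂ x ∈ 1 ⊔ negSpace (comm (leviAct ξ₀ Y)) := by
  induction x using ExteriorAlgebra.induction with
  | algebraMap r =>
    refine Submodule.mem_sup_left (Submodule.mem_one.2 ⟨r, ?_⟩)
    refine LinearMap.ext fun x => ?_
    rw [Module.algebraMap_end_apply, LinearMap.mulLeft_apply,
      Algebra.smul_def]
  | ι m => exact Submodule.mem_sup_right (extMul_mem_negSpace hY m)
  | mul a b ha hb =>
    rw [LinearMap.mulLeft_mul]; exact mul_mem_one_sup_negSpace _ ha hb
  | add a b ha hb =>
    have : LinearMap.mulLeft ℂ (a + b) = LinearMap.mulLeft ℂ a + LinearMap.mulLeft ℂ b :=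
      map_add (LinearMap.mul ℂ (ExtNeg ξ₀)) a b
    rw [this]; exact add_mem ha hb

/-- The products of elements of `ℂ + 𝔥 + 𝔲bar` belong to `U(𝔥)` modulo negative weights. -/
theorem typed_zero_le {R : Type*} [Ring R] [Algebra ℂ R] {n : ℕ} (F : Frame 𝔤 R n)
    (hF : F.P = parNeg ξ₀) (p : ℕ) :
    F.typed p 0 ≤ (ufil (levi ξ₀) (p + 1)).map (leviIncl ξ₀).toLinearMap ⊔
      negSpace (comm (ι ℂ ξ₀)) := by
  induction p with
  | zero =>
    refine le_sup_of_le_left ?_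
    rw [ufil_one, Submodule.map_one]; exact le_rfl
  | succ p ih =>
    refine Submodule.mul_le.2 fun u hu y hy => ?_
    rw [hF] at hy
    obtain ⟨y0, hy0, _, ⟨x, hx, rfl⟩, rfl⟩ := Submodule.mem_sup.1 hy
    obtain ⟨r, rfl⟩ := Submodule.mem_one.1 hy0
    obtain ⟨_, ⟨w, hw, rfl⟩, v, hv, rfl⟩ := Submodule.mem_sup.1 (ih hu)
    obtain ⟨Z, hZ, m, hm, rfl⟩ := Submodule.mem_sup.1 hx
    rw [mul_add, ← Algebra.commutes, ← Algebra.smul_def]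
    refine add_mem (Submodule.smul_mem _ _ (add_mem (Submodule.mem_sup_left
      ⟨w, ufil_mono (Nat.le_succ _) hw, rfl⟩) (Submodule.mem_sup_right hv))) ?_
    change (leviIncl ξ₀ w + v) * ι ℂ (Z + m) ∈ _
    have hZm : ι ℂ (Z + m) ∈ nonposAlg (ι ℂ ξ₀) :=
      envPar_le_nonposAlg (iota_mem_envPar hx)
    rw [add_mul]
    refine add_mem ?_ (Submodule.mem_sup_right (mul_mem_negSpace_of_nonpos_right hv hZm))
    rw [map_add, mul_add]
    refine add_mem (Submodule.mem_sup_left ⟨w * ι ℂ (⟨Z, hZ⟩ : levi ξ₀),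
      mul_iota_mem_ufil hw _, ?_⟩) (Submodule.mem_sup_right
        (mul_mem_negSpace_of_comm_left (comm_leviIncl w) (iota_mem_negSpace hm)))
    change leviIncl ξ₀ _ = _
    rw [map_mul, leviIncl_iota]

section Delta

variable {E : Type*} [Ring E] [Algebra ℂ E] (τ : levi ξ₀ →ₗ⁅ℂ⁆ E)

/-- The element `Y ⊗ 1 + 1 ⊗ τ(Y)` for a representation `τ` of `𝔥`. -/
def dLie (Y : levi ξ₀) : UniversalEnvelopingAlgebra ℂ 𝔤 ⊗[ℂ] E :=
  ι ℂ (Y : 𝔤) ⊗ₜ[ℂ] 1 + 1 ⊗ₜ[ℂ] τ Y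

/-- The homomorphism on `U(𝔥)` with `Y ↦ Y ⊗ 1 + 1 ⊗ τ(Y)`. -/
def dHom : UniversalEnvelopingAlgebra ℂ (levi ξ₀) →ₐ[ℂ] UniversalEnvelopingAlgebra ℂ 𝔤 ⊗[ℂ] E :=
  (Algebra.TensorProduct.map (leviIncl ξ₀) (AlgHom.id ℂ E)).comp (coact τ)

theorem dHom_apply (w : UniversalEnvelopingAlgebra ℂ (levi ξ₀)) :
    dHom τ w = Algebra.TensorProduct.map (leviIncl ξ₀) (AlgHom.id ℂ E) (coact τ w) := rfl

theorem dHom_iota (Y : levi ξ₀) : dHom τ (ι ℂ Y) = dLie τ Y := by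
  rw [dHom_apply, coact_iota, map_add, Algebra.TensorProduct.map_tmul,
    Algebra.TensorProduct.map_tmul, leviIncl_iota, map_one, map_one]
  rfl

theorem comm_dLie_mem_bfil (Y : levi ξ₀) (p : ℕ) :
    ∀ z ∈ bfil E 𝔤 p, comm (dLie τ Y) z ∈ bfil E 𝔤 p := by
  suffices bfil E 𝔤 p ≤ (bfil E 𝔤 p).comap (comm (dLie τ Y)) from this
  refine bfil_le.2 fun u hu T => ?_
  rw [Submodule.mem_comap, dLie, comm_add_tmul]
  exact add_mem (tmul_mem_bfil (commutator_mem_ufil _ hu) _) (tmul_mem_bfil hu _)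

/-- This permits replacing `w ⊗ 1`, which the Laplacian need not annihilate, by `δ(w)`, which it
does annihilate. -/
theorem leviIncl_tmul_one_sub_dHom_mem {p : ℕ} {w : UniversalEnvelopingAlgebra ℂ (levi ξ₀)}
    (hw : w ∈ ufil (levi ξ₀) (p + 1)) : leviIncl ξ₀ w ⊗ₜ[ℂ] 1 - dHom τ w ∈ bfil E 𝔤 p := by
  have h1 := coact_sub_mem τ hw
  have h2 : leviIncl ξ₀ w ⊗ₜ[ℂ] 1 - dHom τ w =
      -Algebra.TensorProduct.map (leviIncl ξ₀) (AlgHom.id ℂ E) (coact τ w - w ⊗ₜ[ℂ] 1) := by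
    rw [map_sub, ← dHom_apply, Algebra.TensorProduct.map_tmul, map_one, neg_sub]
  rw [h2]
  refine neg_mem ?_
  suffices tens E (ufil (levi ξ₀) p) ≤ (bfil E 𝔤 p).comap
    (Algebra.TensorProduct.map (leviIncl ξ₀) (AlgHom.id ℂ E)).toLinearMap from this h1
  exact tens_le.2 fun u hu T => tmul_mem_bfil (ufil_map_lift leviIncl_iota p ⟨u, hu, rfl⟩) T

theorem comm_dLie_dHom (Y : levi ξ₀) (w : UniversalEnvelopingAlgebra ℂ (levi ξ₀)) :
    comm (dLie τ Y) (dHom τ w) = dHom τ (comm (ι ℂ Y) w) := by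
  rw [comm_apply, comm_apply, map_sub, map_mul, map_mul, dHom_iota]

/-- As `𝔥` is the centralizer of `ξ₀`, the element `ξ₀` is central in `𝔥`. Consequently `δ(w)` has
weight zero for every `w`, central or not. -/
theorem comm_iota_eq_zero {Y : levi ξ₀} (hY : (Y : 𝔤) = ξ₀)
    (w : UniversalEnvelopingAlgebra ℂ (levi ξ₀)) : comm (ι ℂ Y) w = 0 := by
  have h : ∀ Z, comm (AlgHom.id ℂ (UniversalEnvelopingAlgebra ℂ (levi ξ₀)) (ι ℂ Z)) (ι ℂ Y) = 0 :=
    fun Z => by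
      have : ⁅Z, Y⁆ = 0 := by
        rw [← lie_skew, neg_eq_zero]
        refine Subtype.ext ?_
        change ⁅(Y : 𝔤), (Z : 𝔤)⁆ = 0
        rw [hY]; exact mem_levi.1 Z.2
      rw [AlgHom.id_apply, comm_iota, this, map_zero]
  rw [comm_apply, sub_eq_zero]
  exact (mul_comm_of_iota (AlgHom.id ℂ _) h w).symm

theorem map₂_typed_zero_le {R : Type*} [Ring R] [Algebra ℂ R] {n : ℕ} (F : Frame 𝔤 R n)
    (hF : F.P = parNeg ξ₀) {Y : levi ξ₀} (hY : (Y : 𝔤) = ξ₀) {W : Submodule ℂ E}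
    (hW : W ≤ 1 ⊔ negSpace (comm (τ Y))) (p : ℕ) :
    Submodule.map₂ (TensorProduct.mk ℂ (UniversalEnvelopingAlgebra ℂ 𝔤) E) (F.typed p 0) W ≤
      (ufil (levi ξ₀) (p + 1)).map ((TensorProduct.mk ℂ (UniversalEnvelopingAlgebra ℂ 𝔤) E).flip 1
        ∘ₗ (leviIncl ξ₀).toLinearMap) ⊔ negSpace (comm (dLie τ Y)) := by
  refine map₂_le_sup_negSpace (a := ι ℂ (Y : 𝔤)) (leviIncl ξ₀) ?_ ?_ hW
  · rw [hY]; exact comm_leviIncl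
  · rw [hY]; exact typed_zero_le F hF p

open Polynomial

variable {τ}

/-- A polynomial in the Laplacian maps invariant elements to `δ(U(𝔥))`. -/
theorem exists_aeval_eq_dHom {N : Module.End ℂ (UniversalEnvelopingAlgebra ℂ 𝔤 ⊗[ℂ] E)}
    {R : Type*} [Ring R] [Algebra ℂ R] {n : ℕ} (F : Frame 𝔤 R n) (hF : F.P = parNeg ξ₀)
    {Y : levi ξ₀} (hY : (Y : 𝔤) = ξ₀) {W : Submodule ℂ E} (hW : W ≤ 1 ⊔ negSpace (comm (τ Y)))
    (hN : ∀ p, ∀ z ∈ bfil E 𝔤 (p + 1), aeval N (shiftPoly 1 (p + n)) z ∈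
      Submodule.map₂ (TensorProduct.mk ℂ (UniversalEnvelopingAlgebra ℂ 𝔤) E) (F.typed p 0) W ⊔
        bfil E 𝔤 p)
    (hNY : ∀ z, comm (dLie τ Y) (N z) = N (comm (dLie τ Y) z)) (hNd : ∀ w, N (dHom τ w) = 0)
    (p : ℕ) : ∃ G : ℂ[X], G.eval 0 ≠ 0 ∧ ∀ z ∈ bfil E 𝔤 p, comm (dLie τ Y) z = 0 →
      ∃ w, aeval N G z = dHom τ w := by
  induction p with
  | zero =>
    refine ⟨1, by simp, fun z hz _ => ⟨0, ?_⟩⟩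
    rw [bfil_zero, Submodule.mem_bot] at hz
    rw [hz, map_zero, map_zero]
  | succ p ih =>
    obtain ⟨G, hG0, hG⟩ := ih
    refine ⟨G * shiftPoly 1 (p + n), ?_, fun z hz hz0 => ?_⟩
    · rw [eval_mul]; exact mul_ne_zero hG0 (shiftPoly_eval_zero_ne 0 (p + n))
    have h0 : ∀ w, comm (dLie τ Y) (dHom τ w) = 0 := fun w => by
      rw [comm_dLie_dHom, comm_iota_eq_zero hY, map_zero]
    have hc0 : comm (dLie τ Y) (aeval N (shiftPoly 1 (p + n)) z) = 0 := by
      rw [← aeval_commute (comm (dLie τ Y)) (fun w => (hNY w).symm), hz0, map_zero]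
    obtain ⟨y, hy, x, hx, hyx⟩ := Submodule.mem_sup.1 (hN p z hz)
    obtain ⟨_, ⟨w, hw, rfl⟩, v, hv, rfl⟩ :=
      Submodule.mem_sup.1 (map₂_typed_zero_le τ F hF hY hW p hy)
    -- The difference has weight zero and lies in the lower filtered piece plus negative weights, so
    -- it lies in the lower piece.
    have h1 : aeval N (shiftPoly 1 (p + n)) z - dHom τ w ∈ bfil E 𝔤 p := by
      refine mem_of_sub_mem_negSpace (comm_dLie_mem_bfil τ Y p) ?_ ?_
      · rw [map_sub, hc0, h0, sub_zero]
      · rw [← hyx]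
        refine Submodule.mem_sup.2 ⟨_, add_mem (leviIncl_tmul_one_sub_dHom_mem τ hw) hx, v, hv, ?_⟩
        change _ = leviIncl ξ₀ w ⊗ₜ[ℂ] 1 + v + x - dHom τ w
        abel
    obtain ⟨w', hw'⟩ := hG _ h1 (by rw [map_sub, hc0, h0, sub_zero])
    -- On `δ(w)`, which `N` annihilates, `G(N)` is the scalar `G(0)`.
    refine ⟨w' + G.eval 0 • w, ?_⟩
    rw [map_sub, aeval_apply_of_apply_eq_zero (hNd w), sub_eq_iff_eq_add] at hw'
    rw [aeval_mul_apply, hw', map_add, map_smul]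

/-- Hodge decomposition: an invariant cocycle is the sum of an element of `δ(Z(𝔥))` and of the
coboundary of an invariant element. -/
theorem exists_eq_dHom_sub {d P : Module.End ℂ (UniversalEnvelopingAlgebra ℂ 𝔤 ⊗[ℂ] E)}
    {R : Type*} [Ring R] [Algebra ℂ R] {n : ℕ} (F : Frame 𝔤 R n) (hF : F.P = parNeg ξ₀)
    {W : Submodule ℂ E} (hW : ∀ Y : levi ξ₀, (Y : 𝔤) = ξ₀ → W ≤ 1 ⊔ negSpace (comm (τ Y)))
    (hN : ∀ p, ∀ z ∈ bfil E 𝔤 (p + 1), aeval (laplace d P) (shiftPoly 1 (p + n)) z ∈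
      Submodule.map₂ (TensorProduct.mk ℂ (UniversalEnvelopingAlgebra ℂ 𝔤) E) (F.typed p 0) W ⊔
        bfil E 𝔤 p)
    (hd : ∀ z, d (d z) = 0) (hdY : ∀ Y z, comm (dLie τ Y) (d z) = d (comm (dLie τ Y) z))
    (hPY : ∀ Y z, comm (dLie τ Y) (P z) = P (comm (dLie τ Y) z))
    (hdd : ∀ w, d (dHom τ w) = 0) (hPd : ∀ w, P (dHom τ w) = 0)
    (hinj : Function.Injective (dHom τ)) {b : UniversalEnvelopingAlgebra ℂ 𝔤 ⊗[ℂ] E}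
    (hb : ∀ Y, comm (dLie τ Y) b = 0) (hdb : d b = 0) :
    ∃ w ∈ ZU (levi ξ₀), ∃ c, (∀ Y, comm (dLie τ Y) c = 0) ∧ b = dHom τ w + d c := by
  have hNY : ∀ Y z, comm (dLie τ Y) (laplace d P z) = laplace d P (comm (dLie τ Y) z) :=
    fun Y z => by
      rw [laplace_apply, laplace_apply, map_add, hdY, hPY, hPY, hdY]
  have hNd : ∀ w, laplace d P (dHom τ w) = 0 := fun w => by
    rw [laplace_apply, hdd, hPd, map_zero, map_zero, add_zero]
  obtain ⟨p, hp⟩ := exists_mem_bfil b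
  have hY : (((⟨ξ₀, mem_levi.2 (lie_self ξ₀)⟩ : levi ξ₀)) : 𝔤) = ξ₀ := rfl
  obtain ⟨G, hG0, hG⟩ := exists_aeval_eq_dHom F hF hY (hW _ hY) hN (hNY _) hNd p
  obtain ⟨w, hw⟩ := hG b hp (hb _)
  -- Writing `G = t · divX G + G(0)`, the vector `b'` is again an invariant cocycle, so the
  -- Laplacian acts on it as `d P`.
  set b' := aeval (laplace d P) G.divX b with hb'
  have hdb' : d b' = 0 := by
    rw [hb', ← aeval_commute (N := laplace d P) d (fun z => ?_), hdb, map_zero]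
    rw [laplace_apply, laplace_apply, map_add, hd, hd, map_zero, zero_add, add_zero]
  have hYb' : ∀ Y, comm (dLie τ Y) b' = 0 := fun Y => by
    rw [hb', ← aeval_commute (N := laplace d P) (comm (dLie τ Y)) (fun z => (hNY Y z).symm), hb,
      map_zero]
  have h1 : d (P b') + G.eval 0 • b = dHom τ w := by
    rw [← hw]
    conv_rhs => rw [← X_mul_divX_add G]
    rw [map_add, map_mul, aeval_X, aeval_C, LinearMap.add_apply, Module.End.mul_apply,
      Module.algebraMap_end_apply, ← hb', laplace_apply, hdb', map_zero, add_zero,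
      coeff_zero_eq_eval_zero]
  have hPY' : ∀ Y, comm (dLie τ Y) (P b') = 0 := fun Y => by rw [hPY, hYb', map_zero]
  -- The commutator of `w` with `Y` has image zero under `δ`, because `b` and `d(P b')` are
  -- invariant; injectivity of `δ` makes `w` central.
  refine ⟨(G.eval 0)⁻¹ • w, Subalgebra.smul_mem _ (mem_center_of_comm fun Y => hinj ?_) _,
    -(G.eval 0)⁻¹ • P b', fun Y => by rw [map_smul, hPY', smul_zero], ?_⟩
  · rw [← comm_dLie_dHom, ← h1, map_add, map_smul, hb, hdY, hPY', map_zero, map_zero, smul_zero,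
      add_zero]
  · rw [map_smul, map_smul, ← h1, smul_add, smul_smul, inv_mul_cancel₀ hG0, one_smul, neg_smul]
    abel

end Delta

end WeightAlg

/-! ### Equivariance of the contraction operator and the vacuum expectation -/

section Equivariance

open UniversalEnvelopingAlgebra (ι)

section Coder

variable {L E : Type*} [LieRing L] [LieAlgebra ℂ L] [Ring E] [Algebra ℂ E]

theorem slice_add (f g : Module.Dual ℂ E) (z : UniversalEnvelopingAlgebra ℂ L ⊗[ℂ] E) :
    slice (f + g) z = slice f z + slice g z := by
  rw [slice, LinearMap.lTensor_add]; simp [slice]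

theorem slice_smul (c : ℂ) (f : Module.Dual ℂ E) (z : UniversalEnvelopingAlgebra ℂ L ⊗[ℂ] E) :
    slice (c • f) z = c • slice f z := by
  rw [slice, LinearMap.lTensor_smul]; simp [slice]

theorem slice_comm_add (f g : Module.Dual ℂ E) {a : UniversalEnvelopingAlgebra ℂ L} {S : E}
    (hg : ∀ T, f (comm S T) = -g T) (z : UniversalEnvelopingAlgebra ℂ L ⊗[ℂ] E) :
    slice f (comm (a ⊗ₜ[ℂ] 1 + 1 ⊗ₜ[ℂ] S) z) = comm a (slice f z) - slice g z := by
  induction z using TensorProduct.induction_on with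
  | zero => simp
  | tmul u T =>
    rw [comm_add_tmul, map_add, slice_tmul, slice_tmul, slice_tmul, slice_tmul, hg, map_smul,
      neg_smul, sub_eq_add_neg]
  | add x y hx hy => rw [map_add, map_add, hx, hy, map_add, map_add, map_add]; abel

/-- Differentiation is equivariant: bracketing the argument with `x` also moves the linear form by
the coadjoint action, recorded in `g`. -/
theorem coder_comm (ρ : L →ₗ⁅ℂ⁆ E) (f g : Module.Dual ℂ E) {x : L}
    (hg : ∀ T, f (comm (ρ x) T) = -g T) (u : UniversalEnvelopingAlgebra ℂ L) :
    coder ρ f (comm (ι ℂ x) u) = comm (ι ℂ x) (coder ρ f u) - coder ρ g u := by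
  rw [coder_apply, coder_apply, coder_apply, ← slice_comm_add f g hg, ← coact_iota, comm_apply,
    comm_apply, map_sub, map_mul, map_mul]

end Coder

variable {𝔤 : Type*} [LieRing 𝔤] [LieAlgebra ℂ 𝔤] {ξ₀ : 𝔤}
  {E : Type*} [Ring E] [Algebra ℂ E] {τ : levi ξ₀ →ₗ⁅ℂ⁆ E} {n : ℕ}

/-- The first tensor factors of `δ(w)` lie in `U(𝔥)`, where all derivatives vanish exactly. -/
theorem contr_dHom {R : Type*} [Ring R] [Algebra ℂ R] (F : Frame 𝔤 R n) (hF : F.P = parNeg ξ₀)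
    (Q : Fin n → Module.End ℂ E) (w : UniversalEnvelopingAlgebra ℂ (levi ξ₀)) :
    contr F Q (dHom τ w) = 0 := by
  rw [dHom_apply]
  generalize coact τ w = z
  induction z using TensorProduct.induction_on with
  | zero => rw [map_zero, map_zero]
  | tmul u T =>
    rw [Algebra.TensorProduct.map_tmul, contr_tmul]
    refine Finset.sum_eq_zero fun i _ => ?_
    rw [F.der_eq_zero (by rw [hF]; exact leviIncl_mem_envPar u), TensorProduct.zero_tmul]
  | add x y hx hy => rw [map_add, map_add, hx, hy, add_zero]

section Grading

variable {γ : E →ₐ[ℂ] E} (hγ : ∀ Y, γ (τ Y) = τ Y)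

variable (𝔤 γ) in
/-- The grading operator `id ⊗ γ`. -/
def tensParity : UniversalEnvelopingAlgebra ℂ 𝔤 ⊗[ℂ] E →ₐ[ℂ] UniversalEnvelopingAlgebra ℂ 𝔤 ⊗[ℂ] E :=
  Algebra.TensorProduct.map (AlgHom.id ℂ (UniversalEnvelopingAlgebra ℂ 𝔤)) γ

include hγ

theorem tensParity_dLie (Y : levi ξ₀) : tensParity 𝔤 γ (dLie τ Y) = dLie τ Y := by
  rw [tensParity, dLie, map_add, Algebra.TensorProduct.map_tmul, Algebra.TensorProduct.map_tmul,
    map_one, map_one, hγ, AlgHom.id_apply]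

theorem tensParity_dHom (w : UniversalEnvelopingAlgebra ℂ (levi ξ₀)) :
    tensParity 𝔤 γ (dHom τ w) = dHom τ w := by
  have : (tensParity 𝔤 γ).comp (dHom τ) = dHom τ := by
    ext Y
    change tensParity 𝔤 γ (dHom τ (ι ℂ Y)) = dHom τ (ι ℂ Y)
    rw [dHom_iota, tensParity_dLie hγ]
  exact DFunLike.congr_fun this w

theorem gradedComm_dHom {D : UniversalEnvelopingAlgebra ℂ 𝔤 ⊗[ℂ] E}
    (hD : ∀ Y, comm (dLie τ Y) D = 0) (w : UniversalEnvelopingAlgebra ℂ (levi ξ₀)) :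
    gradedComm (tensParity 𝔤 γ) D (dHom τ w) = 0 := by
  rw [gradedComm_apply, tensParity_dHom hγ,
    mul_comm_of_iota (dHom τ) (fun Y => by rw [dHom_iota]; exact hD Y), sub_self]

end Grading

section Vacuum

variable {f : Module.Dual ℂ E}

/-- The form discards every term in which some `τ(Y)` stands at the left end, leaving only the
factors of `U(𝔥)`. -/
theorem slice_dHom_mul (hf : ∀ Y T, f (τ Y * T) = 0) (w : UniversalEnvelopingAlgebra ℂ (levi ξ₀))
    (z : UniversalEnvelopingAlgebra ℂ 𝔤 ⊗[ℂ] E) :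
    slice f (dHom τ w * z) = leviIncl ξ₀ w * slice f z := by
  induction w using env_induction generalizing z with
  | one => rw [map_one, map_one, one_mul, one_mul]
  | smul c u h => rw [map_smul, map_smul, smul_mul_assoc, smul_mul_assoc, map_smul, h]
  | add u v hu hv => rw [map_add, map_add, add_mul, add_mul, map_add, hu, hv]
  | mul Y u h =>
    have h1 : ∀ z, slice f (dLie τ Y * z) = ι ℂ (Y : 𝔤) * slice f z := fun z => by
      induction z using TensorProduct.induction_on with
      | zero => simp
      | tmul v T =>
        rw [dLie, add_mul, Algebra.TensorProduct.tmul_mul_tmul, Algebra.TensorProduct.tmul_mul_tmul,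
          map_add, slice_tmul, slice_tmul, slice_tmul, hf, zero_smul, add_zero, one_mul,
          mul_smul_comm]
      | add x y hx hy => rw [mul_add, map_add, hx, hy, map_add, mul_add]
    rw [map_mul (dHom τ), map_mul (leviIncl ξ₀), mul_assoc, dHom_iota, h1, h, leviIncl_iota, mul_assoc]

theorem slice_dHom (hf : ∀ Y T, f (τ Y * T) = 0) (hf1 : f 1 = 1)
    (w : UniversalEnvelopingAlgebra ℂ (levi ξ₀)) : slice f (dHom τ w) = leviIncl ξ₀ w := by
  have := slice_dHom_mul hf w 1
  rwa [mul_one, Algebra.TensorProduct.one_def, slice_tmul, hf1, one_smul, mul_one] at this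

/-- All terms that begin with `e_i` or `C`, or end with `C`, have zero expectation. What remains is
`γ(T) e_i` paired with `u X_i`, and `u X_i` lies in `U(𝔤) 𝔲`. -/
theorem slice_gradedComm_mem {γ : E →ₐ[ℂ] E} {x : Fin n → 𝔤} (hx : ∀ i, x i ∈ nilPos ξ₀)
    {e : Fin n → E} {C : E} (he : ∀ i T, f (e i * T) = 0) (hC : ∀ T, f (C * T) = 0)
    (hC' : ∀ T, f (T * C) = 0) (z : UniversalEnvelopingAlgebra ℂ 𝔤 ⊗[ℂ] E) :
    slice f (gradedComm (tensParity 𝔤 γ) (∑ i, ι ℂ (x i) ⊗ₜ[ℂ] e i + 1 ⊗ₜ[ℂ] C) z) ∈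
      envIdeal ξ₀ := by
  induction z using TensorProduct.induction_on with
  | zero => rw [map_zero, map_zero]; exact zero_mem _
  | tmul u T =>
    have h : slice f (gradedComm (tensParity 𝔤 γ)
        (∑ i, ι ℂ (x i) ⊗ₜ[ℂ] e i + 1 ⊗ₜ[ℂ] C) (u ⊗ₜ[ℂ] T)) =
        -∑ i, f (γ T * e i) • (u * ι ℂ (x i)) := by
      rw [gradedComm_apply, tensParity, Algebra.TensorProduct.map_tmul, AlgHom.id_apply, add_mul,
        mul_add, Finset.sum_mul, Finset.mul_sum]
      simp only [Algebra.TensorProduct.tmul_mul_tmul, map_sub, map_add, map_sum, slice_tmul, he, hC,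
        hC', zero_smul, Finset.sum_const_zero, add_zero, zero_sub]
    rw [h]
    exact neg_mem (sum_mem fun i _ => Submodule.smul_mem _ _
      (Submodule.mul_mem_mul trivial (iota_mem_iotaMap (hx i))))
  | add x y hx hy => rw [map_add, map_add]; exact add_mem hx hy

end Vacuum

section Contr

variable {B : LinearMap.BilinForm ℂ 𝔤}
  {X : Module.Basis (Fin n) ℂ (nilPos ξ₀)} {ξ : Module.Basis (Fin n) ℂ (nilNeg ξ₀)}

/-- The summand depends bilinearly on `(X j, ξ j)`: the derivative through `tr(· ad ξ j)`, the
operator `Q_j` through `X j`. Invariance of `∑ X j ⊗ ξ j` cancels the terms that move these vectors.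
-/
theorem comm_dLie_contr (hB : B.lieInvariant 𝔤)
    (hX : ∀ i j, B (X i : 𝔤) (ξ j : 𝔤) = if i = j then 1 else 0)
    (hξ₀ : ⨆ t : ℝ, (LieAlgebra.ad ℂ 𝔤 ξ₀).eigenspace (t : ℂ) = ⊤)
    (hK : ∀ i j, killingForm ℂ 𝔤 (X i) (ξ j) = if i = j then 1 else 0)
    {γ : E →ₐ[ℂ] E} (hγ : ∀ Y, γ (τ Y) = τ Y) (g : 𝔤 →ₗ[ℂ] E)
    (hg : ∀ (Y : levi ξ₀) x, comm (τ Y) (g x) = g ⁅(Y : 𝔤), x⁆) (Y : levi ξ₀)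
    (z : UniversalEnvelopingAlgebra ℂ 𝔤 ⊗[ℂ] E) :
    comm (dLie τ Y) (contr (mainFrame hξ₀ X ξ hK)
        (fun j => LinearMap.mulRight ℂ (g (X j)) ∘ₗ γ.toLinearMap) z) =
      contr (mainFrame hξ₀ X ξ hK) (fun j => LinearMap.mulRight ℂ (g (X j)) ∘ₗ γ.toLinearMap)
        (comm (dLie τ Y) z) := by
  induction z using TensorProduct.induction_on with
  | zero => simp only [map_zero]
  | tmul u T =>
    let β : 𝔤 →ₗ[ℂ] nilNeg ξ₀ →ₗ[ℂ] UniversalEnvelopingAlgebra ℂ 𝔤 ⊗[ℂ] E :=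
      LinearMap.mk₂ ℂ (fun x m => coder (LieAlgebra.ad ℂ 𝔤) (traceAd m) u ⊗ₜ[ℂ] (γ T * g x))
        (fun x y m => by rw [map_add, mul_add, TensorProduct.tmul_add])
        (fun c x m => by rw [map_smul, mul_smul_comm, TensorProduct.tmul_smul])
        (fun x m m' => by
          have : traceAd ((m + m' : nilNeg ξ₀) : 𝔤) = traceAd (m : 𝔤) + traceAd (m' : 𝔤) := by
            refine LinearMap.ext fun S => ?_
            rw [LinearMap.add_apply, traceAd_apply, traceAd_apply, traceAd_apply, ← map_add,
              ← mul_add, ← map_add]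
            rfl
          rw [this, coder_apply, slice_add, TensorProduct.add_tmul]; rfl)
        (fun c x m => by
          have : traceAd ((c • m : nilNeg ξ₀) : 𝔤) = c • traceAd (m : 𝔤) := by
            refine LinearMap.ext fun S => ?_
            rw [LinearMap.smul_apply, traceAd_apply, traceAd_apply, ← map_smul,
              ← mul_smul_comm, ← map_smul]
            rfl
          rw [this, coder_apply, slice_smul, ← TensorProduct.smul_tmul']; rfl)
    have h1 : ∀ j, comm (dLie τ Y) ((mainFrame hξ₀ X ξ hK).der j u ⊗ₜ[ℂ] (γ T * g (X j))) =
        (mainFrame hξ₀ X ξ hK).der j (comm (ι ℂ (Y : 𝔤)) u) ⊗ₜ[ℂ] (γ T * g (X j)) +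
        (mainFrame hξ₀ X ξ hK).der j u ⊗ₜ[ℂ] (γ (comm (τ Y) T) * g (X j)) +
        (β ⁅(Y : 𝔤), (X j : 𝔤)⁆ (ξ j) + β (X j) ⁅Y, ξ j⁆) := fun j => by
      have h2 : (mainFrame hξ₀ X ξ hK).der j (comm (ι ℂ (Y : 𝔤)) u) =
          comm (ι ℂ (Y : 𝔤)) ((mainFrame hξ₀ X ξ hK).der j u) -
            coder (LieAlgebra.ad ℂ 𝔤) (traceAd ⁅(Y : 𝔤), (ξ j : 𝔤)⁆) u :=
        coder_comm _ _ _ (fun S => traceAd_lie (Y : 𝔤) (ξ j : 𝔤) S) u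
      have h3 : γ (comm (τ Y) T) = comm (τ Y) (γ T) := by
        rw [comm_apply, comm_apply, map_sub, map_mul, map_mul, hγ]
      have h4 : β ⁅(Y : 𝔤), (X j : 𝔤)⁆ (ξ j) =
          (mainFrame hξ₀ X ξ hK).der j u ⊗ₜ[ℂ] (γ T * g ⁅(Y : 𝔤), (X j : 𝔤)⁆) := rfl
      have h5 : β (X j) ⁅Y, ξ j⁆ =
          coder (LieAlgebra.ad ℂ 𝔤) (traceAd ⁅(Y : 𝔤), (ξ j : 𝔤)⁆) u ⊗ₜ[ℂ] (γ T * g (X j)) := rfl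
      rw [dLie, comm_add_tmul, comm_mul, hg, h2, h3, h4, h5, TensorProduct.sub_tmul,
        TensorProduct.tmul_add]
      abel
    have h6 : ∀ v S, contr (mainFrame hξ₀ X ξ hK)
        (fun j => LinearMap.mulRight ℂ (g (X j)) ∘ₗ γ.toLinearMap) (v ⊗ₜ[ℂ] S) =
        ∑ j, (mainFrame hξ₀ X ξ hK).der j v ⊗ₜ[ℂ] (γ S * g (X j)) := fun v S =>
      contr_tmul _ _ _ _
    rw [h6, map_sum, Finset.sum_congr rfl fun j _ => h1 j, Finset.sum_add_distrib,
      sum_lie_add_lie hB hX β Y, add_zero, Finset.sum_add_distrib]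
    conv_rhs => rw [dLie, comm_add_tmul, map_add, h6, h6]
  | add x y hx hy => simp only [map_add, hx, hy]

end Contr

end Equivariance

/-! ### Cocycles -/

section Cocycles

open UniversalEnvelopingAlgebra (ι)

open Polynomial

section Vacuum
variable {L R M : Type*} [LieRing L] [LieAlgebra ℂ L] [Ring R] [Algebra ℂ R] [AddCommGroup M]
  [Module ℂ M] {n : ℕ}

theorem aeval_laplace_shiftPoly_mem (F : Frame L R n) {ξ : Module.Basis (Fin n) ℂ M}
    {φ : Fin n → Module.Dual ℂ M} (h : ∀ i j, φ i (ξ j) = if i = j then 1 else 0)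
    (C : Module.End ℂ (ExteriorAlgebra ℂ M)) (p : ℕ)
    (z : UniversalEnvelopingAlgebra ℂ L ⊗[ℂ] Module.End ℂ (ExteriorAlgebra ℂ M))
    (hz : z ∈ bfil (Module.End ℂ (ExteriorAlgebra ℂ M)) L (p + 1)) :
    aeval (laplace (gradedComm
      (Algebra.TensorProduct.map (AlgHom.id ℂ (UniversalEnvelopingAlgebra ℂ L)) (endParity M))
      (∑ i, ι ℂ (F.X i) ⊗ₜ[ℂ] extMul (ξ i) + 1 ⊗ₜ[ℂ] C)) (contr F fun j => intMul (φ j)))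
      (shiftPoly 1 (p + n)) z ∈
      Submodule.map₂ (TensorProduct.mk ℂ (UniversalEnvelopingAlgebra ℂ L) _) (F.typed p 0)
        (LinearMap.range (LinearMap.mul ℂ (ExteriorAlgebra ℂ M))) ⊔
      bfil (Module.End ℂ (ExteriorAlgebra ℂ M)) L p := by
  refine aeval_shiftPoly_mem (fun p u hu T => ?_) h hz
  rw [numOp_apply]
  refine laplace_sub_mem F (fun i j T => ?_) hu T
  rw [← h]
  exact extComm_intMul _ _ _

variable (M) in
/-- The vacuum expectation `T ↦ (T 1)_0`. -/
def vacuum : Module.Dual ℂ (Module.End ℂ (ExteriorAlgebra ℂ M)) :=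
  (ExteriorAlgebra.algebraMapInv (R := ℂ) (M := M)).toLinearMap ∘ₗ LinearMap.applyₗ 1

theorem vacuum_apply (T : Module.End ℂ (ExteriorAlgebra ℂ M)) :
    vacuum M T = ExteriorAlgebra.algebraMapInv (T 1) := rfl

theorem vacuum_one : vacuum M 1 = 1 := by
  rw [vacuum_apply, Module.End.one_apply, map_one]

theorem algebraMapInv_iota (m : M) :
    ExteriorAlgebra.algebraMapInv (ExteriorAlgebra.ι ℂ m) = (0 : ℂ) := by
  simp [ExteriorAlgebra.algebraMapInv]

theorem vacuum_extMul_mul (m : M) (T : Module.End ℂ (ExteriorAlgebra ℂ M)) :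
    vacuum M (extMul m * T) = 0 := by
  rw [vacuum_apply, Module.End.mul_apply, extMul_apply, map_mul, algebraMapInv_iota, zero_mul]

/-- A derivation extending an endomorphism of `M` annihilates constants and preserves the
augmentation ideal, so its values have no constant term. -/
theorem vacuum_extDer_mul (f : Module.End ℂ M) (T : Module.End ℂ (ExteriorAlgebra ℂ M)) :
    vacuum M (extDer f * T) = 0 := by
  rw [vacuum_apply, Module.End.mul_apply]
  generalize T 1 = x
  induction x using ExteriorAlgebra.induction with
  | algebraMap r => rw [extDer_algebraMap, map_zero]
  | ι m => rw [extDer_ι, algebraMapInv_iota]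
  | mul a b ha hb => rw [extDer_mul, map_add, map_mul, map_mul, ha, hb, zero_mul, mul_zero, add_zero]
  | add a b ha hb => rw [map_add, map_add, ha, hb, add_zero]

end Vacuum

variable {𝔤 : Type*} [LieRing 𝔤] [LieAlgebra ℂ 𝔤] {ξ₀ : 𝔤}

section Abstract

variable [FiniteDimensional ℂ 𝔤] [LieAlgebra.HasCentralRadical ℂ 𝔤]
  {E : Type*} [Ring E] [Algebra ℂ E] {τ : levi ξ₀ →ₗ⁅ℂ⁆ E} {n : ℕ}
  {B : LinearMap.BilinForm ℂ 𝔤}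
  {X : Module.Basis (Fin n) ℂ (nilPos ξ₀)} {ξ : Module.Basis (Fin n) ℂ (nilNeg ξ₀)}
  {f : Module.Dual ℂ E}

theorem dHom_injective (hf : ∀ Y T, f (τ Y * T) = 0) (hf1 : f 1 = 1) :
    Function.Injective (dHom τ) := fun w w' h => leviIncl_injective ξ₀ (by
  rw [← slice_dHom hf hf1, h, slice_dHom hf hf1])

/-- The coefficient algebra is kept abstract: only the relations between `τ`, `γ`, `g`, `f` and `D`,
together with the leading behaviour `hN` of the Laplacian, enter. -/
theorem exists_eq_dHom_add_gradedComm (hB : B.lieInvariant 𝔤)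
    (hX : ∀ i j, B (X i : 𝔤) (ξ j : 𝔤) = if i = j then 1 else 0)
    (hξ₀ : ⨆ t : ℝ, (LieAlgebra.ad ℂ 𝔤 ξ₀).eigenspace (t : ℂ) = ⊤)
    (hK : ∀ i j, killingForm ℂ 𝔤 (X i) (ξ j) = if i = j then 1 else 0)
    {γ : E →ₐ[ℂ] E} (hγ : ∀ Y, γ (τ Y) = τ Y) (hγ2 : ∀ T, γ (γ T) = T) (g : 𝔤 →ₗ[ℂ] E)
    (hg : ∀ (Y : levi ξ₀) x, comm (τ Y) (g x) = g ⁅(Y : 𝔤), x⁆)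
    (hf : ∀ Y T, f (τ Y * T) = 0) (hf1 : f 1 = 1) {D : UniversalEnvelopingAlgebra ℂ 𝔤 ⊗[ℂ] E}
    (hD : ∀ Y, comm (dLie τ Y) D = 0) (hγD : tensParity 𝔤 γ D = -D) (hD2 : D * D = 0)
    {W : Submodule ℂ E} (hW : ∀ Y : levi ξ₀, (Y : 𝔤) = ξ₀ → W ≤ 1 ⊔ negSpace (comm (τ Y)))
    (hN : ∀ p, ∀ z ∈ bfil E 𝔤 (p + 1), aeval (laplace (gradedComm (tensParity 𝔤 γ) D)
      (contr (mainFrame hξ₀ X ξ hK) (fun j => LinearMap.mulRight ℂ (g (X j)) ∘ₗ γ.toLinearMap)))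
        (shiftPoly 1 (p + n)) z ∈
      Submodule.map₂ (TensorProduct.mk ℂ (UniversalEnvelopingAlgebra ℂ 𝔤) E)
        ((mainFrame hξ₀ X ξ hK).typed p 0) W ⊔ bfil E 𝔤 p)
    {b : UniversalEnvelopingAlgebra ℂ 𝔤 ⊗[ℂ] E} (hb : ∀ Y, comm (dLie τ Y) b = 0)
    (hdb : gradedComm (tensParity 𝔤 γ) D b = 0) :
    ∃ w ∈ ZU (levi ξ₀), ∃ c, (∀ Y, comm (dLie τ Y) c = 0) ∧
      b = dHom τ w + gradedComm (tensParity 𝔤 γ) D c := by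
  have hΓ : ∀ z, tensParity 𝔤 γ (tensParity 𝔤 γ z) = z := fun z => by
    induction z using TensorProduct.induction_on with
    | zero => rw [map_zero, map_zero]
    | tmul u T =>
      rw [tensParity, Algebra.TensorProduct.map_tmul, Algebra.TensorProduct.map_tmul, hγ2,
        AlgHom.id_apply, AlgHom.id_apply]
    | add x y hx hy => rw [map_add, map_add, hx, hy]
  exact exists_eq_dHom_sub (mainFrame hξ₀ X ξ hK) rfl hW hN (gradedComm_gradedComm hΓ hγD hD2)
    (fun Y => comm_gradedComm (hD Y) (tensParity_dLie hγ Y))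
    (comm_dLie_contr hB hX hξ₀ hK hγ g hg) (gradedComm_dHom hγ hD) (contr_dHom _ rfl _)
    (dHom_injective hf hf1) hb hdb

end Abstract

end Cocycles

/-! ### The Dolbeault operator and the vacuum expectation -/

section DolbeaultVacuum

open UniversalEnvelopingAlgebra (ι)
open Polynomial

variable {𝔤 : Type*} [LieRing 𝔤] [LieAlgebra ℂ 𝔤] {ξ₀ : 𝔤}
variable {n : ℕ} {B : LinearMap.BilinForm ℂ 𝔤}
  {X : Module.Basis (Fin n) ℂ (nilPos ξ₀)} {ξ : Module.Basis (Fin n) ℂ (nilNeg ξ₀)}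

variable (ξ₀) in
theorem delta_eq_dHom : delta ξ₀ = dHom (leviAct ξ₀) := by
  refine (UniversalEnvelopingAlgebra.lift_unique ℂ _ _).1 ?_ |>.symm
  funext Y
  exact dHom_iota (leviAct ξ₀) Y

theorem cubic_one : cubic B X ξ 1 = 0 := by
  rw [cubic, LinearMap.sum_apply]
  refine Finset.sum_eq_zero fun i _ => ?_
  rw [LinearMap.sum_apply]
  refine Finset.sum_eq_zero fun j _ => ?_
  have : intProdLie B ξ₀ ⁅(X i : 𝔤), (X j : 𝔤)⁆ 1 = 0 := intProd_one _
  rw [Module.End.mul_apply, this, map_zero]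

theorem dolbeault_eq_sum_add : dolbeault B ξ₀ X ξ = ∑ i, ι ℂ (X i : 𝔤) ⊗ₜ[ℂ] extMul (ξ i) +
      1 ⊗ₜ[ℂ] (-(2⁻¹ : ℂ) • cubic B X ξ) := by
  rw [dolbeault_eq, TensorProduct.tmul_smul, neg_smul, sub_eq_add_neg]

/-- On the right, `cubic` acts on `1` through an interior product and gives zero; on the left, in
`vacuum_cubic_mul`, it begins with an exterior product and has no constant term. -/
theorem vacuum_mul_cubic (T : Module.End ℂ (ExtNeg ξ₀)) :
    vacuum (nilNeg ξ₀) (T * (-(2⁻¹ : ℂ) • cubic B X ξ)) = 0 := by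
  rw [mul_smul_comm, map_smul, vacuum_apply, Module.End.mul_apply, cubic_one, map_zero, map_zero,
    smul_zero]

theorem vacuum_cubic_mul (T : Module.End ℂ (ExtNeg ξ₀)) :
    vacuum (nilNeg ξ₀) ((-(2⁻¹ : ℂ) • cubic B X ξ) * T) = 0 := by
  rw [smul_mul_assoc, map_smul, cubic, Finset.sum_mul, map_sum, Finset.sum_eq_zero, smul_zero]
  intro i _
  rw [Finset.sum_mul, map_sum, Finset.sum_eq_zero]
  intro j _
  rw [mul_assoc, mul_assoc, vacuum_extMul_mul]

end DolbeaultVacuum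

/-! ### The cohomology of the Dolbeault operator -/

section Cohomology

open UniversalEnvelopingAlgebra (ι)

variable {𝔤 : Type*} [LieRing 𝔤] [LieAlgebra ℂ 𝔤] {ξ₀ : 𝔤} {n : ℕ} {B : LinearMap.BilinForm ℂ 𝔤}
  {X : Module.Basis (Fin n) ℂ (nilPos ξ₀)} {ξ : Module.Basis (Fin n) ℂ (nilNeg ξ₀)}

theorem vacuum_leviAct_mul (Y : levi ξ₀) (T : Module.End ℂ (ExtNeg ξ₀)) :
    vacuum (nilNeg ξ₀) (leviAct ξ₀ Y * T) = 0 := vacuum_extDer_mul _ T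

theorem slice_gradedComm_dolbeault_mem (b : BigAlg ξ₀) :
    slice (vacuum (nilNeg ξ₀)) (gradedComm (parity ξ₀) (dolbeault B ξ₀ X ξ) b) ∈
      envIdeal ξ₀ := by
  rw [dolbeault_eq_sum_add]
  exact slice_gradedComm_mem (fun i => (X i).2) (fun i => vacuum_extMul_mul (ξ i)) vacuum_cubic_mul
    vacuum_mul_cubic b

theorem slice_dHom_leviAct (w : UniversalEnvelopingAlgebra ℂ (levi ξ₀)) :
    slice (vacuum (nilNeg ξ₀)) (dHom (leviAct ξ₀) w) = leviIncl ξ₀ w :=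
  slice_dHom vacuum_leviAct_mul vacuum_one w

theorem delta_mem_kerD (hB : B.lieInvariant 𝔤)
    (hX : ∀ i j, B (X i : 𝔤) (ξ j : 𝔤) = if i = j then 1 else 0)
    {w : UniversalEnvelopingAlgebra ℂ (levi ξ₀)} (hw : w ∈ ZU (levi ξ₀)) :
    dHom (leviAct ξ₀) w ∈ kerD (dolbeault B ξ₀ X ξ) := by
  refine ⟨mem_invAlg_iff.2 fun Y => ?_, ?_⟩
  · have h : comm (ι ℂ Y) w = 0 := by
      rw [comm_apply, Subalgebra.mem_center_iff.1 hw, sub_self]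
    exact (comm_dLie_dHom (leviAct ξ₀) Y w).trans (by rw [h, map_zero])
  · exact gradedComm_dHom (γ := endParity (nilNeg ξ₀)) (fun Y => endParity_extDer _)
      (mem_invAlg_iff.1 (dolbeault_mem_invAlg hB hX)) w

theorem imComm_le_kerComm {A : Type*} [Ring A] [Algebra ℂ A] {S : Subalgebra ℂ A} {γ : A →ₐ[ℂ] A}
    {a : A} (hγ : ∀ b, γ (γ b) = b) (hS : ∀ b ∈ S, γ b ∈ S) (ha : γ a = -a) (ha2 : a * a = 0)
    (haS : a ∈ S) : imComm S γ a ≤ Subalgebra.toSubmodule (kerComm S γ a) := by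
  rintro _ ⟨b, hb, rfl⟩
  refine ⟨?_, gradedComm_gradedComm hγ ha ha2 b⟩
  rw [gradedComm_apply]
  exact S.sub_mem (S.mul_mem haS hb) (S.mul_mem (hS b hb) haS)

theorem imD_le_kerD (hB : B.lieInvariant 𝔤)
    (hX : ∀ i j, B (X i : 𝔤) (ξ j : 𝔤) = if i = j then 1 else 0) :
    imD (dolbeault B ξ₀ X ξ) ≤ Subalgebra.toSubmodule (kerD (dolbeault B ξ₀ X ξ)) :=
  imComm_le_kerComm (parity_parity ξ₀) (parity_mem_invAlg ξ₀) (parity_dolbeault B ξ₀ X ξ)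
    (dolbeault_mul_dolbeault hX) (dolbeault_mem_invAlg hB hX)

theorem slice_mem_of_mem_imD {b : BigAlg ξ₀} (hb : b ∈ imD (dolbeault B ξ₀ X ξ)) :
    slice (vacuum (nilNeg ξ₀)) b ∈ pbwCompl ξ₀ := by
  obtain ⟨c, -, rfl⟩ := hb
  exact (le_sup_right : envIdeal ξ₀ ≤ pbwCompl ξ₀) (slice_gradedComm_dolbeault_mem c)

/-- The homomorphism from `Z(𝔥)` to the cohomology. -/
def cohHom (hB : B.lieInvariant 𝔤)
    (hX : ∀ i j, B (X i : 𝔤) (ξ j : 𝔤) = if i = j then 1 else 0) :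
    ZU (levi ξ₀) →ₐ[ℂ] Coh (dolbeault B ξ₀ X ξ) (parity_dolbeault B ξ₀ X ξ) :=
  (cohClass _ (parity_dolbeault B ξ₀ X ξ)).comp
    (((dHom (leviAct ξ₀)).comp (ZU (levi ξ₀)).val).codRestrict (kerD (dolbeault B ξ₀ X ξ))
      fun w => delta_mem_kerD hB hX w.2)

theorem cohHom_apply (hB : B.lieInvariant 𝔤)
    (hX : ∀ i j, B (X i : 𝔤) (ξ j : 𝔤) = if i = j then 1 else 0) (w : ZU (levi ξ₀))
    (hw : delta ξ₀ w ∈ kerD (dolbeault B ξ₀ X ξ)) :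
    cohHom hB hX w = cohClass _ (parity_dolbeault B ξ₀ X ξ) ⟨delta ξ₀ w, hw⟩ := by
  have h : (⟨delta ξ₀ w, hw⟩ : kerD (dolbeault B ξ₀ X ξ)) =
      ⟨dHom (leviAct ξ₀) w, delta_mem_kerD hB hX w.2⟩ :=
    Subtype.ext (DFunLike.congr_fun (delta_eq_dHom ξ₀) _)
  rw [h]; rfl

/-- Cohomologous elements differ by a coboundary, whose vacuum expectation lies in `U(𝔤) 𝔲`; the
expectations of `δ(w)` and `z ⊗ 1` are `w` and `z`. This yields the projection formula for `ζ`. -/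
theorem leviIncl_sub_mem_pbwCompl (hB : B.lieInvariant 𝔤)
    (hX : ∀ i j, B (X i : 𝔤) (ξ j : 𝔤) = if i = j then 1 else 0) {w : ZU (levi ξ₀)} {z : ZU 𝔤}
    (h : cohHom hB hX w =
      cohClass _ (parity_dolbeault B ξ₀ X ξ) (centerToKer (dolbeault B ξ₀ X ξ) z)) :
    leviIncl ξ₀ w - z ∈ pbwCompl ξ₀ := by
  have h1 := slice_mem_of_mem_imD ((cohClass_eq_iff _ (parity_dolbeault B ξ₀ X ξ)
    ⟨dHom (leviAct ξ₀) w, delta_mem_kerD hB hX w.2⟩ (centerToKer _ z)).1 h)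
  have h2 : slice (vacuum (nilNeg ξ₀))
      (centerToKer (dolbeault B ξ₀ X ξ) z : BigAlg ξ₀) = z := by
    change slice (vacuum (nilNeg ξ₀))
      ((z : UniversalEnvelopingAlgebra ℂ 𝔤) ⊗ₜ[ℂ] (1 : Module.End ℂ (ExtNeg ξ₀))) = z
    rw [slice_tmul, vacuum_one, one_smul]
  rwa [map_sub, slice_dHom_leviAct, h2] at h1

theorem zeta_eq {p : UniversalEnvelopingAlgebra ℂ 𝔤 →ₗ[ℂ] UniversalEnvelopingAlgebra ℂ (levi ξ₀)}
    (hp : IsPBWProj ξ₀ p) (hB : B.lieInvariant 𝔤)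
    (hX : ∀ i j, B (X i : 𝔤) (ξ j : 𝔤) = if i = j then 1 else 0)
    {e : ZU (levi ξ₀) ≃ₐ[ℂ] Coh (dolbeault B ξ₀ X ξ) (parity_dolbeault B ξ₀ X ξ)}
    (he : ∀ w, e w = cohHom hB hX w) (z : ZU 𝔤) :
    (zeta _ (parity_dolbeault B ξ₀ X ξ) e z : UniversalEnvelopingAlgebra ℂ (levi ξ₀)) = p z := by
  have h1 : cohHom hB hX (zeta _ (parity_dolbeault B ξ₀ X ξ) e z) =
      cohClass _ (parity_dolbeault B ξ₀ X ξ) (centerToKer (dolbeault B ξ₀ X ξ) z) := by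
    rw [← he]
    exact e.apply_symm_apply _
  have h := hp.2 _ (leviIncl_sub_mem_pbwCompl hB hX h1)
  rwa [map_sub, hp.1, sub_eq_zero] at h

variable [FiniteDimensional ℂ 𝔤] [LieAlgebra.HasCentralRadical ℂ 𝔤]

/-- Invariant cocycles. -/
theorem exists_eq_delta_add (hB : B.lieInvariant 𝔤)
    (hX : ∀ i j, B (X i : 𝔤) (ξ j : 𝔤) = if i = j then 1 else 0)
    (hξ₀ : ⨆ t : ℝ, (LieAlgebra.ad ℂ 𝔤 ξ₀).eigenspace (t : ℂ) = ⊤)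
    (hK : ∀ i j, killingForm ℂ 𝔤 (X i) (ξ j) = if i = j then 1 else 0) {b : BigAlg ξ₀}
    (hb : ∀ Y, comm (deltaLie ξ₀ Y) b = 0)
    (hdb : gradedComm (parity ξ₀) (dolbeault B ξ₀ X ξ) b = 0) :
    ∃ w ∈ ZU (levi ξ₀), ∃ c, (∀ Y, comm (deltaLie ξ₀ Y) c = 0) ∧
      b = dHom (leviAct ξ₀) w + gradedComm (parity ξ₀) (dolbeault B ξ₀ X ξ) c := by
  have hN := aeval_laplace_shiftPoly_mem (mainFrame hξ₀ X ξ hK) (ξ := ξ)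
    (φ := fun i => formNeg B ξ₀ (X i)) hX (-(2⁻¹ : ℂ) • cubic B X ξ)
  exact exists_eq_dHom_add_gradedComm (τ := leviAct ξ₀) (γ := endParity (nilNeg ξ₀))
    (f := vacuum (nilNeg ξ₀)) (D := dolbeault B ξ₀ X ξ)
    (W := LinearMap.range (LinearMap.mul ℂ (ExtNeg ξ₀))) hB hX hξ₀ hK
    (fun Y => endParity_extDer _) endParity_endParity (intProdHom ξ₀ B)
    (comm_leviAct_intProdLie hB) vacuum_leviAct_mul vacuum_one
    (mem_invAlg_iff.1 (dolbeault_mem_invAlg hB hX)) (parity_dolbeault B ξ₀ X ξ)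
    (dolbeault_mul_dolbeault hX)
    (by rintro Y hY _ ⟨x, rfl⟩; exact mulLeft_mem_one_sup_negSpace hY x)
    (by rw [dolbeault_eq_sum_add]; exact hN) hb hdb

/-- The vacuum expectation recovers the image of `w` and puts it in the complement of `U(𝔥)`, so
that image vanishes; injectivity of `U(𝔥) → U(𝔤)` concludes. -/
theorem eq_zero_of_dHom_mem_imD
    (hξ₀ : ⨆ t : ℝ, (LieAlgebra.ad ℂ 𝔤 ξ₀).eigenspace (t : ℂ) = ⊤)
    (hK : ∀ i j, killingForm ℂ 𝔤 (X i) (ξ j) = if i = j then 1 else 0)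
    {w : UniversalEnvelopingAlgebra ℂ (levi ξ₀)}
    (hw : dHom (leviAct ξ₀) w ∈ imD (dolbeault B ξ₀ X ξ)) : w = 0 := by
  have h := slice_mem_of_mem_imD hw
  rw [slice_dHom_leviAct] at h
  refine leviIncl_injective ξ₀ ?_
  rw [map_zero]
  exact Submodule.disjoint_def.1 (isCompl_pbwCompl hξ₀ X ξ hK).disjoint _ ⟨w, rfl⟩ h

theorem dHom_sup_imD (hB : B.lieInvariant 𝔤)
    (hX : ∀ i j, B (X i : 𝔤) (ξ j : 𝔤) = if i = j then 1 else 0)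
    (hξ₀ : ⨆ t : ℝ, (LieAlgebra.ad ℂ 𝔤 ξ₀).eigenspace (t : ℂ) = ⊤)
    (hK : ∀ i j, killingForm ℂ 𝔤 (X i) (ξ j) = if i = j then 1 else 0) :
    (Subalgebra.toSubmodule (ZU (levi ξ₀))).map (dHom (leviAct ξ₀)).toLinearMap ⊔
      imD (dolbeault B ξ₀ X ξ) = Subalgebra.toSubmodule (kerD (dolbeault B ξ₀ X ξ)) := by
  refine le_antisymm (sup_le ?_ (imD_le_kerD hB hX)) ?_
  · rintro _ ⟨w, hw, rfl⟩
    exact delta_mem_kerD hB hX hw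
  · rintro b ⟨hb, hdb⟩
    obtain ⟨w, hw, c, hc, rfl⟩ := exists_eq_delta_add hB hX hξ₀ hK (mem_invAlg_iff.1 hb) hdb
    exact Submodule.add_mem_sup ⟨w, hw, rfl⟩ ⟨c, mem_invAlg_iff.2 hc, rfl⟩

variable (ξ₀) in
theorem exists_isPBWProj (h : IsCompl (LinearMap.range (leviIncl ξ₀).toLinearMap) (pbwCompl ξ₀)) :
    ∃ p, IsPBWProj ξ₀ p := by
  let l := LinearEquiv.ofInjective (leviIncl ξ₀).toLinearMap (leviIncl_injective ξ₀)
  refine ⟨l.symm.toLinearMap ∘ₗ Submodule.projectionOnto _ _ h, fun w => ?_, fun x hx => ?_⟩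
  · rw [LinearMap.comp_apply, LinearEquiv.coe_coe, LinearEquiv.symm_apply_eq]
    exact Submodule.projectionOnto_apply_left h ⟨leviIncl ξ₀ w, w, rfl⟩
  · rw [LinearMap.comp_apply, (Submodule.projectionOnto_apply_eq_zero_iff h).2 hx, map_zero]

theorem cohHom_bijective (hB : B.lieInvariant 𝔤)
    (hX : ∀ i j, B (X i : 𝔤) (ξ j : 𝔤) = if i = j then 1 else 0)
    (hξ₀ : ⨆ t : ℝ, (LieAlgebra.ad ℂ 𝔤 ξ₀).eigenspace (t : ℂ) = ⊤)
    (hK : ∀ i j, killingForm ℂ 𝔤 (X i) (ξ j) = if i = j then 1 else 0) :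
    Function.Bijective (cohHom hB hX) := by
  constructor
  · refine (injective_iff_map_eq_zero _).2 fun w hw => Subtype.ext ?_
    refine eq_zero_of_dHom_mem_imD hξ₀ hK (B := B) ?_
    have h := (cohClass_eq_iff _ (parity_dolbeault B ξ₀ X ξ)
      ⟨dHom (leviAct ξ₀) w, delta_mem_kerD hB hX w.2⟩ 0).1 (hw.trans (map_zero _).symm)
    rwa [ZeroMemClass.coe_zero, sub_zero] at h
  · intro q
    obtain ⟨b, rfl⟩ := RingCon.mkₐ_surjective (α := ℂ) _ q
    have hb : (b : BigAlg ξ₀) ∈ Subalgebra.toSubmodule (kerD (dolbeault B ξ₀ X ξ)) := b.2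
    rw [← dHom_sup_imD hB hX hξ₀ hK] at hb
    obtain ⟨_, ⟨w, hw, rfl⟩, c, hc, hbc⟩ := Submodule.mem_sup.1 hb
    refine ⟨⟨w, hw⟩, (cohClass_eq_iff _ (parity_dolbeault B ξ₀ X ξ)
      ⟨dHom (leviAct ξ₀) w, delta_mem_kerD hB hX hw⟩ b).2 ?_⟩
    rw [← hbc]
    change dHom (leviAct ξ₀) w - (dHom (leviAct ξ₀) w + c) ∈ _
    rw [sub_add_cancel_left]
    exact neg_mem hc

theorem disjoint_delta_imD
    (hξ₀ : ⨆ t : ℝ, (LieAlgebra.ad ℂ 𝔤 ξ₀).eigenspace (t : ℂ) = ⊤)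
    (hK : ∀ i j, killingForm ℂ 𝔤 (X i) (ξ j) = if i = j then 1 else 0) :
    Disjoint ((Subalgebra.toSubmodule (ZU (levi ξ₀))).map (delta ξ₀).toLinearMap)
      (imD (dolbeault B ξ₀ X ξ)) := by
  rw [Submodule.disjoint_def, delta_eq_dHom]
  rintro _ ⟨w, hw, rfl⟩ h
  have : w = 0 := eq_zero_of_dHom_mem_imD hξ₀ hK h
  rw [this, map_zero]

theorem delta_sup_imD (hB : B.lieInvariant 𝔤)
    (hX : ∀ i j, B (X i : 𝔤) (ξ j : 𝔤) = if i = j then 1 else 0)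
    (hξ₀ : ⨆ t : ℝ, (LieAlgebra.ad ℂ 𝔤 ξ₀).eigenspace (t : ℂ) = ⊤)
    (hK : ∀ i j, killingForm ℂ 𝔤 (X i) (ξ j) = if i = j then 1 else 0) :
    (Subalgebra.toSubmodule (ZU (levi ξ₀))).map (delta ξ₀).toLinearMap ⊔
      imD (dolbeault B ξ₀ X ξ) = Subalgebra.toSubmodule (kerD (dolbeault B ξ₀ X ξ)) := by
  rw [delta_eq_dHom]
  exact dHom_sup_imD hB hX hξ₀ hK

theorem exists_coh_equiv (hB : B.lieInvariant 𝔤)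
    (hX : ∀ i j, B (X i : 𝔤) (ξ j : 𝔤) = if i = j then 1 else 0)
    (hξ₀ : ⨆ t : ℝ, (LieAlgebra.ad ℂ 𝔤 ξ₀).eigenspace (t : ℂ) = ⊤)
    (hK : ∀ i j, killingForm ℂ 𝔤 (X i) (ξ j) = if i = j then 1 else 0) :
    ∃ e : ZU (levi ξ₀) ≃ₐ[ℂ] Coh (dolbeault B ξ₀ X ξ) (parity_dolbeault B ξ₀ X ξ),
      ∀ w, e w = cohHom hB hX w :=
  ⟨AlgEquiv.ofBijective _ (cohHom_bijective hB hX hξ₀ hK), fun _ => rfl⟩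

theorem exists_pbwProj_zeta
    (h : IsCompl (LinearMap.range (leviIncl ξ₀).toLinearMap) (pbwCompl ξ₀)) (hB : B.lieInvariant 𝔤)
    (hX : ∀ i j, B (X i : 𝔤) (ξ j : 𝔤) = if i = j then 1 else 0)
    {e : ZU (levi ξ₀) ≃ₐ[ℂ] Coh (dolbeault B ξ₀ X ξ) (parity_dolbeault B ξ₀ X ξ)}
    (he : ∀ w, e w = cohHom hB hX w) :
    ∃ p : UniversalEnvelopingAlgebra ℂ 𝔤 →ₗ[ℂ] UniversalEnvelopingAlgebra ℂ (levi ξ₀),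
      IsPBWProj ξ₀ p ∧ ∀ z : ZU 𝔤, (zeta _ (parity_dolbeault B ξ₀ X ξ) e z :
        UniversalEnvelopingAlgebra ℂ (levi ξ₀)) = p z :=
  (exists_isPBWProj ξ₀ h).imp fun _ hp => ⟨hp, zeta_eq hp hB hX he⟩

end Cohomology

end Dolbeault

end

theorem mainTheorem5 {𝔤 : Type*} [LieRing 𝔤] [LieAlgebra ℂ 𝔤] [FiniteDimensional ℂ 𝔤]
    -- `𝔤` is reductive
    [LieAlgebra.HasCentralRadical ℂ 𝔤]
    -- `B` is an invariant form which is the Killing form on the derived algebra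
    (B : LinearMap.BilinForm ℂ 𝔤) (hBinv : B.lieInvariant 𝔤)
    (hB : ∀ x y : LieAlgebra.derivedSeries ℂ 𝔤 1,
      B x y = killingForm ℂ (LieAlgebra.derivedSeries ℂ 𝔤 1) x y)
    -- `ad ξ₀` is diagonalizable with real eigenvalues
    (ξ₀ : 𝔤)
    (hξ₀ : ⨆ t : ℝ, (LieAlgebra.ad ℂ 𝔤 ξ₀).eigenspace (t : ℂ) = ⊤)
    {n : ℕ} (X : Module.Basis (Fin n) ℂ (Dolbeault.nilPos ξ₀)) :
    -- the basis of `𝔲` has a unique dual basis in `𝔲bar`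
    ∃ ξ : Module.Basis (Fin n) ℂ (Dolbeault.nilNeg ξ₀),
      (∀ i j, B (X i : 𝔤) (ξ j : 𝔤) = if i = j then 1 else 0) ∧
      (∀ ξ' : Fin n → Dolbeault.nilNeg ξ₀,
        (∀ i j, B (X i : 𝔤) (ξ' j : 𝔤) = if i = j then 1 else 0) → ξ' = ξ) ∧
      -- the operator is an invariant (odd) element of square zero
      Dolbeault.dolbeault B ξ₀ X ξ ∈ Dolbeault.invAlg ξ₀ ∧
      Dolbeault.dolbeault B ξ₀ X ξ * Dolbeault.dolbeault B ξ₀ X ξ = 0 ∧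
      -- `ker d = δ(Z(𝔥)) ⊕ im d`
      Disjoint ((Subalgebra.toSubmodule (Dolbeault.ZU (Dolbeault.levi ξ₀))).map
          (Dolbeault.delta ξ₀).toLinearMap)
        (Dolbeault.imD (Dolbeault.dolbeault B ξ₀ X ξ)) ∧
      (Subalgebra.toSubmodule (Dolbeault.ZU (Dolbeault.levi ξ₀))).map
          (Dolbeault.delta ξ₀).toLinearMap ⊔
        Dolbeault.imD (Dolbeault.dolbeault B ξ₀ X ξ) =
        Subalgebra.toSubmodule (Dolbeault.kerD (Dolbeault.dolbeault B ξ₀ X ξ)) ∧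
      -- `U(𝔤) = U(𝔥) ⊕ (𝔲bar U(𝔤) + U(𝔤) 𝔲)`
      Function.Injective (Dolbeault.leviIncl ξ₀) ∧
      IsCompl (LinearMap.range (Dolbeault.leviIncl ξ₀).toLinearMap) (Dolbeault.pbwCompl ξ₀) ∧
      -- `δ` induces an isomorphism `Z(𝔥) ≃ H`, and the resulting `ζ` is the projection `p`
      ∃ e : Dolbeault.ZU (Dolbeault.levi ξ₀) ≃ₐ[ℂ]
          Dolbeault.Coh (Dolbeault.dolbeault B ξ₀ X ξ) (Dolbeault.parity_dolbeault B ξ₀ X ξ),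
        (∀ (w : Dolbeault.ZU (Dolbeault.levi ξ₀))
            (hw : Dolbeault.delta ξ₀ w ∈ Dolbeault.kerD (Dolbeault.dolbeault B ξ₀ X ξ)),
          e w = Dolbeault.cohClass _ (Dolbeault.parity_dolbeault B ξ₀ X ξ)
            ⟨Dolbeault.delta ξ₀ w, hw⟩) ∧
        ∃ p : UniversalEnvelopingAlgebra ℂ 𝔤 →ₗ[ℂ]
            UniversalEnvelopingAlgebra ℂ (Dolbeault.levi ξ₀),
          Dolbeault.IsPBWProj ξ₀ p ∧
          ∀ z : Dolbeault.ZU 𝔤,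
            (Dolbeault.zeta _ (Dolbeault.parity_dolbeault B ξ₀ X ξ) e z :
              UniversalEnvelopingAlgebra ℂ (Dolbeault.levi ξ₀)) = p z := by
  refine (Dolbeault.exists_dual_basis hBinv hB hξ₀ X).imp fun ξ h => ?_
  have hX := h.1
  -- The derivatives on `U(𝔤)` use the Killing form, the interior products use `B`. Both forms give
  -- the same pairing with `𝔲bar`, so one dual basis serves both.
  have hK : ∀ i j, killingForm ℂ 𝔤 (X i) (ξ j) = if i = j then 1 else 0 := fun i j => by
    rw [← hX, Dolbeault.form_eq_killingForm hBinv hB hξ₀ _ (ξ j).2]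
  have hcompl := Dolbeault.isCompl_pbwCompl hξ₀ X ξ hK
  exact ⟨hX, h.2, Dolbeault.dolbeault_mem_invAlg hBinv hX,
    Dolbeault.dolbeault_mul_dolbeault hX, Dolbeault.disjoint_delta_imD hξ₀ hK,
    Dolbeault.delta_sup_imD hBinv hX hξ₀ hK, Dolbeault.leviIncl_injective ξ₀, hcompl,
    (Dolbeault.exists_coh_equiv hBinv hX hξ₀ hK).imp fun e he =>
      ⟨fun w hw => (he w).trans (Dolbeault.cohHom_apply hBinv hX w hw),
        Dolbeault.exists_pbwProj_zeta hcompl hBinv hX he⟩⟩
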